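/- **Setting.** Let $\operatorname{Diff}(S^1)$ be the group of orientation preserving $C^\infty$ diffeomorphisms of the circle, $\operatorname{Möb}(S^1)$ the subgroup of the maps $z\mapsto (az+b)/(\bar b z+\bar a)$, $|a|^2-|b|^2=1$, and $M=\operatorname{Diff}(S^1)/\operatorname{Möb}(S^1)$ the space of cosets $[\varphi]=\operatorname{Möb}(S^1)\circ\varphi$, on which $\operatorname{Diff}(S^1)$ acts by right translations. *The metric $g$.* A tangent vector of $M$ at the origin is a smooth real vector field $v=u(\theta)\,\partial/\partial\theta$ on $S^1$, $u(\theta)=\sum_m v_m e^{im\theta}$, modulo those with $v_m=0$ for all $|m|\ge 2$. There $$g(v,w)=\sum_{m\ge 2} v_m\,\overline{w_m}\,(m^3-m),$$ and $g$ is transported to all of $M$ by right translations: a tangent vector at $[\varphi]$ that is the velocity at $t=0$ of a smooth curve $\varphi_t$ with $\varphi_0=\varphi$ is identified with the vector field which is the velocity at $t=0$ of $\varphi_t\circ\varphi^{-1}$. *The Siegel disc and the metric $h$.* Let $W_\pm$ be the Hilbert spaces with orthonormal bases $e_p=e^{ip\theta}/\sqrt p$ and $e_{-p}=e^{-ip\theta}/\sqrt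 p$ ($p\ge 1$) respectively, so that $W_+\oplus W_-$ is a completion of $V_{\mathbb C}=C^\infty(S^1,\mathbb C)/\mathbb C$. The Siegel disc $D_\infty$ is the set of the Hilbert–Schmidt operators $Z:W_+\to W_-$ that are symmetric, $\langle e_{-p},Ze_q\rangle=\langle e_{-q},Ze_p\rangle$ for all $p,q$, and for which $I-Z\bar Z$ is positive definite; here $\bar Z x=\overline{Z\bar x}$. It carries the Siegel symplectic metric $$h_Z(\phi,\psi)=\operatorname{trace}\bigl((I-Z\bar Z)^{-1}\phi\,(I-\bar Z Z)^{-1}\bar\psi\bigr),$$ which is $\operatorname{trace}(\phi\circ\bar\psi)$ at the origin $Z=0$. **Theorem.** There is a map $\Pi:M\to D_\infty$ such that, for every $\varphi\in\operatorname{Diff}(S^1)$, the graph of $\Pi[\varphi]$ is the closure in $W_+\oplus W_-$ of the set of the classes of $\sigma\circ\varphi$, where $\sigma$ runs over the smooth functions on $S^1$ whose Fourier coefficients of negative index vanish. This $\Pi$ is a smooth immersion: for each smooth curve $\varphi_t$ in $\operatorname{Diff}(S^1)$, the curve $t\mapsto\Pi[\varphi_t]$ is $C^\infty$ in the Hilbert–Schmidt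 norm, and its derivative at $t=0$ vanishes if and only if the tangent vector of $M$ defined by $\varphi_t$ at $t=0$ is zero. It pulls the Siegel metric $h$ back to the homogeneous metric $g$, up to the normalization of the metrics: for all tangent vectors $v,w$ of $M$ at any point $x\in M$, the trace defining $h_{\Pi(x)}(d\Pi\,v,d\Pi\,w)$ and the series defining $g(v,w)$ converge absolutely, and $$h_{\Pi(x)}(d\Pi\,v,d\Pi\,w)=\tfrac16\,g(w,v)=\tfrac16\,\overline{g(v,w)}.$$ In particular $\operatorname{Re}h(d\Pi\,v,d\Pi\,w)=\frac16\operatorname{Re}g(v,w)$, that is, $\Pi$ is an isometric immersion of $(M,g)$ into $(D_\infty,6h)$. -/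

import Mathlib

open scoped Manifold ContDiff ComplexConjugate InnerProductSpace

namespace CirclePeriod

noncomputable section

/-! ## The group `Diff(S¹)`, the Möbius subgroup, and `M = Diff(S¹)/Möb(S¹)` -/

/-- A self-map of the circle preserves the orientation if it lifts to a continuous strictly
increasing map of the angle. -/
def PreservesOrientation (f : Circle → Circle) : Prop :=
  ∃ F : ℝ → ℝ, Continuous F ∧ StrictMono F ∧ ∀ x : ℝ, f (Circle.exp x) = Circle.exp (F x)

theorem PreservesOrientation.comp {f g : Circle → Circle} (hf : PreservesOrientation f)
    (hg : PreservesOrientation g) : PreservesOrientation (f ∘ g) := by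
  obtain ⟨F, hFc, hFm, hF⟩ := hf
  obtain ⟨G, hGc, hGm, hG⟩ := hg
  exact ⟨F ∘ G, hFc.comp hGc, hFm.comp hGm, fun x => by simp [hG, hF]⟩

theorem PreservesOrientation.symm {f : Equiv.Perm Circle} (hf : PreservesOrientation f) :
    PreservesOrientation f.symm := by
  obtain ⟨F, hFc, hFm, hF⟩ := hf
  -- the increment of `F` over one period is at least `2π`
  have step : ∀ x, F x + 2 * Real.pi ≤ F (x + 2 * Real.pi) := by
    intro x
    have h1 : Circle.exp (F (x + 2 * Real.pi)) = Circle.exp (F x) := by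
      rw [← hF, ← hF, Circle.exp_add, Circle.exp_two_pi, mul_one]
    obtain ⟨m, hm⟩ := Circle.exp_eq_exp.1 h1
    have h2 : F x < F (x + 2 * Real.pi) := hFm (by linarith [Real.pi_pos])
    have h3 : (0 : ℝ) < m := by
      by_contra hcon
      nlinarith [Real.pi_pos, not_lt.1 hcon]
    have h4 : (1 : ℝ) ≤ m := by
      have : (0 : ℤ) < m := by exact_mod_cast h3
      exact_mod_cast this
    nlinarith [Real.pi_pos]
  have up : ∀ n : ℕ, F 0 + n * (2 * Real.pi) ≤ F (n * (2 * Real.pi)) := by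
    intro n
    induction n with
    | zero => simp
    | succ k ih =>
      have := step (k * (2 * Real.pi))
      push_cast
      rw [show ((k : ℝ) + 1) * (2 * Real.pi) = k * (2 * Real.pi) + 2 * Real.pi by ring]
      linarith
  have down : ∀ n : ℕ, F (-(n * (2 * Real.pi))) ≤ F 0 - n * (2 * Real.pi) := by
    intro n
    induction n with
    | zero => simp
    | succ k ih =>
      have := step (-(((k : ℝ) + 1) * (2 * Real.pi)))
      rw [show -(((k : ℝ) + 1) * (2 * Real.pi)) + 2 * Real.pi = -(k * (2 * Real.pi)) by ring]
        at this
      push_cast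
      linarith
  have hsurj : Function.Surjective F := by
    intro y
    obtain ⟨n, hn⟩ := exists_nat_ge (|y - F 0| / (2 * Real.pi))
    have hpi : (0 : ℝ) < 2 * Real.pi := by linarith [Real.pi_pos]
    have hn' : |y - F 0| ≤ n * (2 * Real.pi) := (div_le_iff₀ hpi).1 hn
    obtain ⟨h1, h2⟩ := abs_le.1 hn'
    exact mem_range_of_exists_le_of_exists_ge hFc
      ⟨_, (down n).trans (by linarith)⟩ ⟨_, le_trans (by linarith) (up n)⟩
  let E : ℝ ≃o ℝ := StrictMono.orderIsoOfSurjective F hFm hsurj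
  have hE : ∀ x, F (E.symm x) = x := fun x => E.apply_symm_apply x
  refine ⟨E.symm, E.symm.continuous, E.symm.strictMono, fun x => ?_⟩
  rw [Equiv.symm_apply_eq, hF, hE]

/-- `Diff(S¹)`: the group (under composition) of the orientation preserving `C^∞`
diffeomorphisms of the circle. -/
def DiffCircle : Subgroup (Equiv.Perm Circle) where
  carrier := {f | ContMDiff (𝓡 1) (𝓡 1) ∞ f ∧ ContMDiff (𝓡 1) (𝓡 1) ∞ f.symm ∧
    PreservesOrientation f}
  one_mem' := ⟨contMDiff_id, contMDiff_id, id, continuous_id, strictMono_id, fun _ => rfl⟩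
  mul_mem' := fun hf hg =>
    ⟨hf.1.comp hg.1, hg.2.1.comp hf.2.1, hf.2.2.comp hg.2.2⟩
  inv_mem' := fun hf => ⟨hf.2.1, hf.1, hf.2.2.symm⟩

instance : CoeFun DiffCircle (fun _ => Circle → Circle) := ⟨fun f => f.1⟩

/-- `Möb(S¹)`: the diffeomorphisms `z ↦ (a z + b) / (b̄ z + ā)` with `|a|² - |b|² = 1`, that is,
the boundary values of the holomorphic automorphisms of the unit disc. -/
def Mob : Subgroup DiffCircle where
  carrier := {f | ∃ a b : ℂ, ‖a‖ ^ 2 - ‖b‖ ^ 2 = 1 ∧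
    ∀ z : Circle, (f z : ℂ) * (conj b * z + conj a) = a * z + b}
  one_mem' := ⟨1, 0, by simp, fun z => by simp⟩
  mul_mem' := by
    rintro f g ⟨a, b, hab, hf⟩ ⟨c, d, hcd, hg⟩
    have key : ∀ w : ℂ, ((‖w‖ ^ 2 : ℝ) : ℂ) = w * conj w := fun w => by
      rw [Complex.mul_conj, Complex.normSq_eq_norm_sq]
    refine ⟨a * c + b * conj d, a * d + b * conj c, ?_, fun z => ?_⟩
    · have h1 : (((‖a‖ ^ 2 - ‖b‖ ^ 2) * (‖c‖ ^ 2 - ‖d‖ ^ 2) : ℝ) : ℂ) = 1 := by simp [hab, hcd]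
      have h2 : ((‖a * c + b * conj d‖ ^ 2 - ‖a * d + b * conj c‖ ^ 2 : ℝ) : ℂ) = 1 := by
        rw [← h1]
        simp only [Complex.ofReal_sub, Complex.ofReal_mul]
        rw [key, key, key, key, key, key]
        simp only [map_add, map_mul, Complex.conj_conj]
        ring
      exact_mod_cast h2
    · have h1 := hf (g z)
      have h2 := hg z
      have h3 : ((f * g : DiffCircle) z : ℂ) = (f (g z) : ℂ) := rfl
      rw [h3]
      simp only [map_add, map_mul, Complex.conj_conj]
      linear_combination (conj d * (z : ℂ) + conj c) * h1 +
        (a - (f (g z) : ℂ) * conj b) * h2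
  inv_mem' := by
    rintro f ⟨a, b, hab, hf⟩
    have key : a * conj a - b * conj b = 1 := by
      rw [Complex.mul_conj, Complex.mul_conj, Complex.normSq_eq_norm_sq,
        Complex.normSq_eq_norm_sq]
      exact_mod_cast hab
    refine ⟨conj a, -b, by simpa using hab, fun z => ?_⟩
    have h1 := hf (f⁻¹ z)
    have h2 : f (f⁻¹ z) = z := f.1.apply_symm_apply z
    rw [h2] at h1
    simp only [map_neg, Complex.conj_conj]
    linear_combination -h1

/-- The homogeneous space `M = Diff(S¹)/Möb(S¹)`. The group `Diff(S¹)` acts on `M` by right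
translations, so the points of `M` are the cosets `Möb(S¹) ∘ φ`. -/
abbrev DiffModMob : Type := Quotient (QuotientGroup.rightRel Mob)

/-- The projection `Diff(S¹) → M`. -/
def toM (φ : DiffCircle) : DiffModMob := Quotient.mk _ φ

/-! ## Tangent vectors of `M` and the homogeneous Kähler metric `g` -/

/-- The `k`-th Fourier coefficient of a function on the circle. -/
def fourierCoef (f : Circle → ℂ) (k : ℤ) : ℂ :=
  (2 * Real.pi : ℂ)⁻¹ *
    ∫ θ in (0 : ℝ)..(2 * Real.pi), f (Circle.exp θ) * Complex.exp (-(k * θ * Complex.I))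

/-- A smooth curve in the Fréchet Lie group `Diff(S¹)`: a one-parameter family of
diffeomorphisms that depends smoothly on the parameter and the point of the circle jointly. -/
def SmoothCurve (c : ℝ → DiffCircle) : Prop :=
  ContMDiff ((𝓘(ℝ, ℝ)).prod (𝓡 1)) (𝓡 1) ∞ (fun p : ℝ × Circle => c p.1 p.2)

/-- The velocity at time `0` of a curve `c` in `Diff(S¹)`, translated from the right to the
identity: the vector field `u(θ) ∂/∂θ` on the circle which is the velocity at time `0` of
`s ↦ c s ∘ (c 0)⁻¹`. The angular velocity of a curve `z s` in the circle is `z' / (i z)`.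
The right translate of a tangent vector of `M` is represented by such a field modulo the fields
whose Fourier coefficients vanish outside of `{-1, 0, 1}` (the Lie algebra of `Möb(S¹)`). -/
def rightVelocity (c : ℝ → DiffCircle) (z : Circle) : ℝ :=
  (deriv (fun s : ℝ => (c s ((c 0)⁻¹ z) : ℂ)) 0 / (Complex.I * z)).re

/-- The `m`-th Fourier coefficient of the vector field `u(θ) ∂/∂θ`. -/
def vecCoef (u : Circle → ℝ) (m : ℤ) : ℂ := fourierCoef (fun z => (u z : ℂ)) m

/-- The terms `v_m w̄_m (m³ - m)` of the metric `g`; they vanish for `m = 0` and `m = 1`. -/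
def gTerm (v w : Circle → ℝ) (m : ℕ) : ℂ :=
  vecCoef v m * conj (vecCoef w m) * ((m : ℂ) ^ 3 - m)

/-- The Hermitian pairing `g(v, w) = ∑_{m ≥ 2} v_m w̄_m (m³ - m)` at the origin of `M`. -/
def gOrigin (v w : Circle → ℝ) : ℂ := ∑' m : ℕ, gTerm v w m

/-- The metric `g` on `M`, obtained from `gOrigin` by right translations, evaluated on the
tangent vectors of two curves through the same point. -/
def gMetric (c₁ c₂ : ℝ → DiffCircle) : ℂ := gOrigin (rightVelocity c₁) (rightVelocity c₂)

/-! ## The Siegel disc `D_∞` and the Siegel symplectic metric `h` -/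

/-- The completed space `W_+`, in the coordinates with respect to the orthonormal basis
`e_p = e^{ipθ}/√p`, `p = 1, 2, …`; also the completed space `W_-` in the coordinates with respect
to the conjugate basis `e_{-p} = e^{-ipθ}/√p`. -/
abbrev HalfSpace : Type := lp (fun _ : ℕ+ => ℂ) 2

/-- The Hilbert space of the Hilbert-Schmidt operators `W_+ → W_-` (equally `W_- → W_+`),
as the square summable matrices with its Hilbert-Schmidt norm. -/
abbrev HSOp : Type := lp (fun _ : ℕ+ × ℕ+ => ℂ) 2

/-- The matrix entries of the row `p` are square summable. -/
theorem memℓp_row (Z : HSOp) (p : ℕ+) : Memℓp (fun q : ℕ+ => conj (Z (p, q))) 2 := by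
  have h := (lp.memℓp Z).summable (by norm_num)
  refine memℓp_gen ?_
  simpa [Function.comp_def] using h.comp_injective (Prod.mk_right_injective p)

/-- The conjugate of the row `p`. -/
def conjRow (Z : HSOp) (p : ℕ+) : HalfSpace := ⟨_, memℓp_row Z p⟩

theorem hasSum_norm_conjRow (Z : HSOp) : HasSum (fun p => ‖conjRow Z p‖ ^ 2) (‖Z‖ ^ 2) := by
  have h2 : (0 : ℝ) < (2 : ENNReal).toReal := by norm_num
  have h := lp.hasSum_norm h2 Z
  have hr : ∀ p, HasSum (fun q => ‖Z (p, q)‖ ^ (2 : ENNReal).toReal)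
      (‖conjRow Z p‖ ^ (2 : ENNReal).toReal) := fun p => by
    simpa [conjRow] using lp.hasSum_norm h2 (conjRow Z p)
  simpa using h.prod_fiberwise hr

theorem memℓp_apply (Z : HSOp) (x : HalfSpace) :
    Memℓp (fun p : ℕ+ => (inner ℂ (conjRow Z p) x : ℂ)) 2 := by
  refine memℓp_gen ?_
  refine Summable.of_nonneg_of_le (fun _ => by positivity) (fun p => ?_)
    ((hasSum_norm_conjRow Z).summable.mul_right (‖x‖ ^ 2))
  have h := norm_inner_le_norm (𝕜 := ℂ) (conjRow Z p) x
  have h' := pow_le_pow_left₀ (norm_nonneg _) h 2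
  rw [mul_pow] at h'
  simpa using h'

/-- The bounded operator with a given Hilbert-Schmidt matrix. -/
def op (Z : HSOp) : HalfSpace →L[ℂ] HalfSpace :=
  LinearMap.mkContinuous
    { toFun := fun x => ⟨_, memℓp_apply Z x⟩
      map_add' := fun x y => by ext p; exact inner_add_right _ _ _
      map_smul' := fun a x => by ext p; exact inner_smul_right _ _ _ }
    ‖Z‖ (fun x => by
      have h2 : (0 : ℝ) < (2 : ENNReal).toReal := by norm_num
      refine lp.norm_le_of_forall_sum_le h2 (by positivity) (fun s => ?_)
      have h1 : ∑ p ∈ s, ‖conjRow Z p‖ ^ 2 * ‖x‖ ^ 2 ≤ ‖Z‖ ^ 2 * ‖x‖ ^ 2 := by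
        rw [← Finset.sum_mul]
        exact mul_le_mul_of_nonneg_right
          (sum_le_hasSum s (fun _ _ => by positivity) (hasSum_norm_conjRow Z)) (by positivity)
      have h3 : ∑ p ∈ s, ‖(inner ℂ (conjRow Z p) x : ℂ)‖ ^ 2 ≤
          ∑ p ∈ s, ‖conjRow Z p‖ ^ 2 * ‖x‖ ^ 2 := by
        refine Finset.sum_le_sum (fun p _ => ?_)
        rw [← mul_pow]
        exact pow_le_pow_left₀ (norm_nonneg _) (norm_inner_le_norm _ _) 2
      have h4 := h3.trans h1
      rw [← mul_pow] at h4
      simpa using h4)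

/-- The operator is multiplication by the matrix. -/
theorem op_apply (Z : HSOp) (x : HalfSpace) (p : ℕ+) :
    op Z x p = ∑' q : ℕ+, Z (p, q) * x q := by
  change (inner ℂ (conjRow Z p) x : ℂ) = _
  rw [lp.inner_eq_tsum]
  simp [conjRow, mul_comm]

/-- `Z` is symmetric with respect to `S(σ, τ) = ∫ σ dτ`. Since `S(e_{-p}, e_q) = 2πi` for `p = q`
and `0` for `p ≠ q`, the condition `S(Z e_q, e_p) = S(Z e_p, e_q)` says that the matrix is
symmetric. -/
def IsSymm (Z : HSOp) : Prop := ∀ p q : ℕ+, Z (p, q) = Z (q, p)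

/-- The infinite-dimensional Siegel disc: the symmetric Hilbert-Schmidt operators
`Z : W_+ → W_-` for which `I - Z Z̄` is positive definite. The conjugate operator
`Z̄ : W_- → W_+`, `Z̄ x = conj (Z (conj x))`, has the conjugate matrix `star Z`. -/
def siegelDisc : Set HSOp :=
  {Z | IsSymm Z ∧
    ∀ x : HalfSpace, x ≠ 0 → 0 < (⟪x, (1 - op Z ∘L op (star Z)) x⟫_ℂ).re}

/-- The diagonal matrix entry `⟪e_p, K e_p⟫` of an operator. -/
def diagEntry (K : HalfSpace →L[ℂ] HalfSpace) (p : ℕ+) : ℂ := K (lp.single 2 p 1) p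

/-- The trace of an operator. -/
def trace (K : HalfSpace →L[ℂ] HalfSpace) : ℂ := ∑' p : ℕ+, diagEntry K p

/-- The operator `(I - Z Z̄)⁻¹ X (I - Z̄ Z)⁻¹ Ȳ` on `W_-`. For `Z` in the Siegel disc, both inverses
exist. -/
def siegelOp (Z X Y : HSOp) : HalfSpace →L[ℂ] HalfSpace :=
  Ring.inverse (1 - op Z ∘L op (star Z)) ∘L op X ∘L
    Ring.inverse (1 - op (star Z) ∘L op Z) ∘L op (star Y)

/-- The Siegel symplectic metric `h_Z(X, Y) = tr((I - Z Z̄)⁻¹ X (I - Z̄ Z)⁻¹ Ȳ)`: the metric that is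
`tr(X Ȳ)` at the origin and invariant under the symplectic group. -/
def siegelMetric (Z X Y : HSOp) : ℂ := trace (siegelOp Z X Y)

/-- At the origin, the Siegel metric is the trace of `X ∘ Ȳ`. -/
theorem siegelMetric_zero (X Y : HSOp) :
    siegelMetric 0 X Y = trace (op X ∘L op (star Y)) := by
  have h : op 0 = 0 := by ext x p; simp [op_apply]
  simp only [siegelMetric, siegelOp, h, ContinuousLinearMap.zero_comp,
    ContinuousLinearMap.comp_zero, sub_zero, Ring.inverse_one]
  rfl

/-! ## The polarization attached to a diffeomorphism -/

/-- The class in `V_ℂ = C^∞(S¹, ℂ)/ℂ` of the function `f` is the vector `x` of the completion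
`W_+ ⊕ W_-`: the coordinates of `f` in the basis `e_k = e^{ikθ}/√|k|`, `k ≠ 0`, are those of `x`. -/
def Represents (f : Circle → ℂ) (x : HalfSpace × HalfSpace) : Prop :=
  ∀ p : ℕ+, x.1 p = √(p : ℝ) * fourierCoef f p ∧ x.2 p = √(p : ℝ) * fourierCoef f (-(p : ℤ))

/-- The smooth functions on the circle that represent the elements of `W_+` (those with only
positive index Fourier components, up to constants). -/
def SmoothPlus : Set (Circle → ℂ) :=
  {σ | ContMDiff (𝓡 1) 𝓘(ℝ, ℂ) ∞ σ ∧ ∀ k : ℤ, k < 0 → fourierCoef σ k = 0}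

/-- The positive polarization `T_φ(W_+)` of `V_ℂ` that the symplectic automorphism
`T_φ : σ ↦ σ ∘ φ` makes from the fiducial one, as a closed subspace of the completion. -/
def polarization (φ : DiffCircle) : Set (HalfSpace × HalfSpace) :=
  closure {x | ∃ σ ∈ SmoothPlus, Represents (σ ∘ φ) x}

/-- The graph of the operator `Z : W_+ → W_-`. -/
def graph (Z : HSOp) : Set (HalfSpace × HalfSpace) := {x | x.2 = op Z x.1}

end

end CirclePeriod

open CirclePeriod

/-!
Write the pullback `σ ↦ σ ∘ φ` as a block operator on `W_+ ⊕ W_-`. Its first column consists of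
`a = opA φ : W_+ → W_+` and `b = opB φ : W_+ → W_-`, whose entries are, up to the factors `√p / √q`
of the orthonormal bases, the Fourier coefficients of the powers `φ^q`.

*Existence and polarization.* The pullback is real and preserves the symplectic form
`∫ f dg`; by Parseval's identity and the change of variables by `φ` and by `φ⁻¹` this says
`a†a = 1 + b†b`, `aa† = 1 + b̄bᵗ` and `aᵗb = bᵗa` (`isSymplecticPair`). The first relation shows that
`a` is bounded as soon as `b` is (`exists_clm_of_gram`), the first two that `a` is invertible. So
`Z = b a⁻¹` is defined, the third relation makes it symmetric, and
`1 - Z̄Z = (a⁻¹)† a⁻¹` puts it into the Siegel disc (`IsSymplecticPair.siegelPoint_mem`). Its graph is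
the image `{(a y, b y)}` of `W_+`, the closure of the classes of the `σ ∘ φ` (`graph_period`). A
Möbius transformation extends holomorphically to the disc, hence preserves the functions without
negative coefficients, so that `Z` depends only on the coset of `φ`.

*Smoothness.* The entry of `b` with the indices `p`, `q` is an integral of `e^{i(q φ + p θ)}`. Both
terms of the phase have positive derivative, and `q φ + p θ` is `p + q` times an interpolation between
the maps `φ` and `id`, so that repeated integration by parts gives a bound by any power of
`1 / (p + q)`, for the time derivatives along a curve as well (`AngleFamily.derivBound_negative`).
Hence `b` is a smooth curve of Hilbert-Schmidt operators. The time derivatives of `a` are in general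
unbounded, which is circumvented by the formula `Z = (b a†)(1 + b̄bᵗ)⁻¹`: the entries of `a` and of its
derivatives grow at most polynomially, so the entries of `b a†` decay rapidly in the first index, and
`b a†` is symmetric. An entrywise bound of this kind gives smoothness in the Hilbert-Schmidt norm
(`exists_contDiff_lp`).

*Derivative and metric.* The transformation `X ↦ aᵗ X a` carries tangent vectors at `Z` to the origin,
and the Siegel metric becomes the Hilbert-Schmidt inner product there
(`IsSymplecticPair.hasSum_diagEntry_siegelOp`). Differentiating `Z a = b` gives
`aᵗ Z' a = aᵗ b' - bᵗ a'`, whose entries are symplectic products of `φ^p` with the velocity of `φ^q`. A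
change of variables evaluates them as `i √(pq) v_{-(p+q)}`, where `v` is the right-translated velocity
(`originVelocity_apply`). This vanishes exactly if `v_m = 0` for all `|m| ≥ 2`, and
the Hilbert-Schmidt inner product of two such matrices is the sum over `n` of the products of the
coefficients with index `n`, times `∑_{p+q=n} pq = (n³ - n) / 6` (`hasSum_gTerm`).
-/

namespace CirclePeriod

noncomputable section

open ContinuousLinearMap (adjoint)

/-! ### Conjugation and transposition of operators on the sequence space -/

/-- The basis vector `e_p`. -/
abbrev basisVec (p : ℕ+) : HalfSpace := lp.single 2 p 1

theorem inner_basisVec (p : ℕ+) (x : HalfSpace) : ⟪basisVec p, x⟫_ℂ = x p := by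
  rw [lp.inner_single_left]; simp

theorem star_basisVec (p : ℕ+) : star (basisVec p) = basisVec p := by
  ext q
  rw [lp.star_apply, lp.single_apply]
  by_cases h : q = p
  · subst h; simp
  · simp [Pi.single_eq_of_ne h]

theorem hasSum_basisVec (x : HalfSpace) : HasSum (fun p => x p • basisVec p) x := by
  have h := lp.hasSum_single (E := fun _ : ℕ+ => ℂ) (p := 2) (by norm_num) x
  refine h.congr_fun fun p => ?_
  rw [← lp.single_smul]
  simp

theorem clm_ext {E : Type*} [NormedAddCommGroup E] [NormedSpace ℂ E]
    {K L : HalfSpace →L[ℂ] E} (h : ∀ q, K (basisVec q) = L (basisVec q)) : K = L := by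
  ext x
  have h1 := (hasSum_basisVec x).mapL K
  have h2 := (hasSum_basisVec x).mapL L
  simp only [map_smul, h] at h1 h2
  exact h1.unique h2

theorem inner_star_star {ι : Type*} (x y : lp (fun _ : ι => ℂ) 2) :
    ⟪star x, star y⟫_ℂ = conj ⟪x, y⟫_ℂ := by
  rw [lp.inner_eq_tsum, lp.inner_eq_tsum, ← RCLike.conjCLE_apply (K := ℂ),
    ContinuousLinearEquiv.map_tsum]
  simp

/-- The conjugate operator `K̄ x = conj (K (conj x))`. -/
def conjOp (K : HalfSpace →L[ℂ] HalfSpace) : HalfSpace →L[ℂ] HalfSpace :=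
  LinearMap.mkContinuous
    { toFun := fun x => star (K (star x))
      map_add' := fun x y => by simp
      map_smul' := fun a x => by simp }
    ‖K‖ (fun x => by
      have h := K.le_opNorm (star x)
      simpa using h)

theorem conjOp_apply (K : HalfSpace →L[ℂ] HalfSpace) (x : HalfSpace) :
    conjOp K x = star (K (star x)) := rfl

theorem conjOp_comp (K L : HalfSpace →L[ℂ] HalfSpace) :
    conjOp (K ∘L L) = conjOp K ∘L conjOp L := by
  ext1 x; simp [conjOp_apply]

theorem conjOp_one : conjOp 1 = 1 := by
  ext1 x; simp [conjOp_apply]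

theorem conjOp_sub (K L : HalfSpace →L[ℂ] HalfSpace) :
    conjOp (K - L) = conjOp K - conjOp L := by
  ext1 x; simp [conjOp_apply]

theorem conjOp_conjOp (K : HalfSpace →L[ℂ] HalfSpace) : conjOp (conjOp K) = K := by
  ext1 x; simp [conjOp_apply]

theorem norm_conjOp_le (K : HalfSpace →L[ℂ] HalfSpace) : ‖conjOp K‖ ≤ ‖K‖ :=
  LinearMap.mkContinuous_norm_le _ (norm_nonneg _) _

theorem adjoint_conjOp (K : HalfSpace →L[ℂ] HalfSpace) :
    adjoint (conjOp K) = conjOp (adjoint K) := by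
  refine ((ContinuousLinearMap.eq_adjoint_iff _ _).2 fun x y => ?_).symm
  rw [conjOp_apply, conjOp_apply]
  have h1 := inner_star_star ((adjoint K) (star x)) (star y)
  have h2 := inner_star_star (star x) (K (star y))
  rw [star_star] at h1 h2
  rw [h1, h2, ContinuousLinearMap.adjoint_inner_left]

/-- The transposed operator `Kᵗ = conj (K†)`, with respect to the bilinear pairing of the
coordinates. -/
def transposeOp (K : HalfSpace →L[ℂ] HalfSpace) : HalfSpace →L[ℂ] HalfSpace :=
  conjOp (adjoint K)

theorem transposeOp_comp (K L : HalfSpace →L[ℂ] HalfSpace) :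
    transposeOp (K ∘L L) = transposeOp L ∘L transposeOp K := by
  rw [transposeOp, ContinuousLinearMap.adjoint_comp, conjOp_comp]; rfl

theorem transposeOp_transposeOp (K : HalfSpace →L[ℂ] HalfSpace) :
    transposeOp (transposeOp K) = K := by
  rw [transposeOp, transposeOp, adjoint_conjOp, conjOp_conjOp,
    ContinuousLinearMap.adjoint_adjoint]

theorem conjOp_adjoint (K : HalfSpace →L[ℂ] HalfSpace) : conjOp (adjoint K) = transposeOp K := rfl

theorem adjoint_transposeOp (K : HalfSpace →L[ℂ] HalfSpace) :
    adjoint (transposeOp K) = conjOp K := by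
  rw [transposeOp, adjoint_conjOp, ContinuousLinearMap.adjoint_adjoint]

theorem conjOp_transposeOp (K : HalfSpace →L[ℂ] HalfSpace) :
    conjOp (transposeOp K) = adjoint K := conjOp_conjOp _

theorem transposeOp_conjOp (K : HalfSpace →L[ℂ] HalfSpace) :
    transposeOp (conjOp K) = adjoint K := by
  rw [transposeOp, adjoint_conjOp, conjOp_conjOp]

theorem transposeOp_adjoint (K : HalfSpace →L[ℂ] HalfSpace) :
    transposeOp (adjoint K) = conjOp K := by
  rw [transposeOp, ContinuousLinearMap.adjoint_adjoint]

theorem norm_transposeOp_le (K : HalfSpace →L[ℂ] HalfSpace) : ‖transposeOp K‖ ≤ ‖K‖ :=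
  (norm_conjOp_le _).trans (by simp)

/-- The entries of the transposed operator. -/
theorem transposeOp_basisVec (K : HalfSpace →L[ℂ] HalfSpace) (p q : ℕ+) :
    transposeOp K (basisVec q) p = K (basisVec p) q := by
  rw [transposeOp, conjOp_apply, lp.star_apply, star_basisVec, ← inner_basisVec,
    ContinuousLinearMap.adjoint_inner_right, ← inner_basisVec q]
  exact inner_conj_symm _ _

theorem conjOp_basisVec (K : HalfSpace →L[ℂ] HalfSpace) (p q : ℕ+) :
    conjOp K (basisVec q) p = conj (K (basisVec q) p) := by
  rw [conjOp_apply, lp.star_apply, star_basisVec]; rfl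

theorem adjoint_basisVec (K : HalfSpace →L[ℂ] HalfSpace) (p q : ℕ+) :
    adjoint K (basisVec q) p = conj (K (basisVec p) q) := by
  rw [← conjOp_conjOp (adjoint K), conjOp_basisVec, conjOp_adjoint, transposeOp_basisVec]

theorem clm_ext_entries {K L : HalfSpace →L[ℂ] HalfSpace}
    (h : ∀ p q, K (basisVec q) p = L (basisVec q) p) : K = L :=
  clm_ext fun q => lp.ext (funext fun p => h p q)

/-! ### Hilbert-Schmidt operators -/

theorem op_basisVec (Z : HSOp) (p q : ℕ+) : op Z (basisVec q) p = Z (p, q) := by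
  rw [op_apply, tsum_eq_single q]
  · simp
  · intro r hr
    simp [Pi.single_eq_of_ne hr]

theorem op_injective : Function.Injective op := by
  intro Z W h
  ext ⟨p, q⟩
  rw [← op_basisVec, ← op_basisVec, h]

theorem op_add (Z W : HSOp) : op (Z + W) = op Z + op W :=
  clm_ext_entries fun p q => by simp [op_basisVec]

theorem op_smul (a : ℂ) (Z : HSOp) : op (a • Z) = a • op Z :=
  clm_ext_entries fun p q => by simp [op_basisVec]

theorem norm_op_le (Z : HSOp) : ‖op Z‖ ≤ ‖Z‖ := by
  unfold op
  exact LinearMap.mkContinuous_norm_le _ (norm_nonneg _) _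

/-- The inclusion of the Hilbert-Schmidt operators into the bounded operators. -/
def opL : HSOp →L[ℂ] HalfSpace →L[ℂ] HalfSpace :=
  LinearMap.mkContinuous ⟨⟨op, op_add⟩, op_smul⟩ 1 fun Z => by
    rw [one_mul]
    exact norm_op_le Z

theorem opL_apply (Z : HSOp) : opL Z = op Z := rfl

theorem op_star (Z : HSOp) : op (star Z) = conjOp (op Z) :=
  clm_ext_entries fun p q => by
    rw [conjOp_basisVec, op_basisVec, op_basisVec, lp.star_apply]; rfl

/-- The transposed Hilbert-Schmidt matrix. -/
def hsTranspose : HSOp →ₗᵢ[ℂ] HSOp where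
  toFun Z := ⟨fun p => Z p.swap, memℓp_gen (by
    simpa [Function.comp_def] using
      (Equiv.prodComm ℕ+ ℕ+).summable_iff.2 ((lp.memℓp Z).summable (by norm_num)))⟩
  map_add' Z W := rfl
  map_smul' a Z := rfl
  norm_map' Z := by
    rw [lp.norm_eq_tsum_rpow (by norm_num), lp.norm_eq_tsum_rpow (by norm_num)]
    congr 1
    exact (Equiv.prodComm ℕ+ ℕ+).tsum_eq (fun p => ‖Z p‖ ^ (2 : ENNReal).toReal)

theorem hsTranspose_apply (Z : HSOp) (p q : ℕ+) : hsTranspose Z (p, q) = Z (q, p) := rfl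

theorem op_hsTranspose (Z : HSOp) : op (hsTranspose Z) = transposeOp (op Z) :=
  clm_ext_entries fun p q => by
    rw [transposeOp_basisVec, op_basisVec, op_basisVec, hsTranspose_apply]

theorem hsTranspose_hsTranspose (Z : HSOp) : hsTranspose (hsTranspose Z) = Z := rfl

/-- The inner product of Hilbert-Schmidt operators is the sum of the inner products of the
columns. -/
theorem hasSum_inner_columns (P Q : HSOp) :
    HasSum (fun q => ⟪op P (basisVec q), op Q (basisVec q)⟫_ℂ) ⟪P, Q⟫_ℂ := by
  have h := (Equiv.prodComm ℕ+ ℕ+).hasSum_iff.2 (lp.hasSum_inner (𝕜 := ℂ) P Q)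
  refine h.prod_fiberwise fun q => ?_
  have h2 := lp.hasSum_inner (𝕜 := ℂ) (op P (basisVec q)) (op Q (basisVec q))
  simpa [op_basisVec] using h2

theorem hasSum_norm_columns (Z : HSOp) :
    HasSum (fun q => ‖op Z (basisVec q)‖ ^ 2) (‖Z‖ ^ 2) := by
  have h := hasSum_inner_columns Z Z
  simp only [inner_self_eq_norm_sq_to_K] at h
  exact_mod_cast h

/-- The Hilbert-Schmidt matrix of an operator whose columns are square summable. -/
def ofColumns (K : HalfSpace →L[ℂ] HalfSpace)
    (hK : Summable fun q => ‖K (basisVec q)‖ ^ 2) : HSOp :=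
  hsTranspose ⟨fun p => K (basisVec p.1) p.2, memℓp_gen (by
    have h2 : (0 : ℝ) < (2 : ENNReal).toReal := by norm_num
    have hr : ∀ q, HasSum (fun p => ‖K (basisVec q) p‖ ^ (2 : ENNReal).toReal)
        (‖K (basisVec q)‖ ^ (2 : ENNReal).toReal) := fun q => lp.hasSum_norm h2 _
    refine (summable_prod_of_nonneg (fun _ => by positivity)).2 ⟨fun q => (hr q).summable, ?_⟩
    simp only [(hr _).tsum_eq]
    simpa using hK)⟩

theorem op_ofColumns (K : HalfSpace →L[ℂ] HalfSpace)
    (hK : Summable fun q => ‖K (basisVec q)‖ ^ 2) : op (ofColumns K hK) = K :=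
  clm_ext_entries fun p q => by rw [op_basisVec, ofColumns, hsTranspose_apply]

theorem summable_comp_columns (K : HalfSpace →L[ℂ] HalfSpace) (Z : HSOp) :
    Summable fun q => ‖(K ∘L op Z) (basisVec q)‖ ^ 2 := by
  refine Summable.of_nonneg_of_le (fun _ => by positivity) (fun q => ?_)
    ((hasSum_norm_columns Z).summable.mul_left (‖K‖ ^ 2))
  rw [← mul_pow]
  exact pow_le_pow_left₀ (norm_nonneg _) (K.le_opNorm _) 2

/-- The product `K Z` of a bounded and a Hilbert-Schmidt operator. -/
def hsLeft (K : HalfSpace →L[ℂ] HalfSpace) (Z : HSOp) : HSOp :=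
  ofColumns (K ∘L op Z) (summable_comp_columns K Z)

theorem op_hsLeft (K : HalfSpace →L[ℂ] HalfSpace) (Z : HSOp) : op (hsLeft K Z) = K ∘L op Z :=
  op_ofColumns _ _

theorem norm_hsLeft_le (K : HalfSpace →L[ℂ] HalfSpace) (Z : HSOp) :
    ‖hsLeft K Z‖ ≤ ‖K‖ * ‖Z‖ := by
  refine le_of_sq_le_sq ?_ (by positivity)
  rw [mul_pow]
  refine hasSum_le (fun q => ?_) (hasSum_norm_columns (hsLeft K Z))
    ((hasSum_norm_columns Z).mul_left (‖K‖ ^ 2))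
  rw [← mul_pow, op_hsLeft]
  exact pow_le_pow_left₀ (norm_nonneg _) (K.le_opNorm _) 2

/-- The product `Z K` of a Hilbert-Schmidt and a bounded operator. -/
def hsRight (Z : HSOp) (K : HalfSpace →L[ℂ] HalfSpace) : HSOp :=
  hsTranspose (hsLeft (transposeOp K) (hsTranspose Z))

theorem op_hsRight (Z : HSOp) (K : HalfSpace →L[ℂ] HalfSpace) : op (hsRight Z K) = op Z ∘L K := by
  rw [hsRight, op_hsTranspose, op_hsLeft, op_hsTranspose, ← transposeOp_comp,
    transposeOp_transposeOp]

theorem norm_hsRight_le (Z : HSOp) (K : HalfSpace →L[ℂ] HalfSpace) :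
    ‖hsRight Z K‖ ≤ ‖Z‖ * ‖K‖ := by
  rw [hsRight, LinearIsometry.norm_map, mul_comm]
  refine (norm_hsLeft_le _ _).trans ?_
  rw [LinearIsometry.norm_map]
  exact mul_le_mul_of_nonneg_right (norm_transposeOp_le K) (norm_nonneg _)

theorem isBoundedBilinearMap_hsRight :
    IsBoundedBilinearMap ℝ
      (fun x : HSOp × (HalfSpace →L[ℂ] HalfSpace) => hsRight x.1 x.2) where
  add_left Z W K := op_injective (by simp [op_hsRight, op_add])
  smul_left a Z K := op_injective (by
    have h : ∀ W : HSOp, op (a • W) = a • op W := fun W => op_smul a W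
    simp [op_hsRight, h])
  add_right Z K L := op_injective (by simp [op_hsRight, op_add])
  smul_right a Z K := op_injective (by
    have h : ∀ W : HSOp, op (a • W) = a • op W := fun W => op_smul a W
    rw [h, op_hsRight, op_hsRight]
    ext1 x
    exact (op Z).map_smul_of_tower a (K x))
  bound := ⟨1, one_pos, fun Z K => by rw [one_mul]; exact norm_hsRight_le Z K⟩

theorem inner_hsLeft (K : HalfSpace →L[ℂ] HalfSpace) (P Q : HSOp) :
    ⟪hsLeft K P, Q⟫_ℂ = ⟪P, hsLeft (adjoint K) Q⟫_ℂ := by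
  refine (hasSum_inner_columns _ _).unique ?_
  convert hasSum_inner_columns P (hsLeft (adjoint K) Q) using 2 with q
  rw [op_hsLeft, op_hsLeft]
  simp [ContinuousLinearMap.adjoint_inner_right]

theorem inner_hsRight (K : HalfSpace →L[ℂ] HalfSpace) (P Q : HSOp) :
    ⟪hsRight P K, Q⟫_ℂ = ⟪P, hsRight Q (adjoint K)⟫_ℂ := by
  have h := inner_hsLeft (transposeOp K) (hsTranspose P) (hsTranspose Q)
  rw [← hsTranspose.inner_map_map, ← hsTranspose.inner_map_map (hsTranspose P)] at h
  simpa only [hsRight, hsTranspose_hsTranspose, adjoint_transposeOp, transposeOp_adjoint] using h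

/-- The trace of the product of two Hilbert-Schmidt operators is their Hilbert-Schmidt pairing. -/
theorem hasSum_diagEntry_comp (P Q : HSOp) :
    HasSum (diagEntry (op P ∘L op Q)) ⟪star (hsTranspose P), Q⟫_ℂ := by
  convert hasSum_inner_columns (star (hsTranspose P)) Q using 2 with p
  rw [op_star, op_hsTranspose, conjOp_transposeOp, ContinuousLinearMap.adjoint_inner_left,
    inner_basisVec]
  rfl

/-! ### Invertible operators and operators with a given Gram matrix of columns -/

theorem isUnit_one_add_adjoint_comp (K : HalfSpace →L[ℂ] HalfSpace) :
    IsUnit (1 + adjoint K ∘L K) := by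
  have h : (-1 : ℝ) ∉ spectrum ℝ (star K * K) := fun h => by
    have := spectrum_star_mul_self_nonneg _ h
    linarith
  have h2 := (spectrum.notMem_iff.1 h).neg
  convert h2 using 1
  rw [neg_sub, map_neg, map_one, sub_neg_eq_add, add_comm]
  rfl

/-- An operator is invertible if both of its Gram operators are bounded below by the identity. -/
theorem isUnit_of_gram {K L M : HalfSpace →L[ℂ] HalfSpace}
    (h1 : adjoint K ∘L K = 1 + adjoint L ∘L L) (h2 : K ∘L adjoint K = 1 + adjoint M ∘L M) :
    IsUnit K := by
  have u1 := isUnit_one_add_adjoint_comp L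
  have u2 := isUnit_one_add_adjoint_comp M
  rw [← h1] at u1
  rw [← h2] at u2
  obtain ⟨r, hr⟩ := u2.exists_right_inv
  obtain ⟨l, hl⟩ := u1.exists_left_inv
  exact isUnit_iff_exists_and_exists.2
    ⟨⟨adjoint K * r, (mul_assoc K (adjoint K) r).symm.trans hr⟩,
      ⟨l * adjoint K, (mul_assoc l (adjoint K) K).trans hl⟩⟩

/-- Vectors whose Gram matrix is that of a bounded operator are the columns of a bounded
operator. -/
theorem exists_clm_of_gram (v : ℕ+ → HalfSpace) (S : HalfSpace →L[ℂ] HalfSpace)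
    (h : ∀ p q, ⟪v p, v q⟫_ℂ = ⟪basisVec p, S (basisVec q)⟫_ℂ) :
    ∃ K : HalfSpace →L[ℂ] HalfSpace, ∀ q, K (basisVec q) = v q := by
  let e := Finsupp.linearCombination ℂ basisVec
  let f := Finsupp.linearCombination ℂ v
  have hd : DenseRange e := by
    intro x
    refine mem_closure_of_tendsto (hasSum_basisVec x) (Filter.Eventually.of_forall fun s => ?_)
    refine ⟨∑ p ∈ s, Finsupp.single p (x p), ?_⟩
    simp [e, map_sum, Finsupp.linearCombination_single]
  have hg : ∀ x, ⟪f x, f x⟫_ℂ = ⟪e x, S (e x)⟫_ℂ := by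
    intro x
    simp only [e, f, Finsupp.linearCombination_apply, Finsupp.sum, map_sum, map_smul,
      sum_inner, inner_sum, inner_smul_left, inner_smul_right, h]
  have hn : ∃ C, ∀ x, ‖f x‖ ≤ C * ‖e x‖ := by
    refine ⟨√‖S‖, fun x => le_of_sq_le_sq ?_ (by positivity)⟩
    rw [mul_pow, Real.sq_sqrt (norm_nonneg _)]
    have h1 : ((‖f x‖ ^ 2 : ℝ) : ℂ) = ⟪e x, S (e x)⟫_ℂ := by
      rw [← hg, inner_self_eq_norm_sq_to_K]; norm_cast
    have h2 : ‖f x‖ ^ 2 = ‖⟪e x, S (e x)⟫_ℂ‖ := by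
      rw [← h1, Complex.norm_real, Real.norm_of_nonneg (by positivity)]
    rw [h2]
    refine (norm_inner_le_norm _ _).trans ?_
    calc ‖e x‖ * ‖S (e x)‖ ≤ ‖e x‖ * (‖S‖ * ‖e x‖) :=
          mul_le_mul_of_nonneg_left (S.le_opNorm _) (norm_nonneg _)
      _ = ‖S‖ * ‖e x‖ ^ 2 := by ring
  refine ⟨f.extendOfNorm e, fun q => ?_⟩
  have h3 := LinearMap.extendOfNorm_eq hd hn (Finsupp.single q 1)
  simpa [e, f, Finsupp.linearCombination_single] using h3

/-! ### The point of the Siegel disc defined by a symplectic operator -/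

theorem ringInverse_eq_of_mul_eq_one {R : Type*} [Ring R] {x y : R} (h1 : x * y = 1)
    (h2 : y * x = 1) : Ring.inverse x = y :=
  Ring.inverse_unit (⟨x, y, h1, h2⟩ : Rˣ)

/-- The relations between the blocks `a` and `b` of a real operator
`[[a, b̄], [b, ā]]` on `W_+ ⊕ W_-` which say that the operator is invertible and symplectic. -/
structure IsSymplecticPair (a : HalfSpace →L[ℂ] HalfSpace) (B : HSOp) : Prop where
  gram : adjoint a ∘L a = 1 + adjoint (op B) ∘L op B
  symm : transposeOp a ∘L op B = transposeOp (op B) ∘L a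
  gram_adjoint : a ∘L adjoint a = 1 + conjOp (op B) ∘L transposeOp (op B)

/-- The operator `b a⁻¹`, whose graph is the image of `W_+`. -/
def siegelPoint (a : HalfSpace →L[ℂ] HalfSpace) (B : HSOp) : HSOp := hsRight B (Ring.inverse a)

theorem isSymm_iff (Z : HSOp) : IsSymm Z ↔ transposeOp (op Z) = op Z := by
  rw [← op_hsTranspose]
  constructor
  · intro h
    congr 1
    ext ⟨p, q⟩
    exact h q p
  · intro h p q
    exact congrArg (fun W : HSOp => W (q, p)) (op_injective h)

namespace IsSymplecticPair

variable {a : HalfSpace →L[ℂ] HalfSpace} {B : HSOp}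

theorem isUnit (h : IsSymplecticPair a B) : IsUnit a := by
  refine isUnit_of_gram h.gram (M := transposeOp (op B)) ?_
  rw [adjoint_transposeOp]
  exact h.gram_adjoint

theorem mul_inverse (h : IsSymplecticPair a B) : a * Ring.inverse a = 1 :=
  Ring.mul_inverse_cancel _ h.isUnit

theorem inverse_mul (h : IsSymplecticPair a B) : Ring.inverse a * a = 1 :=
  Ring.inverse_mul_cancel _ h.isUnit

theorem siegelPoint_comp (h : IsSymplecticPair a B) : op (siegelPoint a B) ∘L a = op B := by
  rw [siegelPoint, op_hsRight]
  change op B * Ring.inverse a * a = op B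
  rw [mul_assoc, h.inverse_mul, mul_one]

theorem eq_of_comp_right (h : IsSymplecticPair a B) {K L : HalfSpace →L[ℂ] HalfSpace}
    (hKL : K ∘L a = L ∘L a) : K = L :=
  h.isUnit.mul_right_cancel hKL

theorem transposeOp_mul_inverse (h : IsSymplecticPair a B) :
    transposeOp (Ring.inverse a) ∘L transposeOp a = 1 := by
  rw [← transposeOp_comp]
  change transposeOp (a * Ring.inverse a) = 1
  rw [h.mul_inverse, transposeOp, ← ContinuousLinearMap.star_eq_adjoint, star_one, conjOp_one]

theorem eq_of_transposeOp_comp (h : IsSymplecticPair a B) {K L : HalfSpace →L[ℂ] HalfSpace}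
    (hKL : transposeOp a ∘L K = transposeOp a ∘L L) : K = L := by
  have h1 := congrArg (fun M => transposeOp (Ring.inverse a) ∘L M) hKL
  simp only [← ContinuousLinearMap.comp_assoc, h.transposeOp_mul_inverse] at h1
  exact h1

theorem transposeOp_siegelPoint (h : IsSymplecticPair a B) :
    transposeOp (op (siegelPoint a B)) = op (siegelPoint a B) := by
  refine h.eq_of_comp_right (h.eq_of_transposeOp_comp ?_)
  rw [h.siegelPoint_comp, h.symm, ← ContinuousLinearMap.comp_assoc, ← transposeOp_comp,
    h.siegelPoint_comp]

theorem transposeOp_comp_siegelPoint (h : IsSymplecticPair a B) :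
    transposeOp a ∘L op (siegelPoint a B) = transposeOp (op B) := by
  conv_lhs => rw [← h.transposeOp_siegelPoint, ← transposeOp_comp, h.siegelPoint_comp]

theorem conjOp_siegelPoint (h : IsSymplecticPair a B) :
    conjOp (op (siegelPoint a B)) = adjoint (op (siegelPoint a B)) := by
  conv_lhs => rw [← h.transposeOp_siegelPoint, conjOp_transposeOp]

/-- `1 - Z̄Z = (a⁻¹)† a⁻¹`, which makes `1 - Z̄Z` positive and computes its inverse. -/
theorem one_sub_conj_comp (h : IsSymplecticPair a B) :
    1 - op (star (siegelPoint a B)) ∘L op (siegelPoint a B) =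
      adjoint (Ring.inverse a) ∘L Ring.inverse a := by
  rw [op_star, h.conjOp_siegelPoint]
  change 1 - star (op (siegelPoint a B)) * op (siegelPoint a B) =
    star (Ring.inverse a) * Ring.inverse a
  have h1 : op B * Ring.inverse a = op (siegelPoint a B) := (op_hsRight _ _).symm
  have h2 : star a * a = 1 + star (op B) * op B := h.gram
  have h3 : star (op B) * op B = star a * a - 1 := by rw [h2]; abel
  rw [← h1, star_mul]
  calc 1 - star (Ring.inverse a) * star (op B) * (op B * Ring.inverse a)
      = 1 - star (Ring.inverse a) * (star (op B) * op B) * Ring.inverse a := by noncomm_ring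
    _ = 1 - star (a * Ring.inverse a) * (a * Ring.inverse a) +
          star (Ring.inverse a) * Ring.inverse a := by
        rw [h3, star_mul]; noncomm_ring
    _ = _ := by rw [h.mul_inverse]; simp

theorem one_sub_comp_conj (h : IsSymplecticPair a B) :
    1 - op (siegelPoint a B) ∘L op (star (siegelPoint a B)) =
      transposeOp (Ring.inverse a) ∘L conjOp (Ring.inverse a) := by
  have h1 := congrArg conjOp h.one_sub_conj_comp
  rwa [conjOp_sub, conjOp_one, conjOp_comp, conjOp_comp, ← op_star, star_star, ← op_star,
    conjOp_adjoint] at h1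

theorem inverse_one_sub_conj_comp (h : IsSymplecticPair a B) :
    Ring.inverse (1 - op (star (siegelPoint a B)) ∘L op (siegelPoint a B)) = a ∘L adjoint a := by
  rw [h.one_sub_conj_comp]
  have h1 : star (Ring.inverse a) * star a = 1 := by rw [← star_mul, h.mul_inverse, star_one]
  have h2 : star a * star (Ring.inverse a) = 1 := by rw [← star_mul, h.inverse_mul, star_one]
  refine ringInverse_eq_of_mul_eq_one ?_ ?_
  · change star (Ring.inverse a) * Ring.inverse a * (a * star a) = 1
    rw [mul_assoc, ← mul_assoc _ a, h.inverse_mul, one_mul, h1]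
  · change a * star a * (star (Ring.inverse a) * Ring.inverse a) = 1
    rw [mul_assoc, ← mul_assoc (star a), h2, one_mul, h.mul_inverse]

theorem inverse_one_sub_comp_conj (h : IsSymplecticPair a B) :
    Ring.inverse (1 - op (siegelPoint a B) ∘L op (star (siegelPoint a B))) =
      conjOp a ∘L transposeOp a := by
  have h0 : IsUnit (1 - op (star (siegelPoint a B)) ∘L op (siegelPoint a B)) := by
    rw [h.one_sub_conj_comp]
    exact (h.isUnit.ringInverse.star).mul h.isUnit.ringInverse
  have e1 := congrArg conjOp (Ring.mul_inverse_cancel _ h0)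
  have e2 := congrArg conjOp (Ring.inverse_mul_cancel _ h0)
  rw [h.inverse_one_sub_conj_comp, conjOp_one] at e1 e2
  have e3 : conjOp (1 - op (star (siegelPoint a B)) ∘L op (siegelPoint a B)) =
      1 - op (siegelPoint a B) ∘L op (star (siegelPoint a B)) := by
    rw [conjOp_sub, conjOp_one, conjOp_comp, ← op_star, star_star, ← op_star]
  rw [← e3]
  have e4 : conjOp (a ∘L adjoint a) = conjOp a ∘L transposeOp a := by
    rw [conjOp_comp, conjOp_adjoint]
  rw [← e4]
  exact ringInverse_eq_of_mul_eq_one ((conjOp_comp _ _).symm.trans e1)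
    ((conjOp_comp _ _).symm.trans e2)

theorem siegelPoint_mem (h : IsSymplecticPair a B) : siegelPoint a B ∈ siegelDisc := by
  refine ⟨(isSymm_iff _).2 h.transposeOp_siegelPoint, fun x hx => ?_⟩
  rw [h.one_sub_comp_conj, ContinuousLinearMap.comp_apply, ← conjOp_adjoint, ← adjoint_conjOp,
    ContinuousLinearMap.adjoint_inner_right, inner_self_eq_norm_sq_to_K]
  have h1 : conjOp a (conjOp (Ring.inverse a) x) = x := by
    rw [← ContinuousLinearMap.comp_apply, ← conjOp_comp]
    change conjOp (a * Ring.inverse a) x = x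
    rw [h.mul_inverse, conjOp_one]; rfl
  have h2 : conjOp (Ring.inverse a) x ≠ 0 := fun h0 => hx (by rw [← h1, h0, map_zero])
  have h3 : 0 < ‖conjOp (Ring.inverse a) x‖ ^ 2 := by positivity
  exact_mod_cast h3

theorem graph_siegelPoint (h : IsSymplecticPair a B) :
    graph (siegelPoint a B) = Set.range fun y => (a y, op B y) := by
  ext ⟨x, z⟩
  have h1 : ∀ y, op (siegelPoint a B) (a y) = op B y := fun y => by
    rw [← h.siegelPoint_comp]; rfl
  simp only [graph, Set.mem_ofPred_eq, Set.mem_range, Prod.mk.injEq]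
  constructor
  · rintro rfl
    refine ⟨Ring.inverse a x, ?_, ?_⟩
    · exact congrArg (fun K => K x) h.mul_inverse
    · rw [siegelPoint, op_hsRight]; rfl
  · rintro ⟨y, rfl, rfl⟩
    exact (h1 y).symm

/-- A formula for `b a⁻¹` in which the inverse is taken of a Hilbert-Schmidt perturbation of the
identity. -/
theorem siegelPoint_eq (h : IsSymplecticPair a B) :
    siegelPoint a B = hsRight (hsRight B (adjoint a))
      (Ring.inverse (1 + conjOp (op B) ∘L transposeOp (op B))) := by
  apply op_injective
  rw [siegelPoint, op_hsRight, op_hsRight, op_hsRight, ← h.gram_adjoint, ContinuousLinearMap.comp_assoc]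
  congr 1
  change Ring.inverse a = star a * Ring.inverse (a * star a)
  have h2 : star a * star (Ring.inverse a) = 1 := by rw [← star_mul, h.inverse_mul, star_one]
  have h3 := Ring.mul_inverse_cancel _ (h.isUnit.mul h.isUnit.star)
  calc Ring.inverse a = Ring.inverse a * (a * star a * Ring.inverse (a * star a)) := by
        rw [h3, mul_one]
    _ = Ring.inverse a * a * (star a * Ring.inverse (a * star a)) := by noncomm_ring
    _ = _ := by rw [h.inverse_mul, one_mul]

/-- The Siegel metric at `b a⁻¹` is the Hilbert-Schmidt inner product of the tangent vectors,
carried to the origin by `X ↦ aᵗ X a`. -/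
theorem hasSum_diagEntry_siegelOp (h : IsSymplecticPair a B) {X Y : HSOp}
    (hX : IsSymm X) :
    HasSum (diagEntry (siegelOp (siegelPoint a B) X Y))
      ⟪hsLeft (transposeOp a) (hsRight Y a), hsLeft (transposeOp a) (hsRight X a)⟫_ℂ := by
  have hX' := (isSymm_iff X).1 hX
  have h1 := hasSum_diagEntry_comp (hsLeft (conjOp a ∘L transposeOp a) X)
    (hsLeft (a ∘L adjoint a) (star Y))
  have e0 : siegelOp (siegelPoint a B) X Y = op (hsLeft (conjOp a ∘L transposeOp a) X) ∘L
      op (hsLeft (a ∘L adjoint a) (star Y)) := by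
    rw [siegelOp, h.inverse_one_sub_comp_conj, h.inverse_one_sub_conj_comp, op_hsLeft, op_hsLeft]
    simp only [ContinuousLinearMap.comp_assoc]
  rw [e0]
  convert h1 using 1
  have e1 : star (hsTranspose (hsLeft (conjOp a ∘L transposeOp a) X)) =
      hsRight (hsRight (star X) (conjOp a)) (transposeOp a) := by
    apply op_injective
    rw [op_star, op_hsTranspose, op_hsLeft, op_hsRight, op_hsRight, transposeOp_comp,
      transposeOp_comp, transposeOp_transposeOp, transposeOp_conjOp, hX', op_star, conjOp_comp,
      conjOp_comp, conjOp_adjoint, ContinuousLinearMap.comp_assoc]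
  have e2 : hsLeft (a ∘L adjoint a) (star Y) = hsLeft a (hsLeft (adjoint a) (star Y)) :=
    op_injective (by simp only [op_hsLeft, ContinuousLinearMap.comp_assoc])
  have e3 : ∀ W : HSOp, hsLeft (adjoint a) (hsRight (star W) (conjOp a)) =
      star (hsLeft (transposeOp a) (hsRight W a)) := fun W => op_injective (by
    rw [op_hsLeft, op_hsRight, op_star, op_star, op_hsLeft, op_hsRight, conjOp_comp, conjOp_comp,
      conjOp_transposeOp])
  have e4 : hsRight (hsLeft a (hsLeft (adjoint a) (star Y))) (conjOp a) =
      hsLeft a (hsLeft (adjoint a) (hsRight (star Y) (conjOp a))) :=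
    op_injective (by simp only [op_hsLeft, op_hsRight, ContinuousLinearMap.comp_assoc])
  have e5 := inner_hsLeft (adjoint a) (hsRight (star X) (conjOp a))
    (hsLeft (adjoint a) (hsRight (star Y) (conjOp a)))
  rw [ContinuousLinearMap.adjoint_adjoint] at e5
  rw [e1, e2, inner_hsRight, adjoint_transposeOp, e4, ← e5, e3, e3, inner_star_star,
    inner_conj_symm]

end IsSymplecticPair

/-! ### Families of smooth functions with bounds on their derivatives -/

/-- The members of the family `f` are smooth functions of the time, and for every bounded time
interval, their derivatives up to the order `n` are bounded by a constant multiple of the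
weights `w`. -/
def DerivBound {ι E : Type*} [NormedAddCommGroup E] [NormedSpace ℝ E] (n : ℕ) (f : ι → ℝ → E)
    (w : ι → ℝ) : Prop :=
  (∀ i, ContDiff ℝ ∞ (f i)) ∧
    ∀ R : ℝ, ∃ C : ℝ, 0 ≤ C ∧
      ∀ m ≤ n, ∀ i t, |t| ≤ R → ‖iteratedDeriv m (f i) t‖ ≤ C * w i

section

variable {ι κ E : Type*} [NormedAddCommGroup E] [NormedSpace ℝ E]

/-- A sequence of functions, each the derivative of the preceding one, consists of the iterated
derivatives of the first. -/
theorem iteratedDeriv_of_hasDerivAt {F : ℕ → ℝ → E}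
    (hF : ∀ m t, HasDerivAt (F m) (F (m + 1) t) t) (m : ℕ) : iteratedDeriv m (F 0) = F m := by
  induction m with
  | zero => exact iteratedDeriv_zero
  | succ m ih =>
    rw [iteratedDeriv_succ, ih]
    exact funext fun t => (hF m t).deriv

theorem contDiff_of_hasDerivAt {F : ℕ → ℝ → E}
    (hF : ∀ m t, HasDerivAt (F m) (F (m + 1) t) t) : ContDiff ℝ ∞ (F 0) := by
  rw [contDiff_infty]
  intro n
  suffices ∀ n m : ℕ, ContDiff ℝ n (F m) from this n 0
  intro n
  induction n with
  | zero =>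
    intro m
    exact contDiff_zero.2 (continuous_iff_continuousAt.2 fun t => (hF m t).continuousAt)
  | succ n ih =>
    intro m
    push_cast
    refine contDiff_succ_iff_deriv.2 ⟨fun t => (hF m t).differentiableAt, by simp, ?_⟩
    rw [show deriv (F m) = F (m + 1) from funext fun t => (hF m t).deriv]
    exact ih (m + 1)

theorem hasDerivAt_iteratedDeriv {f : ℝ → E} (hf : ContDiff ℝ ∞ f) (m : ℕ) (t : ℝ) :
    HasDerivAt (iteratedDeriv m f) (iteratedDeriv (m + 1) f t) t := by
  rw [iteratedDeriv_succ]
  exact (hf.differentiable_iteratedDeriv m (by exact_mod_cast WithTop.coe_lt_top _) t).hasDerivAt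

/-- It suffices to bound the members of a sequence in which each family is the derivative of
the preceding one, order by order. -/
theorem DerivBound.of_hasDerivAt {n : ℕ} {F : ι → ℕ → ℝ → E} {w : ι → ℝ}
    (hF : ∀ i m t, HasDerivAt (F i m) (F i (m + 1) t) t)
    (hb : ∀ m ≤ n, ∀ R : ℝ, ∃ C : ℝ, 0 ≤ C ∧ ∀ i t, |t| ≤ R → ‖F i m t‖ ≤ C * w i)
    (hw : ∀ i, 0 ≤ w i) :
    DerivBound n (fun i => F i 0) w := by
  refine ⟨fun i => contDiff_of_hasDerivAt (hF i), fun R => ?_⟩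
  have h : ∀ m, ∃ C : ℝ, 0 ≤ C ∧ (m ≤ n → ∀ i t, |t| ≤ R → ‖F i m t‖ ≤ C * w i) := fun m => by
    by_cases hm : m ≤ n
    · obtain ⟨C, h0, hC⟩ := hb m hm R
      exact ⟨C, h0, fun _ => hC⟩
    · exact ⟨0, le_rfl, fun h => absurd h hm⟩
  choose C h0 hC using h
  refine ⟨∑ m ∈ Finset.range (n + 1), C m, Finset.sum_nonneg fun m _ => h0 m,
    fun m hm i t ht => ?_⟩
  rw [iteratedDeriv_of_hasDerivAt (hF i)]
  refine (hC m hm i t ht).trans (mul_le_mul_of_nonneg_right ?_ (hw i))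
  exact Finset.single_le_sum (f := C) (fun m _ => h0 m) (Finset.mem_range.2 (by lia))

theorem DerivBound.mono {n : ℕ} {f : ι → ℝ → E} {w w' : ι → ℝ} (hf : DerivBound n f w) (K : ℝ)
    (h0 : 0 ≤ K) (h : ∀ i, w i ≤ K * w' i) : DerivBound n f w' := by
  refine ⟨hf.1, fun R => ?_⟩
  obtain ⟨C, hC0, hC⟩ := hf.2 R
  refine ⟨C * K, by positivity, fun m hm i t ht => (hC m hm i t ht).trans ?_⟩
  rw [mul_assoc]
  exact mul_le_mul_of_nonneg_left (h i) hC0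

theorem DerivBound.comp {n : ℕ} {f : ι → ℝ → E} {w : ι → ℝ} (hf : DerivBound n f w)
    (e : κ → ι) : DerivBound n (fun k => f (e k)) (fun k => w (e k)) := by
  refine ⟨fun k => hf.1 (e k), fun R => ?_⟩
  obtain ⟨C, hC0, hC⟩ := hf.2 R
  exact ⟨C, hC0, fun m hm i t ht => hC m hm (e i) t ht⟩

/-- Two bounds for the same family give a bound by the geometric mean of the weights. -/
theorem DerivBound.geom_mean {n : ℕ} {f : ι → ℝ → E} {w w' v : ι → ℝ} (hf : DerivBound n f w)
    (hf' : DerivBound n f w') (hv : ∀ i, 0 ≤ v i)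
    (h : ∀ i, w i * w' i ≤ v i ^ 2) : DerivBound n f v := by
  refine ⟨hf.1, fun R => ?_⟩
  obtain ⟨C, hC0, hC⟩ := hf.2 R
  obtain ⟨D, hD0, hD⟩ := hf'.2 R
  refine ⟨C + D, by positivity, fun m hm i t ht => ?_⟩
  have h1 := hC m hm i t ht
  have h2 := hD m hm i t ht
  refine le_of_sq_le_sq ?_ (mul_nonneg (by positivity) (hv i))
  calc ‖iteratedDeriv m (f i) t‖ ^ 2 ≤ (C * w i) * (D * w' i) := by
        rw [sq]
        exact mul_le_mul h1 h2 (norm_nonneg _) ((norm_nonneg _).trans h1)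
    _ = (C * D) * (w i * w' i) := by ring
    _ ≤ (C * D) * v i ^ 2 := mul_le_mul_of_nonneg_left (h i) (by positivity)
    _ ≤ (C + D) ^ 2 * v i ^ 2 := mul_le_mul_of_nonneg_right (by nlinarith) (by positivity)
    _ = ((C + D) * v i) ^ 2 := by ring

theorem DerivBound.mul {n : ℕ} {f g : ι → ℝ → ℂ} {w v : ι → ℝ} (hf : DerivBound n f w)
    (hg : DerivBound n g v) :
    DerivBound n (fun i t => f i t * g i t) (fun i => w i * v i) := by
  refine ⟨fun i => (hf.1 i).mul (hg.1 i), fun R => ?_⟩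
  obtain ⟨C, hC0, hC⟩ := hf.2 R
  obtain ⟨D, hD0, hD⟩ := hg.2 R
  refine ⟨2 ^ n * C * D, by positivity, fun m hm i t ht => ?_⟩
  have hw : 0 ≤ C * w i := (norm_nonneg _).trans (hC m hm i t ht)
  have hv : 0 ≤ D * v i := (norm_nonneg _).trans (hD m hm i t ht)
  rw [← norm_iteratedFDeriv_eq_norm_iteratedDeriv]
  refine (norm_iteratedFDeriv_mul_le (hf.1 i) (hg.1 i) t
    (by exact_mod_cast (WithTop.coe_lt_top _).le)).trans ?_
  simp only [norm_iteratedFDeriv_eq_norm_iteratedDeriv]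
  calc _ ≤ ∑ k ∈ Finset.range (m + 1), (m.choose k : ℝ) * (C * w i) * (D * v i) := by
        refine Finset.sum_le_sum fun k hk => ?_
        have hk' := Finset.mem_range.1 hk
        refine mul_le_mul (mul_le_mul_of_nonneg_left (hC k (by lia) i t ht) (by positivity))
          (hD (m - k) (by lia) i t ht) (norm_nonneg _) (by positivity)
    _ = 2 ^ m * ((C * w i) * (D * v i)) := by
        rw [← Nat.cast_two, ← Nat.cast_pow, ← Nat.sum_range_choose, Nat.cast_sum, Finset.sum_mul]
        exact Finset.sum_congr rfl fun k _ => by ring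
    _ ≤ 2 ^ n * ((C * w i) * (D * v i)) := by
        refine mul_le_mul_of_nonneg_right ?_ (by positivity)
        exact pow_le_pow_right₀ one_le_two hm
    _ = _ := by ring

theorem DerivBound.const_mul {n : ℕ} {f : ι → ℝ → ℂ} {w : ι → ℝ} (hf : DerivBound n f w)
    (c : ι → ℂ) : DerivBound n (fun i t => c i * f i t) (fun i => ‖c i‖ * w i) := by
  refine ⟨fun i => contDiff_const.mul (hf.1 i), fun R => ?_⟩
  obtain ⟨C, hC0, hC⟩ := hf.2 R
  refine ⟨C, hC0, fun m hm i t ht => ?_⟩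
  rw [iteratedDeriv_const_mul_field, norm_mul, mul_left_comm]
  exact mul_le_mul_of_nonneg_left (hC m hm i t ht) (norm_nonneg _)

theorem DerivBound.conj {n : ℕ} {f : ι → ℝ → ℂ} {w : ι → ℝ} (hf : DerivBound n f w) :
    DerivBound n (fun i t => conj (f i t)) w := by
  refine ⟨fun i => Complex.conjCLE.contDiff.comp (hf.1 i), fun R => ?_⟩
  obtain ⟨C, hC0, hC⟩ := hf.2 R
  refine ⟨C, hC0, fun m hm i t ht => ?_⟩
  refine le_trans (le_of_eq ?_) (hC m hm i t ht)
  have h := Complex.conjLIE.norm_iteratedFDeriv_comp_left (𝕜 := ℝ) (f i) t m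
  rw [norm_iteratedFDeriv_eq_norm_iteratedDeriv, norm_iteratedFDeriv_eq_norm_iteratedDeriv] at h
  exact h

theorem DerivBound.smul_const {n : ℕ} {f : ι → ℝ → ℂ} {w : ι → ℝ} [NormedSpace ℂ E]
    (hf : DerivBound n f w) {v : ι → E} (hv : ∀ i, ‖v i‖ ≤ 1) :
    DerivBound n (fun i t => f i t • v i) w := by
  refine ⟨fun i => (hf.1 i).smul contDiff_const, fun R => ?_⟩
  obtain ⟨C, hC0, hC⟩ := hf.2 R
  refine ⟨C, hC0, fun m hm i t ht => ?_⟩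
  have h := iteratedDeriv_of_hasDerivAt (F := fun m t => iteratedDeriv m (f i) t • v i)
    (fun m t => (hasDerivAt_iteratedDeriv (hf.1 i) m t).smul_const (v i)) m
  simp only [iteratedDeriv_zero] at h
  rw [h, norm_smul]
  exact (mul_le_of_le_one_right (norm_nonneg _) (hv i)).trans (hC m hm i t ht)

/-- Term by term differentiation of a series of smooth functions. -/
theorem hasDerivAt_tsum_iteratedDeriv [CompleteSpace E] {f : ι → ℝ → E}
    (hf : ∀ n, ∃ w : ι → ℝ, Summable w ∧ DerivBound n f w) (m : ℕ) (t : ℝ) :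
    HasDerivAt (fun t => ∑' i, iteratedDeriv m (f i) t) (∑' i, iteratedDeriv (m + 1) (f i) t) t := by
  obtain ⟨w, hw, hfw⟩ := hf (m + 1)
  obtain ⟨C, -, hC⟩ := hfw.2 (|t| + 1)
  have ht : t ∈ Metric.ball (0 : ℝ) (|t| + 1) := by simp
  have hs : ∀ y ∈ Metric.ball (0 : ℝ) (|t| + 1), |y| ≤ |t| + 1 := fun y hy => by
    simpa using (Metric.mem_ball.1 hy).le
  refine hasDerivAt_tsum_of_isPreconnected (hw.mul_left C) Metric.isOpen_ball
    (convex_ball _ _).isPreconnected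
    (fun i y _ => hasDerivAt_iteratedDeriv (hfw.1 i) m y)
    (fun i y hy => hC (m + 1) le_rfl i y (hs y hy)) ht ?_ ht
  exact Summable.of_norm_bounded (hw.mul_left C) fun i => hC m (by lia) i t (hs t ht)

theorem contDiff_tsum_of_derivBound [CompleteSpace E] {f : ι → ℝ → E}
    (hf : ∀ n, ∃ w : ι → ℝ, Summable w ∧ DerivBound n f w) :
    ContDiff ℝ ∞ (fun t => ∑' i, f i t) := by
  simpa using contDiff_of_hasDerivAt (hasDerivAt_tsum_iteratedDeriv hf)

theorem iteratedDeriv_tsum_of_derivBound [CompleteSpace E] {f : ι → ℝ → E}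
    (hf : ∀ n, ∃ w : ι → ℝ, Summable w ∧ DerivBound n f w) (m : ℕ) :
    iteratedDeriv m (fun t => ∑' i, f i t) = fun t => ∑' i, iteratedDeriv m (f i) t := by
  simpa using iteratedDeriv_of_hasDerivAt (hasDerivAt_tsum_iteratedDeriv hf) m

/-- A family of series whose terms are bounded by a product of weights, summable in the index
of summation. -/
theorem DerivBound.tsum {f : ι × κ → ℝ → ℂ} {u : ι → ℝ} {b : κ → ℝ} (hu : ∀ i, 0 ≤ u i)
    (hb : Summable b)
    (hf : ∀ n, DerivBound n f fun x => u x.1 * b x.2) (n : ℕ) :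
    DerivBound n (fun i t => ∑' k, f (i, k) t) u := by
  have h : ∀ i n, ∃ w : κ → ℝ, Summable w ∧ DerivBound n (fun k => f (i, k)) w :=
    fun i n => ⟨_, hb.mul_left (u i), (hf n).comp (Prod.mk i)⟩
  refine ⟨fun i => contDiff_tsum_of_derivBound (h i), fun R => ?_⟩
  obtain ⟨C, hC0, hC⟩ := (hf n).2 R
  refine ⟨C * |∑' k, b k|, by positivity, fun m hm i t ht => ?_⟩
  rw [iteratedDeriv_tsum_of_derivBound (h i)]
  have hs : Summable fun k => C * (u i * b k) := (hb.mul_left _).mul_left _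
  have h1 : ‖∑' k, iteratedDeriv m (f (i, k)) t‖ ≤ ∑' k, C * (u i * b k) :=
    tsum_of_norm_bounded hs.hasSum fun k => hC m hm (i, k) t ht
  have h2 : ∑' k, C * (u i * b k) = C * (∑' k, b k) * u i := by
    rw [tsum_mul_left, tsum_mul_left]; ring
  rw [h2] at h1
  exact h1.trans (mul_le_mul_of_nonneg_right
    (mul_le_mul_of_nonneg_left (le_abs_self _) hC0) (hu i))

/-- A family of smooth functions whose derivatives have locally uniform summable bounds is a
smooth curve in the space of square summable families. -/
theorem exists_contDiff_lp {f : ι → ℝ → ℂ}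
    (hf : ∀ n, ∃ w : ι → ℝ, Summable w ∧ DerivBound n f w) :
    ∃ g : ℝ → lp (fun _ : ι => ℂ) 2, ContDiff ℝ ∞ g ∧ ∀ t i, g t i = f i t := by
  classical
  let v : ι → lp (fun _ : ι => ℂ) 2 := fun i => lp.single 2 i 1
  have hv : ∀ i, ‖v i‖ ≤ 1 := fun i => by
    rw [lp.norm_single (E := fun _ : ι => ℂ) (by norm_num), norm_one]
  have h : ∀ n, ∃ w : ι → ℝ, Summable w ∧ DerivBound n (fun i t => f i t • v i) w :=
    fun n => by
      obtain ⟨w, hw, hfw⟩ := hf n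
      exact ⟨w, hw, hfw.smul_const hv⟩
  refine ⟨_, contDiff_tsum_of_derivBound h, fun t i => ?_⟩
  obtain ⟨w, hw, hfw⟩ := h 0
  obtain ⟨C, -, hC⟩ := hfw.2 |t|
  have hs : Summable fun i => f i t • v i :=
    Summable.of_norm_bounded (hw.mul_left C) fun i => by simpa using hC 0 le_rfl i t le_rfl
  have h1 : HasSum (fun j => (f j t • v j) i) ((∑' j, f j t • v j) i) :=
    hs.hasSum.mapL (lp.evalCLM ℂ (fun _ : ι => ℂ) 2 i)
  have h2 : (fun j => (f j t • v j) i) = fun j => if j = i then f i t else 0 := by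
    funext j
    rw [lp.coeFn_smul, Pi.smul_apply, lp.single_apply]
    by_cases hij : j = i
    · subst hij; simp
    · simp [hij]
  rw [h2] at h1
  exact h1.unique (hasSum_ite_eq i _)

end

/-! ### Oscillatory integrals over the circle -/

/-- A smooth function of an auxiliary parameter `x`, the time `t` and the angle `θ`, periodic in
the angle. -/
structure SmoothPeriodic (g : ℝ × ℝ × ℝ → ℂ) : Prop where
  smooth : ContDiff ℝ ∞ g
  periodic : ∀ v, g (v + (0, 0, 2 * Real.pi)) = g v

/-- The derivative with respect to the time, the second variable. -/
def dTime (g : ℝ × ℝ × ℝ → ℂ) (v : ℝ × ℝ × ℝ) : ℂ := fderiv ℝ g v (0, 1, 0)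

/-- The derivative with respect to the angle, the third variable. -/
def dAngle (g : ℝ × ℝ × ℝ → ℂ) (v : ℝ × ℝ × ℝ) : ℂ := fderiv ℝ g v (0, 0, 1)

/-- The integral over a full turn of the angle, as a function of the parameter and the time. -/
def angleIntegral (g : ℝ × ℝ × ℝ → ℂ) (x t : ℝ) : ℂ := ∫ θ in (0 : ℝ)..(2 * Real.pi), g (x, t, θ)

namespace SmoothPeriodic

variable {g h : ℝ × ℝ × ℝ → ℂ}

theorem fderiv_apply (hg : SmoothPeriodic g) (e : ℝ × ℝ × ℝ) :
    SmoothPeriodic (fun v => fderiv ℝ g v e) where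
  smooth := (hg.smooth.fderiv_right (m := ∞) (by simp)).clm_apply contDiff_const
  periodic v := by
    rw [← fderiv_comp_add_right, funext hg.periodic]

theorem dTime (hg : SmoothPeriodic g) : SmoothPeriodic (dTime g) := hg.fderiv_apply _

theorem dAngle (hg : SmoothPeriodic g) : SmoothPeriodic (dAngle g) := hg.fderiv_apply _

theorem mul (hg : SmoothPeriodic g) (hh : SmoothPeriodic h) :
    SmoothPeriodic (fun v => g v * h v) :=
  ⟨hg.smooth.mul hh.smooth, fun v => by rw [hg.periodic, hh.periodic]⟩

theorem add (hg : SmoothPeriodic g) (hh : SmoothPeriodic h) :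
    SmoothPeriodic (fun v => g v + h v) :=
  ⟨hg.smooth.add hh.smooth, fun v => by rw [hg.periodic, hh.periodic]⟩

theorem sub (hg : SmoothPeriodic g) (hh : SmoothPeriodic h) :
    SmoothPeriodic (fun v => g v - h v) :=
  ⟨hg.smooth.sub hh.smooth, fun v => by rw [hg.periodic, hh.periodic]⟩

theorem div (hg : SmoothPeriodic g) (hh : SmoothPeriodic h) (h0 : ∀ v, h v ≠ 0) :
    SmoothPeriodic (fun v => g v / h v) :=
  ⟨by
    have h1 := hg.smooth.mul (hh.smooth.inv h0)
    simp only [div_eq_mul_inv]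
    exact h1, fun v => by rw [hg.periodic, hh.periodic]⟩

theorem pow (hg : SmoothPeriodic g) (n : ℕ) : SmoothPeriodic (fun v => g v ^ n) :=
  ⟨hg.smooth.pow n, fun v => by rw [hg.periodic]⟩

theorem const (c : ℂ) : SmoothPeriodic (fun _ => c) := ⟨contDiff_const, fun _ => rfl⟩

theorem of_param {f : ℝ → ℂ} (hf : ContDiff ℝ ∞ f) : SmoothPeriodic (fun v => f v.1) :=
  ⟨hf.comp contDiff_fst, fun v => by simp⟩

theorem exp_int (k : ℤ) :
    SmoothPeriodic (fun v => Complex.exp (k * v.2.2 * Complex.I)) where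
  smooth := by
    refine Complex.contDiff_exp.comp ((contDiff_const.mul ?_).mul contDiff_const)
    exact Complex.ofRealCLM.contDiff.comp (contDiff_snd.comp contDiff_snd)
  periodic v := by
    refine Complex.exp_eq_exp_iff_exists_int.2 ⟨k, ?_⟩
    simp only [Prod.snd_add]
    push_cast
    ring

theorem hasDerivAt_time (hg : SmoothPeriodic g) (x t θ : ℝ) :
    HasDerivAt (fun t => g (x, t, θ)) (CirclePeriod.dTime g (x, t, θ)) t := by
  have h1 : HasDerivAt (fun t : ℝ => (x, t, θ)) (0, 1, 0) t :=
    (hasDerivAt_const t x).prodMk ((hasDerivAt_id t).prodMk (hasDerivAt_const t θ))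
  exact ((hg.smooth.differentiable (by simp)) (x, t, θ)).hasFDerivAt.comp_hasDerivAt t h1

theorem hasDerivAt_angle (hg : SmoothPeriodic g) (x t θ : ℝ) :
    HasDerivAt (fun θ => g (x, t, θ)) (CirclePeriod.dAngle g (x, t, θ)) θ := by
  have h1 : HasDerivAt (fun θ : ℝ => (x, t, θ)) (0, 0, 1) θ :=
    (hasDerivAt_const θ x).prodMk ((hasDerivAt_const θ t).prodMk (hasDerivAt_id θ))
  exact ((hg.smooth.differentiable (by simp)) (x, t, θ)).hasFDerivAt.comp_hasDerivAt θ h1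

theorem continuous_angle (hg : SmoothPeriodic g) (x t : ℝ) : Continuous fun θ => g (x, t, θ) :=
  hg.smooth.continuous.comp (by fun_prop)

theorem intervalIntegrable (hg : SmoothPeriodic g) (x t : ℝ) :
    IntervalIntegrable (fun θ => g (x, t, θ)) MeasureTheory.volume 0 (2 * Real.pi) :=
  (hg.continuous_angle x t).intervalIntegrable _ _

/-- A bound on a compact range of the parameters; the range `|x| ≤ 2` contains all the values of
the auxiliary parameter which are used. -/
theorem exists_bound (hg : SmoothPeriodic g) (R : ℝ) :
    ∃ C : ℝ, 0 ≤ C ∧ ∀ x t θ : ℝ, |x| ≤ 2 → |t| ≤ R → θ ∈ Set.Icc 0 (2 * Real.pi) →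
      ‖g (x, t, θ)‖ ≤ C := by
  have hK : IsCompact (Set.Icc (-2 : ℝ) 2 ×ˢ Set.Icc (-R) R ×ˢ Set.Icc 0 (2 * Real.pi)) :=
    isCompact_Icc.prod (isCompact_Icc.prod isCompact_Icc)
  obtain ⟨C, hC⟩ := hK.exists_bound_of_continuousOn hg.smooth.continuous.continuousOn
  exact ⟨|C|, abs_nonneg _, fun x t θ hx ht hθ =>
    (hC (x, t, θ) ⟨abs_le.1 hx, abs_le.1 ht, hθ⟩).trans (le_abs_self C)⟩

theorem hasDerivAt_angleIntegral (hg : SmoothPeriodic g) (x t : ℝ) :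
    HasDerivAt (fun t => angleIntegral g x t) (angleIntegral (CirclePeriod.dTime g) x t) t := by
  have hK : IsCompact (({x} : Set ℝ) ×ˢ Set.Icc (t - 1) (t + 1) ×ˢ Set.Icc 0 (2 * Real.pi)) :=
    isCompact_singleton.prod (isCompact_Icc.prod isCompact_Icc)
  obtain ⟨C, hC⟩ := hK.exists_bound_of_continuousOn hg.dTime.smooth.continuous.continuousOn
  refine (intervalIntegral.hasDerivAt_integral_of_dominated_loc_of_deriv_le
    (F := fun t θ => g (x, t, θ)) (F' := fun t θ => CirclePeriod.dTime g (x, t, θ))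
    (bound := fun _ => C) (s := Metric.ball t 1) (Metric.ball_mem_nhds t one_pos)
    (Filter.Eventually.of_forall fun t' => (hg.continuous_angle x t').aestronglyMeasurable)
    (hg.intervalIntegrable x t) (hg.dTime.continuous_angle x t).aestronglyMeasurable
    (Filter.Eventually.of_forall fun θ hθ t' ht' => ?_)
    intervalIntegrable_const
    (Filter.Eventually.of_forall fun θ hθ t' ht' => hg.hasDerivAt_time x t' θ)).2
  rw [Set.uIoc_of_le (by positivity)] at hθ
  rw [Real.ball_eq_Ioo] at ht'
  exact hC _ ⟨rfl, ⟨ht'.1.le, ht'.2.le⟩, ⟨hθ.1.le, hθ.2⟩⟩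

theorem angleIntegral_dAngle (hg : SmoothPeriodic g) (x t : ℝ) :
    angleIntegral (CirclePeriod.dAngle g) x t = 0 := by
  rw [angleIntegral, intervalIntegral.integral_eq_sub_of_hasDerivAt
    (fun θ _ => hg.hasDerivAt_angle x t θ) (hg.dAngle.intervalIntegrable x t)]
  have h := hg.periodic (x, t, 0)
  simp only [Prod.mk_add_mk, add_zero, zero_add] at h
  rw [h, sub_self]

theorem dTime_mul (hg : SmoothPeriodic g) (hh : SmoothPeriodic h) (x t θ : ℝ) :
    CirclePeriod.dTime (fun v => g v * h v) (x, t, θ) =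
      CirclePeriod.dTime g (x, t, θ) * h (x, t, θ) +
        g (x, t, θ) * CirclePeriod.dTime h (x, t, θ) :=
  ((hg.mul hh).hasDerivAt_time x t θ).unique
    ((hg.hasDerivAt_time x t θ).mul (hh.hasDerivAt_time x t θ))

theorem dAngle_mul (hg : SmoothPeriodic g) (hh : SmoothPeriodic h) (x t θ : ℝ) :
    CirclePeriod.dAngle (fun v => g v * h v) (x, t, θ) =
      CirclePeriod.dAngle g (x, t, θ) * h (x, t, θ) +
        g (x, t, θ) * CirclePeriod.dAngle h (x, t, θ) :=
  ((hg.mul hh).hasDerivAt_angle x t θ).unique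
    ((hg.hasDerivAt_angle x t θ).mul (hh.hasDerivAt_angle x t θ))

theorem dAngle_exp_int (k : ℤ) (x t θ : ℝ) :
    CirclePeriod.dAngle (fun v => Complex.exp (k * v.2.2 * Complex.I)) (x, t, θ) =
      Complex.exp (k * θ * Complex.I) * (k * Complex.I) := by
  refine ((exp_int k).hasDerivAt_angle x t θ).unique ?_
  have h1 : HasDerivAt (fun θ : ℝ => (k * θ * Complex.I : ℂ)) (k * Complex.I) θ := by
    simpa using ((Complex.ofRealCLM.hasDerivAt (x := θ)).const_mul (k : ℂ)).mul_const Complex.I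
  exact h1.cexp

theorem dTime_exp_int (k : ℤ) (x t θ : ℝ) :
    CirclePeriod.dTime (fun v => Complex.exp (k * v.2.2 * Complex.I)) (x, t, θ) = 0 :=
  ((exp_int k).hasDerivAt_time x t θ).unique
    (hasDerivAt_const t (Complex.exp (k * θ * Complex.I)))

end SmoothPeriodic

theorem norm_exp_int_mul (k : ℤ) (θ : ℝ) : ‖Complex.exp (k * θ * Complex.I)‖ = 1 := by
  rw [show (k * θ * Complex.I : ℂ) = ((k * θ : ℝ) : ℂ) * Complex.I by push_cast; ring]
  exact Complex.norm_exp_ofReal_mul_I _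

/-- The trivial bound of an integral against a function of absolute value one. -/
theorem norm_angleIntegral_le {P g : ℝ × ℝ × ℝ → ℂ} (hP : ∀ v, ‖P v‖ = 1) {C x t : ℝ}
    (hC : ∀ θ ∈ Set.Icc 0 (2 * Real.pi), ‖g (x, t, θ)‖ ≤ C) :
    ‖angleIntegral (fun v => P v * g v) x t‖ ≤ C * (2 * Real.pi) := by
  have h := intervalIntegral.norm_integral_le_of_norm_le_const (a := 0) (b := 2 * Real.pi)
    (f := fun θ => P (x, t, θ) * g (x, t, θ)) (C := C) fun θ hθ => by
      rw [Set.uIoc_of_le (by positivity)] at hθ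
      rw [norm_mul, hP, one_mul]
      exact hC θ ⟨hθ.1.le, hθ.2⟩
  rwa [sub_zero, abs_of_nonneg (by positivity)] at h

/-- The Fourier coefficients of a smooth function are rapidly decreasing, together with their
derivatives with respect to the time. -/
theorem derivBound_fourier {g : ℝ × ℝ × ℝ → ℂ} (hg : SmoothPeriodic g) (n N : ℕ) :
    DerivBound n (fun (k : ℤ) t =>
      angleIntegral (fun v => Complex.exp (k * v.2.2 * Complex.I) * g v) 0 t)
      (fun k => ((1 + (k : ℝ) ^ 2) ^ N)⁻¹) := by
  let G : ℕ → ℝ × ℝ × ℝ → ℂ := fun m => dTime^[m] g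
  have hG : ∀ m, SmoothPeriodic (G m) := fun m => by
    induction m with
    | zero => exact hg
    | succ m ih => simp only [G, Function.iterate_succ_apply']; exact ih.dTime
  -- integrating by parts twice
  have hparts : ∀ {h : ℝ × ℝ × ℝ → ℂ}, SmoothPeriodic h → ∀ (k : ℤ) (t : ℝ),
      (1 + (k : ℂ) ^ 2) *
        angleIntegral (fun v => Complex.exp (k * v.2.2 * Complex.I) * h v) 0 t =
        angleIntegral (fun v => Complex.exp (k * v.2.2 * Complex.I) *
          (h v - dAngle (dAngle h) v)) 0 t := by
    intro h hh k t
    have key : ∀ {f : ℝ × ℝ × ℝ → ℂ}, SmoothPeriodic f →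
        angleIntegral (fun v => Complex.exp (k * v.2.2 * Complex.I) * dAngle f v) 0 t =
        -(k * Complex.I) * angleIntegral (fun v => Complex.exp (k * v.2.2 * Complex.I) * f v) 0 t := by
      intro f hf
      have h0 := ((SmoothPeriodic.exp_int k).mul hf).angleIntegral_dAngle 0 t
      simp only [angleIntegral, (SmoothPeriodic.exp_int k).dAngle_mul hf,
        SmoothPeriodic.dAngle_exp_int] at h0 ⊢
      rw [intervalIntegral.integral_add
        ((((SmoothPeriodic.exp_int k).mul (SmoothPeriodic.const _)).mul hf).intervalIntegrable 0 t)
        (((SmoothPeriodic.exp_int k).mul hf.dAngle).intervalIntegrable 0 t)] at h0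
      rw [eq_neg_of_add_eq_zero_right h0, ← intervalIntegral.integral_const_mul,
        ← intervalIntegral.integral_neg]
      congr 1
      funext θ
      ring
    have h1 := key hh.dAngle
    rw [key hh] at h1
    have h2 : angleIntegral (fun v => Complex.exp (k * v.2.2 * Complex.I) *
          (h v - dAngle (dAngle h) v)) 0 t =
        angleIntegral (fun v => Complex.exp (k * v.2.2 * Complex.I) * h v) 0 t -
        angleIntegral (fun v => Complex.exp (k * v.2.2 * Complex.I) * dAngle (dAngle h) v) 0 t := by
      simp only [angleIntegral, mul_sub]
      exact intervalIntegral.integral_sub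
        (((SmoothPeriodic.exp_int k).mul hh).intervalIntegrable 0 t)
        (((SmoothPeriodic.exp_int k).mul hh.dAngle.dAngle).intervalIntegrable 0 t)
    rw [h2, h1]
    linear_combination ((k : ℂ) ^ 2 *
      angleIntegral (fun v => Complex.exp (k * v.2.2 * Complex.I) * h v) 0 t) * Complex.I_sq
  have hdecay : ∀ (N : ℕ) {h : ℝ × ℝ × ℝ → ℂ}, SmoothPeriodic h → ∀ R : ℝ, ∃ C : ℝ, 0 ≤ C ∧
      ∀ (k : ℤ) t, |t| ≤ R →
        ‖angleIntegral (fun v => Complex.exp (k * v.2.2 * Complex.I) * h v) 0 t‖ ≤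
          C * ((1 + (k : ℝ) ^ 2) ^ N)⁻¹ := by
    intro N
    induction N with
    | zero =>
      intro h hh R
      obtain ⟨C, hC0, hC⟩ := hh.exists_bound R
      refine ⟨C * (2 * Real.pi), by positivity, fun k t ht => ?_⟩
      rw [pow_zero, inv_one, mul_one]
      exact norm_angleIntegral_le (fun v => norm_exp_int_mul k v.2.2)
        fun θ hθ => hC 0 t θ (by simp) ht hθ
    | succ N ih =>
      intro h hh R
      obtain ⟨C, hC0, hC⟩ := ih (hh.sub hh.dAngle.dAngle) R
      refine ⟨C, hC0, fun k t ht => ?_⟩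
      have h1 := hC k t ht
      rw [← hparts hh, norm_mul] at h1
      have h2 : ‖(1 + (k : ℂ) ^ 2)‖ = 1 + (k : ℝ) ^ 2 := by
        rw [show (1 + (k : ℂ) ^ 2) = ((1 + (k : ℝ) ^ 2 : ℝ) : ℂ) by push_cast; rfl,
          Complex.norm_real, Real.norm_of_nonneg (by positivity)]
      have h3 : (0 : ℝ) < 1 + (k : ℝ) ^ 2 := by positivity
      rw [h2] at h1
      rw [pow_succ, mul_inv, ← mul_assoc, ← div_eq_mul_inv, le_div_iff₀ h3, mul_comm]
      exact h1
  refine DerivBound.of_hasDerivAt (F := fun (k : ℤ) m t =>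
    angleIntegral (fun v => Complex.exp (k * v.2.2 * Complex.I) * G m v) 0 t)
    (fun k m t => ?_) (fun m _ R => hdecay N (hG m) R) (fun k => by positivity)
  have h := ((SmoothPeriodic.exp_int k).mul (hG m)).hasDerivAt_angleIntegral 0 t
  refine h.congr_deriv ?_
  rw [show G (m + 1) = dTime (G m) from Function.iterate_succ_apply' _ _ _]
  simp only [angleIntegral, (SmoothPeriodic.exp_int k).dTime_mul (hG m),
    SmoothPeriodic.dTime_exp_int, zero_mul, zero_add]

/-! ### Oscillatory integrals of a family of immersions of the circle -/

/-- `F t θ` is the value at the angle `θ` of a family of maps of the circle to itself; `α` and `β`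
are the derivatives of the angle of the value with respect to the time and to the angle `θ`. The
maps are immersions that preserve the orientation. -/
structure AngleFamily (F : ℝ → ℝ → ℂ) (α β : ℝ → ℝ → ℝ) : Prop where
  smooth : SmoothPeriodic fun v => F v.2.1 v.2.2
  norm_eq : ∀ t θ, ‖F t θ‖ = 1
  smooth_time : SmoothPeriodic fun v => (α v.2.1 v.2.2 : ℂ)
  smooth_angle : SmoothPeriodic fun v => (β v.2.1 v.2.2 : ℂ)
  hasDerivAt_time : ∀ t θ, HasDerivAt (fun t => F t θ) (F t θ * (α t θ * Complex.I)) t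
  hasDerivAt_angle : ∀ t θ, HasDerivAt (fun θ => F t θ) (F t θ * (β t θ * Complex.I)) θ
  pos : ∀ t θ, 0 < β t θ

/-- The function `F^q e^{ikθ}`. -/
def phase (F : ℝ → ℝ → ℂ) (k : ℤ) (q : ℕ) (v : ℝ × ℝ × ℝ) : ℂ :=
  F v.2.1 v.2.2 ^ q * Complex.exp (k * v.2.2 * Complex.I)

namespace AngleFamily

variable {F : ℝ → ℝ → ℂ} {α β : ℝ → ℝ → ℝ}

theorem smooth_phase (hF : AngleFamily F α β) (k : ℤ) (q : ℕ) : SmoothPeriodic (phase F k q) :=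
  (hF.smooth.pow q).mul (SmoothPeriodic.exp_int k)

theorem norm_phase (hF : AngleFamily F α β) (k : ℤ) (q : ℕ) (v : ℝ × ℝ × ℝ) :
    ‖phase F k q v‖ = 1 := by
  rw [phase, norm_mul, norm_pow, hF.norm_eq, one_pow, one_mul, norm_exp_int_mul]

theorem hasDerivAt_pow_time (hF : AngleFamily F α β) (q : ℕ) (t θ : ℝ) :
    HasDerivAt (fun t => F t θ ^ q) (F t θ ^ q * (q * α t θ * Complex.I)) t := by
  refine ((hF.hasDerivAt_time t θ).pow q).congr_deriv ?_
  cases q with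
  | zero => simp
  | succ q => simp only [Nat.add_sub_cancel, pow_succ]; push_cast; ring

theorem hasDerivAt_pow_angle (hF : AngleFamily F α β) (q : ℕ) (t θ : ℝ) :
    HasDerivAt (fun θ => F t θ ^ q) (F t θ ^ q * (q * β t θ * Complex.I)) θ := by
  refine ((hF.hasDerivAt_angle t θ).pow q).congr_deriv ?_
  cases q with
  | zero => simp
  | succ q => simp only [Nat.add_sub_cancel, pow_succ]; push_cast; ring

theorem dTime_phase (hF : AngleFamily F α β) (k : ℤ) (q : ℕ) (x t θ : ℝ) :
    dTime (phase F k q) (x, t, θ) = phase F k q (x, t, θ) * (q * α t θ * Complex.I) := by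
  refine ((hF.smooth_phase k q).hasDerivAt_time x t θ).unique ?_
  refine ((hF.hasDerivAt_pow_time q t θ).mul_const
    (Complex.exp (k * θ * Complex.I))).congr_deriv ?_
  simp only [phase]
  ring

theorem dAngle_phase (hF : AngleFamily F α β) (k : ℤ) (q : ℕ) (x t θ : ℝ) :
    dAngle (phase F k q) (x, t, θ) =
      phase F k q (x, t, θ) * ((q * β t θ + k) * Complex.I) := by
  unfold phase
  rw [(hF.smooth.pow q).dAngle_mul (SmoothPeriodic.exp_int k), SmoothPeriodic.dAngle_exp_int,
    ((hF.smooth.pow q).hasDerivAt_angle x t θ).unique (hF.hasDerivAt_pow_angle q t θ)]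
  ring

theorem hasDerivAt_angleIntegral (hF : AngleFamily F α β) {g : ℝ × ℝ × ℝ → ℂ}
    (hg : SmoothPeriodic g) (k : ℤ) (q : ℕ) (x t : ℝ) :
    HasDerivAt (fun t => angleIntegral (fun v => phase F k q v * g v) x t)
      (angleIntegral (fun v => phase F k q v *
        (dTime g v + q * α v.2.1 v.2.2 * Complex.I * g v)) x t) t := by
  refine (((hF.smooth_phase k q).mul hg).hasDerivAt_angleIntegral x t).congr_deriv ?_
  simp only [angleIntegral, (hF.smooth_phase k q).dTime_mul hg, hF.dTime_phase]
  congr 1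
  funext θ
  ring

/-- Integration by parts against the phase. -/
theorem angleIntegral_parts (hF : AngleFamily F α β) {g : ℝ × ℝ × ℝ → ℂ}
    (hg : SmoothPeriodic g) (k : ℤ) (q : ℕ) (x t : ℝ) :
    angleIntegral (fun v => phase F k q v *
        ((q * β v.2.1 v.2.2 + k) * Complex.I * g v)) x t =
      -angleIntegral (fun v => phase F k q v * dAngle g v) x t := by
  have hP := hF.smooth_phase k q
  have h0 := (hP.mul hg).angleIntegral_dAngle x t
  simp only [angleIntegral, hP.dAngle_mul hg, hF.dAngle_phase] at h0 ⊢
  have hs : SmoothPeriodic (fun v => (q * β v.2.1 v.2.2 + k : ℂ) * Complex.I) :=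
    (((SmoothPeriodic.const q).mul hF.smooth_angle).add (SmoothPeriodic.const k)).mul
      (SmoothPeriodic.const Complex.I)
  rw [intervalIntegral.integral_add (((hP.mul hs).mul hg).intervalIntegrable x t)
    ((hP.mul hg.dAngle).intervalIntegrable x t)] at h0
  rw [← eq_neg_of_add_eq_zero_left h0]
  congr 1
  funext θ
  ring

/-- The angular derivative of the interpolation `sin² x · F + cos² x · id`. -/
def interpDensity (β : ℝ → ℝ → ℝ) (v : ℝ × ℝ × ℝ) : ℂ :=
  Complex.sin v.1 ^ 2 * β v.2.1 v.2.2 + Complex.cos v.1 ^ 2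

theorem smooth_interpDensity (hF : AngleFamily F α β) : SmoothPeriodic (interpDensity β) := by
  have h1 : SmoothPeriodic (fun v => Complex.sin v.1) :=
    SmoothPeriodic.of_param ((Complex.contDiff_sin.restrict_scalars ℝ).comp Complex.ofRealCLM.contDiff)
  have h2 : SmoothPeriodic (fun v => Complex.cos v.1) :=
    SmoothPeriodic.of_param ((Complex.contDiff_cos.restrict_scalars ℝ).comp Complex.ofRealCLM.contDiff)
  exact ((h1.pow 2).mul hF.smooth_angle).add (h2.pow 2)

theorem interpDensity_ne_zero (hF : AngleFamily F α β) (v : ℝ × ℝ × ℝ) :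
    interpDensity β v ≠ 0 := by
  have h : interpDensity β v =
      ((Real.sin v.1 ^ 2 * β v.2.1 v.2.2 + Real.cos v.1 ^ 2 : ℝ) : ℂ) := by
    simp [interpDensity]
  rw [h, Complex.ofReal_ne_zero]
  have h1 := Real.sin_sq_add_cos_sq v.1
  have h2 := hF.pos v.2.1 v.2.2
  rcases (sq_nonneg (Real.sin v.1)).eq_or_lt' with h0 | h0
  · rw [h0] at h1 ⊢
    linarith
  · have := sq_nonneg (Real.cos v.1)
    positivity

/-- Division by the density, followed by the angular derivative: with the phase, this is division
by `-i n`. -/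
def partsOp (β : ℝ → ℝ → ℝ) (g : ℝ × ℝ × ℝ → ℂ) : ℝ × ℝ × ℝ → ℂ :=
  dAngle fun v => g v / interpDensity β v

/-- The time derivative of an integral against the phase, with the factor that comes from
the phase integrated by parts. -/
def timeOp (α β : ℝ → ℝ → ℝ) (g : ℝ × ℝ × ℝ → ℂ) : ℝ × ℝ × ℝ → ℂ :=
  fun v => dTime g v -
    dAngle (fun v => Complex.sin v.1 ^ 2 * α v.2.1 v.2.2 * g v / interpDensity β v) v

theorem smooth_partsOp (hF : AngleFamily F α β) {g : ℝ × ℝ × ℝ → ℂ} (hg : SmoothPeriodic g) :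
    SmoothPeriodic (partsOp β g) :=
  (hg.div hF.smooth_interpDensity hF.interpDensity_ne_zero).dAngle

theorem smooth_timeOp_aux (hF : AngleFamily F α β) {g : ℝ × ℝ × ℝ → ℂ}
    (hg : SmoothPeriodic g) :
    SmoothPeriodic fun v =>
      Complex.sin v.1 ^ 2 * α v.2.1 v.2.2 * g v / interpDensity β v := by
  have h1 : SmoothPeriodic (fun v => Complex.sin v.1) :=
    SmoothPeriodic.of_param ((Complex.contDiff_sin.restrict_scalars ℝ).comp Complex.ofRealCLM.contDiff)
  exact (((h1.pow 2).mul hF.smooth_time).mul hg).div hF.smooth_interpDensity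
    hF.interpDensity_ne_zero

theorem smooth_timeOp (hF : AngleFamily F α β) {g : ℝ × ℝ × ℝ → ℂ} (hg : SmoothPeriodic g) :
    SmoothPeriodic (timeOp α β g) :=
  hg.dTime.sub (hF.smooth_timeOp_aux hg).dAngle

/-- At `sin² x = q / (p + q)`, the angular derivative of the phase `q F + p θ` is `p + q` times the
interpolated density. -/
theorem density_eq {p q : ℕ} {x : ℝ}
    (hs : ((p + q : ℕ) : ℝ) * Real.sin x ^ 2 = q) (hc : ((p + q : ℕ) : ℝ) * Real.cos x ^ 2 = p)
    (t θ : ℝ) :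
    (q * β t θ + (p : ℤ) : ℂ) = (p + q : ℕ) * interpDensity β (x, t, θ) := by
  have hs' : ((p + q : ℕ) : ℂ) * Complex.sin x ^ 2 = q := by exact_mod_cast congrArg Complex.ofReal hs
  have hc' : ((p + q : ℕ) : ℂ) * Complex.cos x ^ 2 = p := by exact_mod_cast congrArg Complex.ofReal hc
  rw [interpDensity]
  push_cast at hs' hc' ⊢
  linear_combination (-(β t θ) : ℂ) * hs' - hc'

/-- Each application of `partsOp` gains a factor `1 / (p + q)`. -/
theorem angleIntegral_partsOp {p q : ℕ} {x : ℝ}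
    (hs : ((p + q : ℕ) : ℝ) * Real.sin x ^ 2 = q) (hc : ((p + q : ℕ) : ℝ) * Real.cos x ^ 2 = p)
    (hF : AngleFamily F α β) {g : ℝ × ℝ × ℝ → ℂ}
    (hg : SmoothPeriodic g) (t : ℝ) :
    ((p + q : ℕ) : ℂ) * Complex.I * angleIntegral (fun v => phase F p q v * g v) x t =
      -angleIntegral (fun v => phase F p q v * partsOp β g v) x t := by
  have h := hF.angleIntegral_parts (hg.div hF.smooth_interpDensity hF.interpDensity_ne_zero) p q x t
  unfold partsOp
  rw [← h]
  simp only [angleIntegral, density_eq hs hc]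
  rw [← intervalIntegral.integral_const_mul]
  congr 1
  funext θ
  have h0 := hF.interpDensity_ne_zero (x, t, θ)
  field_simp

/-- The factor `q` which differentiation in the time brings down from the phase is absorbed by an
integration by parts, so that `timeOp` does not depend on `p` and `q` except through `x`. -/
theorem hasDerivAt_timeOp {p q : ℕ} {x : ℝ}
    (hs : ((p + q : ℕ) : ℝ) * Real.sin x ^ 2 = q) (hc : ((p + q : ℕ) : ℝ) * Real.cos x ^ 2 = p)
    (hF : AngleFamily F α β) {g : ℝ × ℝ × ℝ → ℂ}
    (hg : SmoothPeriodic g) (t : ℝ) :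
    HasDerivAt (fun t => angleIntegral (fun v => phase F p q v * g v) x t)
      (angleIntegral (fun v => phase F p q v * timeOp α β g v) x t) t := by
  refine (hF.hasDerivAt_angleIntegral hg p q x t).congr_deriv ?_
  have hP := hF.smooth_phase p q
  have h := hF.angleIntegral_parts (hF.smooth_timeOp_aux hg) p q x t
  have hs' : ((p + q : ℕ) : ℂ) * Complex.sin x ^ 2 = q := by exact_mod_cast congrArg Complex.ofReal hs
  simp only [angleIntegral, density_eq hs hc, timeOp, mul_add, mul_sub] at h ⊢
  rw [intervalIntegral.integral_add ((hP.mul hg.dTime).intervalIntegrable x t)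
      ((hP.mul ((((SmoothPeriodic.const q).mul hF.smooth_time).mul
        (SmoothPeriodic.const Complex.I)).mul hg)).intervalIntegrable x t),
    intervalIntegral.integral_sub ((hP.mul hg.dTime).intervalIntegrable x t)
      ((hP.mul (hF.smooth_timeOp_aux hg).dAngle).intervalIntegrable x t), sub_eq_add_neg, ← h]
  congr 2
  funext θ
  have h0 := hF.interpDensity_ne_zero (x, t, θ)
  rw [← hs']
  field_simp

theorem exists_interp_param (p q : ℕ) (h : 0 < p + q) :
    ∃ x : ℝ, |x| ≤ 2 ∧ ((p + q : ℕ) : ℝ) * Real.sin x ^ 2 = q ∧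
      ((p + q : ℕ) : ℝ) * Real.cos x ^ 2 = p := by
  have hn : (0 : ℝ) < ((p + q : ℕ) : ℝ) := by exact_mod_cast h
  have h1 : (q : ℝ) / (p + q : ℕ) ≤ 1 := by
    rw [div_le_one hn]; push_cast; linarith [(Nat.cast_nonneg p : (0 : ℝ) ≤ p)]
  have h2 : √((q : ℝ) / (p + q : ℕ)) ≤ 1 := Real.sqrt_le_one.2 h1
  have h0 := Real.sqrt_nonneg ((q : ℝ) / (p + q : ℕ))
  have hs : ((p + q : ℕ) : ℝ) * Real.sin (Real.arcsin √((q : ℝ) / (p + q : ℕ))) ^ 2 = q := by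
    rw [Real.sin_arcsin (by linarith) h2, Real.sq_sqrt (by positivity)]
    field_simp
  refine ⟨Real.arcsin √((q : ℝ) / (p + q : ℕ)), ?_, hs, ?_⟩
  · rw [abs_le]
    constructor
    · linarith [Real.neg_pi_div_two_le_arcsin √((q : ℝ) / (p + q : ℕ)), Real.pi_lt_four]
    · linarith [Real.arcsin_le_pi_div_two √((q : ℝ) / (p + q : ℕ)), Real.pi_lt_four]
  · have h3 := Real.sin_sq_add_cos_sq (Real.arcsin √((q : ℝ) / (p + q : ℕ)))
    push_cast at hs h3 ⊢
    linear_combination ((p : ℝ) + q) * h3 - hs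

/-- The coefficients with indices of opposite sign are rapidly decreasing in both indices: for the
phase `q φ + p θ`, the angular derivative is at least a constant multiple of `p + q`. -/
theorem derivBound_negative (hF : AngleFamily F α β) (n N : ℕ) :
    DerivBound n (fun (i : ℕ+ × ℕ+) t => angleIntegral (phase F (i.1 : ℕ) i.2) 0 t)
      (fun i => (((i.1 : ℕ) + (i.2 : ℕ) : ℝ) ^ N)⁻¹) := by
  choose x hx2 hs hc using fun i : ℕ+ × ℕ+ => exists_interp_param i.1 i.2 (by positivity)
  let G : ℕ → ℝ × ℝ × ℝ → ℂ := fun m => (timeOp α β)^[m] fun _ => 1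
  have hG : ∀ m, SmoothPeriodic (G m) := fun m => by
    induction m with
    | zero => exact SmoothPeriodic.const 1
    | succ m ih => simp only [G, Function.iterate_succ_apply']; exact hF.smooth_timeOp ih
  have hdecay : ∀ (N : ℕ) {g : ℝ × ℝ × ℝ → ℂ}, SmoothPeriodic g → ∀ R : ℝ, ∃ C : ℝ, 0 ≤ C ∧
      ∀ (i : ℕ+ × ℕ+) t, |t| ≤ R →
        ‖angleIntegral (fun v => phase F (i.1 : ℕ) i.2 v * g v) (x i) t‖ ≤
          C * (((i.1 : ℕ) + (i.2 : ℕ) : ℝ) ^ N)⁻¹ := by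
    intro N
    induction N with
    | zero =>
      intro g hg R
      obtain ⟨C, hC0, hC⟩ := hg.exists_bound R
      refine ⟨C * (2 * Real.pi), by positivity, fun i t ht => ?_⟩
      rw [pow_zero, inv_one, mul_one]
      exact norm_angleIntegral_le (hF.norm_phase _ _)
        fun θ hθ => hC (x i) t θ (hx2 i) ht hθ
    | succ N ih =>
      intro g hg R
      obtain ⟨C, hC0, hC⟩ := ih (hF.smooth_partsOp hg) R
      refine ⟨C, hC0, fun i t ht => ?_⟩
      have h1 := hC i t ht
      rw [← norm_neg, ← angleIntegral_partsOp (hs i) (hc i) hF hg, norm_mul, norm_mul,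
        Complex.norm_I, mul_one, Complex.norm_natCast] at h1
      have h3 : (0 : ℝ) < (i.1 : ℕ) + (i.2 : ℕ) := by positivity
      rw [pow_succ, mul_inv, ← mul_assoc, ← div_eq_mul_inv, le_div_iff₀ h3, mul_comm]
      exact_mod_cast h1
  have hb := DerivBound.of_hasDerivAt (n := n) (F := fun (i : ℕ+ × ℕ+) m t =>
    angleIntegral (fun v => phase F (i.1 : ℕ) i.2 v * G m v) (x i) t)
    (w := fun i => (((i.1 : ℕ) + (i.2 : ℕ) : ℝ) ^ N)⁻¹)
    (fun i m t => by
      rw [show G (m + 1) = timeOp α β (G m) from Function.iterate_succ_apply' _ _ _]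
      exact hasDerivAt_timeOp (hs i) (hc i) hF (hG m) t)
    (fun m _ R => hdecay N (hG m) R) (fun i => by positivity)
  convert hb using 3
  simp [G, angleIntegral, phase]

/-- The coefficients with indices of the same sign grow at most polynomially, together with their
derivatives with respect to the time. -/
theorem derivBound_positive (hF : AngleFamily F α β) (n : ℕ) :
    DerivBound n (fun (i : ℕ+ × ℕ+) t => angleIntegral (phase F (-(i.1 : ℕ) : ℤ) i.2) 0 t)
      (fun i => (i.2 : ℝ) ^ n) := by
  -- with `y = 1/q`, the time derivative is `q` times an operator that depends smoothly on `y`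
  let T : (ℝ × ℝ × ℝ → ℂ) → ℝ × ℝ × ℝ → ℂ := fun g v =>
    v.1 * dTime g v + α v.2.1 v.2.2 * Complex.I * g v
  have hT : ∀ {g : ℝ × ℝ × ℝ → ℂ}, SmoothPeriodic g → SmoothPeriodic (T g) := fun hg =>
    ((SmoothPeriodic.of_param Complex.ofRealCLM.contDiff).mul hg.dTime).add
      ((hF.smooth_time.mul (SmoothPeriodic.const Complex.I)).mul hg)
  let G : ℕ → ℝ × ℝ × ℝ → ℂ := fun m => T^[m] fun _ => 1
  have hG : ∀ m, SmoothPeriodic (G m) := fun m => by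
    induction m with
    | zero => exact SmoothPeriodic.const 1
    | succ m ih => simp only [G, Function.iterate_succ_apply']; exact hT ih
  have hb := DerivBound.of_hasDerivAt (n := n) (F := fun (i : ℕ+ × ℕ+) m t =>
    (i.2 : ℂ) ^ m * angleIntegral (fun v => phase F (-(i.1 : ℕ) : ℤ) i.2 v * G m v)
      ((i.2 : ℝ)⁻¹) t)
    (w := fun i => (i.2 : ℝ) ^ n)
    (fun i m t => by
      rw [show G (m + 1) = T (G m) from Function.iterate_succ_apply' _ _ _]
      refine ((hF.hasDerivAt_angleIntegral (hG m) _ _ _ t).const_mul _).congr_deriv ?_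
      rw [pow_succ, mul_assoc]
      congr 1
      simp only [angleIntegral, T]
      rw [← intervalIntegral.integral_const_mul]
      congr 1
      funext θ
      have hq : ((i.2 : ℕ) : ℂ) ≠ 0 := by exact_mod_cast i.2.ne_zero
      push_cast
      field_simp)
    (fun m hm R => by
      obtain ⟨C, hC0, hC⟩ := (hG m).exists_bound R
      refine ⟨C * (2 * Real.pi), by positivity, fun i t ht => ?_⟩
      have hq : (1 : ℝ) ≤ (i.2 : ℕ) := by exact_mod_cast one_le (a := i.2)
      rw [norm_mul, norm_pow, mul_comm]
      have hy : |((i.2 : ℝ)⁻¹)| ≤ 2 := by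
        rw [abs_of_nonneg (by positivity)]
        exact (inv_le_one_of_one_le₀ hq).trans one_le_two
      refine mul_le_mul (norm_angleIntegral_le (hF.norm_phase _ _)
        fun θ hθ => hC _ t θ hy ht hθ) ?_ (by positivity) (by positivity)
      rw [Complex.norm_natCast]
      exact pow_le_pow_right₀ hq hm) (fun i => by positivity)
  convert hb using 3
  simp [G, angleIntegral, phase]

end AngleFamily

/-! ### Fourier series of smooth functions of the angle -/

/-- The Fourier coefficient of a function of the angle. -/
def angleCoef (f : ℝ → ℂ) (k : ℤ) : ℂ :=
  (2 * Real.pi : ℂ)⁻¹ * ∫ θ in (0 : ℝ)..(2 * Real.pi), f θ * Complex.exp (-(k * θ * Complex.I))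

theorem fourierCoef_eq (f : Circle → ℂ) (k : ℤ) :
    fourierCoef f k = angleCoef (fun θ => f (Circle.exp θ)) k := rfl

/-- A smooth periodic function of the angle. -/
structure SmoothAngle (f : ℝ → ℂ) : Prop where
  smooth : ContDiff ℝ ∞ f
  periodic : Function.Periodic f (2 * Real.pi)

theorem two_pi_ne_zero : (2 * Real.pi : ℂ) ≠ 0 := by
  exact_mod_cast Real.two_pi_pos.ne'

theorem summable_inv_one_add_sq : Summable fun k : ℤ => (1 + (k : ℝ) ^ 2)⁻¹ := by
  refine Summable.of_norm_bounded_eventually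
    (Real.summable_one_div_int_pow.2 (one_lt_two : 1 < 2)) ?_
  refine ((Set.finite_singleton (0 : ℤ)).subset fun k hk => ?_)
  by_contra h0
  refine hk ?_
  have h1 : (0 : ℝ) < (k : ℝ) ^ 2 := by
    have : (k : ℝ) ≠ 0 := by exact_mod_cast h0
    positivity
  show ‖(1 + (k : ℝ) ^ 2)⁻¹‖ ≤ 1 / (k : ℝ) ^ 2
  rw [Real.norm_of_nonneg (by positivity), one_div]
  exact inv_anti₀ h1 (by linarith)

theorem angleCoef_conj (f : ℝ → ℂ) (k : ℤ) :
    angleCoef (fun θ => conj (f θ)) k = conj (angleCoef f (-k)) := by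
  simp only [angleCoef, map_mul, map_inv₀, Complex.conj_ofReal, map_ofNat]
  congr 1
  rw [intervalIntegral.integral_of_le (by positivity),
    intervalIntegral.integral_of_le (by positivity), ← integral_conj]
  congr 1
  funext θ
  rw [map_mul, ← Complex.exp_conj]
  simp

namespace SmoothAngle

variable {f g : ℝ → ℂ}

theorem smoothPeriodic (hf : SmoothAngle f) : SmoothPeriodic fun v => f v.2.2 :=
  ⟨hf.smooth.comp (contDiff_snd.comp contDiff_snd), fun v => by
    simpa using hf.periodic v.2.2⟩

theorem continuous (hf : SmoothAngle f) : Continuous f := hf.smooth.continuous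

theorem hasDerivAt (hf : SmoothAngle f) (θ : ℝ) : HasDerivAt f (deriv f θ) θ :=
  (hf.smooth.differentiable (by simp) θ).hasDerivAt

theorem deriv (hf : SmoothAngle f) : SmoothAngle (deriv f) where
  smooth := (contDiff_infty_iff_deriv.1 hf.smooth).2
  periodic θ := by
    rw [← deriv_comp_add_const, funext hf.periodic]

theorem star (hf : SmoothAngle f) : SmoothAngle fun θ => conj (f θ) :=
  ⟨Complex.conjCLE.contDiff.comp hf.smooth, fun θ => by rw [hf.periodic]⟩

theorem exists_bound_angleCoef (hf : SmoothAngle f) (N : ℕ) :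
    ∃ C : ℝ, 0 ≤ C ∧ ∀ k : ℤ, ‖angleCoef f k‖ ≤ C * ((1 + (k : ℝ) ^ 2) ^ N)⁻¹ := by
  obtain ⟨C, hC0, hC⟩ := (derivBound_fourier hf.smoothPeriodic 0 N).2 0
  refine ⟨(2 * Real.pi)⁻¹ * C, by positivity, fun k => ?_⟩
  have h := hC 0 le_rfl (-k) 0 (by simp)
  rw [iteratedDeriv_zero] at h
  rw [angleCoef, norm_mul, mul_assoc]
  have h2 : ‖(2 * Real.pi : ℂ)⁻¹‖ = (2 * Real.pi)⁻¹ := by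
    rw [norm_inv, ← Complex.ofReal_ofNat, ← Complex.ofReal_mul, Complex.norm_real,
      Real.norm_of_nonneg (by positivity)]
  rw [h2]
  refine mul_le_mul_of_nonneg_left ?_ (by positivity)
  have h3 : ∫ θ in (0 : ℝ)..(2 * Real.pi), f θ * Complex.exp (-(k * θ * Complex.I)) =
      angleIntegral (fun v => Complex.exp (((-k : ℤ) : ℂ) * v.2.2 * Complex.I) * f v.2.2) 0 0 := by
    simp only [angleIntegral]
    congr 1
    funext θ
    push_cast
    rw [mul_comm]
    congr 2
    ring
  rw [h3]
  simpa using h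

theorem summable_angleCoef (hf : SmoothAngle f) : Summable fun k => ‖angleCoef f k‖ := by
  obtain ⟨C, -, hC⟩ := hf.exists_bound_angleCoef 1
  simp only [pow_one] at hC
  exact Summable.of_nonneg_of_le (fun _ => norm_nonneg _) hC (summable_inv_one_add_sq.mul_left C)

theorem angleCoef_deriv (hf : SmoothAngle f) (k : ℤ) :
    angleCoef (_root_.deriv f) k = k * Complex.I * angleCoef f k := by
  have hm := hf.smoothPeriodic.dAngle_mul (SmoothPeriodic.exp_int (-k)) 0 0
  have h0 := (hf.smoothPeriodic.mul (SmoothPeriodic.exp_int (-k))).angleIntegral_dAngle 0 0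
  have h1 : ∀ θ : ℝ, dAngle (fun v => f v.2.2) (0, 0, θ) = _root_.deriv f θ := fun θ =>
    (hf.smoothPeriodic.hasDerivAt_angle 0 0 θ).unique (hf.hasDerivAt θ)
  have e : ∀ θ : ℝ, Complex.exp (((-k : ℤ) : ℂ) * θ * Complex.I) =
      Complex.exp (-(k * θ * Complex.I)) := fun θ => by congr 1; push_cast; ring
  simp only [angleIntegral, hm] at h0
  simp only [SmoothPeriodic.dAngle_exp_int, h1] at h0
  simp only [e] at h0
  have hc : Continuous fun θ : ℝ => Complex.exp (-(k * θ * Complex.I)) := by fun_prop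
  have c1 : Continuous fun θ : ℝ => _root_.deriv f θ * Complex.exp (-(k * θ * Complex.I)) :=
    hf.deriv.continuous.mul hc
  have c2 : Continuous fun θ : ℝ =>
      f θ * (Complex.exp (-(k * θ * Complex.I)) * (((-k : ℤ) : ℂ) * Complex.I)) :=
    hf.continuous.mul (hc.mul continuous_const)
  rw [intervalIntegral.integral_add (c1.intervalIntegrable _ _) (c2.intervalIntegrable _ _)] at h0
  rw [angleCoef, eq_neg_of_add_eq_zero_left h0, angleCoef, mul_left_comm,
    ← intervalIntegral.integral_const_mul, ← intervalIntegral.integral_neg]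
  congr 2
  funext θ
  push_cast
  ring

/-- The Fourier series of a smooth function converges to the function. -/
theorem hasSum_fourier (hf : SmoothAngle f) (θ : ℝ) :
    HasSum (fun k : ℤ => angleCoef f k * Complex.exp (k * θ * Complex.I)) (f θ) := by
  have : Fact (0 < 2 * Real.pi) := ⟨Real.two_pi_pos⟩
  let F : C(AddCircle (2 * Real.pi), ℂ) := ⟨hf.periodic.lift, by
    exact continuous_quot_lift _ hf.continuous⟩
  have hF : ∀ x : ℝ, F (x : AddCircle (2 * Real.pi)) = f x := fun x => hf.periodic.lift_coe x
  have hexp : ∀ (k : ℤ) (x : ℝ), fourier k (x : AddCircle (2 * Real.pi)) =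
      Complex.exp (k * x * Complex.I) := fun k x => by
    rw [fourier_coe_apply]
    congr 1
    have := two_pi_ne_zero
    push_cast
    field_simp
  have hc : ∀ k, fourierCoeff F k = angleCoef f k := fun k => by
    rw [fourierCoeff_eq_intervalIntegral F k 0, angleCoef, zero_add, Complex.real_smul]
    push_cast
    rw [one_div]
    congr 2
    funext x
    rw [hexp, hF, smul_eq_mul, mul_comm]
    congr 2
    push_cast
    ring
  have hs : Summable (fourierCoeff F) := by
    rw [funext hc]
    exact hf.summable_angleCoef.of_norm
  have h := has_pointwise_sum_fourier_series_of_summable hs (θ : AddCircle (2 * Real.pi))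
  simpa only [hc, hexp, hF, smul_eq_mul] using h

/-- Parseval's identity. -/
theorem hasSum_parseval (hf : SmoothAngle f) (hg : Continuous g) :
    HasSum (fun k : ℤ => angleCoef f k * angleCoef g (-k))
      ((2 * Real.pi : ℂ)⁻¹ * ∫ θ in (0 : ℝ)..(2 * Real.pi), f θ * g θ) := by
  obtain ⟨M, hM⟩ := isCompact_Icc.exists_bound_of_continuousOn
    (s := Set.Icc 0 (2 * Real.pi)) hg.continuousOn
  have h := intervalIntegral.hasSum_integral_of_dominated_convergence
    (μ := MeasureTheory.volume) (a := 0) (b := 2 * Real.pi)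
    (F := fun (k : ℤ) (θ : ℝ) => angleCoef f k * Complex.exp (k * θ * Complex.I) * g θ)
    (f := fun θ => f θ * g θ)
    (fun k _ => ‖angleCoef f k‖ * M)
    (fun k => (by fun_prop : Continuous fun θ : ℝ =>
      angleCoef f k * Complex.exp (k * θ * Complex.I) * g θ).aestronglyMeasurable)
    (fun k => Filter.Eventually.of_forall fun θ hθ => by
      rw [Set.uIoc_of_le (by positivity)] at hθ
      rw [norm_mul, norm_mul, norm_exp_int_mul, mul_one]
      exact mul_le_mul_of_nonneg_left (hM θ ⟨hθ.1.le, hθ.2⟩) (norm_nonneg _))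
    (Filter.Eventually.of_forall fun θ _ => hf.summable_angleCoef.mul_right M)
    intervalIntegrable_const
    (Filter.Eventually.of_forall fun θ _ => (hf.hasSum_fourier θ).mul_right (g θ))
  refine (h.mul_left (2 * Real.pi : ℂ)⁻¹).congr_fun fun k => ?_
  rw [angleCoef.eq_1 g, mul_left_comm, ← intervalIntegral.integral_const_mul]
  congr 2
  funext θ
  push_cast
  rw [show -(-(k : ℂ) * θ * Complex.I) = k * θ * Complex.I by ring]
  ring

/-- The symplectic form in terms of the Fourier coefficients. -/
theorem hasSum_symplectic (hf : SmoothAngle f) (hg : Continuous g) :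
    HasSum (fun k : ℤ => k * angleCoef f k * angleCoef g (-k))
      ((2 * Real.pi : ℂ)⁻¹ *
        ∫ θ in (0 : ℝ)..(2 * Real.pi), -Complex.I * (_root_.deriv f θ * g θ)) := by
  have h := (hf.deriv.hasSum_parseval hg).mul_left (-Complex.I)
  rw [mul_left_comm, ← intervalIntegral.integral_const_mul] at h
  refine h.congr_fun fun k => ?_
  rw [hf.angleCoef_deriv]
  linear_combination ((k * angleCoef f k * angleCoef g (-k)) : ℂ) * Complex.I_sq

end SmoothAngle

/-! ### Diffeomorphisms of the circle in the angular coordinate -/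

/-- The value of a diffeomorphism, as a function of the angle. -/
def angleMap (φ : DiffCircle) (θ : ℝ) : ℂ := φ (Circle.exp θ)

/-- The derivative of the angle of the value with respect to the angle. -/
def angleDensity (φ : DiffCircle) (θ : ℝ) : ℝ :=
  (deriv (angleMap φ) θ * conj (angleMap φ θ)).im

/-- The derivative of the angle of the value of a curve with respect to the time. -/
def timeVelocity (c : ℝ → DiffCircle) (t θ : ℝ) : ℝ :=
  (deriv (fun t => angleMap (c t) θ) t * conj (angleMap (c t) θ)).im

theorem norm_angleMap (φ : DiffCircle) (θ : ℝ) : ‖angleMap φ θ‖ = 1 := Circle.norm_coe _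

theorem angleMap_mul_conj (φ : DiffCircle) (θ : ℝ) : angleMap φ θ * conj (angleMap φ θ) = 1 := by
  rw [Complex.mul_conj, Complex.normSq_eq_norm_sq, norm_angleMap]; simp

theorem angleMap_ne_zero (φ : DiffCircle) (θ : ℝ) : angleMap φ θ ≠ 0 := Circle.coe_ne_zero _

theorem circleExp_add_two_pi (θ : ℝ) : Circle.exp (θ + 2 * Real.pi) = Circle.exp θ := by
  rw [Circle.exp_add, Circle.exp_two_pi, mul_one]

/-- The velocity of a curve on the unit circle is `i` times a real multiple of the position. -/
theorem deriv_eq_of_norm_eq_one {f : ℝ → ℂ} (hf : ∀ x, ‖f x‖ = 1) {f' : ℂ} {x : ℝ}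
    (h : HasDerivAt f f' x) : f' = f x * (((f' * conj (f x)).im : ℝ) * Complex.I) := by
  have key : ∀ z : ℂ, ‖z‖ = 1 → z * conj z = 1 := fun z hz => by
    rw [Complex.mul_conj, Complex.normSq_eq_norm_sq, hz]; simp
  have h1 : HasDerivAt (fun x => f x * conj (f x)) (f' * conj (f x) + f x * conj f') x :=
    h.mul (Complex.conjCLE.hasFDerivAt.comp_hasDerivAt x h)
  have h2 : (fun x => f x * conj (f x)) = fun _ => 1 := funext fun y => key _ (hf y)
  rw [h2] at h1
  have h3 := h1.unique (hasDerivAt_const x (1 : ℂ))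
  have h4 : (f' * conj (f x)).re = 0 := by
    have h5 : f x * conj f' = conj (f' * conj (f x)) := by simp [mul_comm]
    rw [h5, Complex.add_conj] at h3
    have h6 := congrArg Complex.re h3
    simpa using h6
  have h5 : f' * conj (f x) = ((f' * conj (f x)).im : ℝ) * Complex.I := by
    apply Complex.ext <;> simp [h4]
  rw [← h5, mul_left_comm, key _ (hf x), mul_one]

theorem SmoothCurve.const (φ : DiffCircle) : SmoothCurve fun _ => φ :=
  φ.2.1.comp contMDiff_snd

theorem contMDiff_circle_coe : ContMDiff (𝓡 1) 𝓘(ℝ, ℂ) ∞ (fun z : Circle => (z : ℂ)) := by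
  have := finrank_real_complex_fact'
  exact contMDiff_coe_sphere

theorem SmoothCurve.contDiff {c : ℝ → DiffCircle} (hc : SmoothCurve c) :
    ContDiff ℝ ∞ (fun p : ℝ × ℝ => angleMap (c p.1) p.2) := by
  rw [← contMDiff_iff_contDiff]
  have h1 : ContMDiff 𝓘(ℝ, ℝ × ℝ) ((𝓘(ℝ, ℝ)).prod (𝓡 1)) ∞
      (fun p : ℝ × ℝ => (p.1, Circle.exp p.2)) :=
    contDiff_fst.contMDiff.prodMk (contMDiff_circleExp.comp contDiff_snd.contMDiff)
  exact contMDiff_circle_coe.comp (ContMDiff.comp hc h1)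

theorem angleMap_periodic (φ : DiffCircle) : Function.Periodic (angleMap φ) (2 * Real.pi) :=
  fun θ => by rw [angleMap, circleExp_add_two_pi]; rfl

theorem smoothAngle_angleMap (φ : DiffCircle) : SmoothAngle (angleMap φ) :=
  ⟨(SmoothCurve.const φ).contDiff.comp (contDiff_const.prodMk contDiff_id : ContDiff ℝ ∞
    fun θ : ℝ => ((0 : ℝ), θ)), angleMap_periodic φ⟩

theorem hasDerivAt_angleMap (φ : DiffCircle) (θ : ℝ) :
    HasDerivAt (angleMap φ) (angleMap φ θ * (angleDensity φ θ * Complex.I)) θ := by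
  have h := (smoothAngle_angleMap φ).hasDerivAt θ
  exact h.congr_deriv (deriv_eq_of_norm_eq_one (norm_angleMap φ) h)

theorem continuous_angleDensity (φ : DiffCircle) : Continuous (angleDensity φ) :=
  Complex.continuous_im.comp ((smoothAngle_angleMap φ).deriv.continuous.mul
    (smoothAngle_angleMap φ).star.continuous)

/-- A continuous lift of the angle is differentiable. -/
theorem hasDerivAt_lift {φ : DiffCircle} {G : ℝ → ℝ} (hG : Continuous G)
    (h : ∀ x, φ (Circle.exp x) = Circle.exp (G x)) (x : ℝ) :
    HasDerivAt G (angleDensity φ x) x := by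
  have hf : ∀ y, angleMap φ y = Complex.exp (G y * Complex.I) := fun y => by
    rw [angleMap, h, Circle.coe_exp]
  have h1 : HasDerivAt (fun y => angleMap φ y * conj (angleMap φ x))
      (angleDensity φ x * Complex.I) x := by
    refine ((hasDerivAt_angleMap φ x).mul_const (conj (angleMap φ x))).congr_deriv ?_
    rw [mul_right_comm, angleMap_mul_conj, one_mul]
  have h2 : HasDerivAt (fun y => Complex.log (angleMap φ y * conj (angleMap φ x)))
      (angleDensity φ x * Complex.I) x := by
    have h3 := h1.clog_real (by rw [angleMap_mul_conj]; exact Complex.one_mem_slitPlane)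
    rwa [angleMap_mul_conj, div_one] at h3
  have h3 : HasDerivAt (fun y => G x + (Complex.log (angleMap φ y * conj (angleMap φ x))).im)
      (angleDensity φ x) x := by
    have h4 := (Complex.imCLM.hasFDerivAt.comp_hasDerivAt x h2).const_add (G x)
    refine h4.congr_deriv ?_
    simp
  refine h3.congr_of_eventuallyEq ?_
  have h4 : ∀ᶠ y in nhds x, G y ∈ Metric.ball (G x) Real.pi :=
    hG.continuousAt.eventually (Metric.ball_mem_nhds _ Real.pi_pos)
  filter_upwards [h4] with y hy
  rw [Real.ball_eq_Ioo] at hy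
  have h5 : angleMap φ y * conj (angleMap φ x) =
      Complex.exp (((G y - G x : ℝ) : ℂ) * Complex.I) := by
    rw [hf, hf, ← Complex.exp_conj, ← Complex.exp_add]
    congr 1
    simp
    ring
  rw [h5, Complex.log_exp]
  · simp
  · simp; linarith [hy.1]
  · simp; linarith [hy.2]

/-- The lift of a diffeomorphism to the angle: a smooth map with positive derivative that
commutes with the translation by a full turn. -/
theorem exists_lift (φ : DiffCircle) :
    ∃ G : ℝ → ℝ, (∀ x, φ (Circle.exp x) = Circle.exp (G x)) ∧
      (∀ x, HasDerivAt G (angleDensity φ x) x) ∧ (∀ x, 0 < angleDensity φ x) ∧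
      ∀ x, G (x + 2 * Real.pi) = G x + 2 * Real.pi := by
  obtain ⟨G, hGc, hGm, hG⟩ := φ.2.2.2
  obtain ⟨H, hHc, -, hH⟩ := φ⁻¹.2.2.2
  have hGd := hasDerivAt_lift hGc hG
  have hHd := hasDerivAt_lift hHc hH
  have hpos : ∀ x, 0 < angleDensity φ x := by
    intro x
    have h0 : 0 ≤ angleDensity φ x := by
      rw [← (hGd x).deriv]
      exact hGm.monotone.deriv_nonneg
    refine h0.lt_of_ne' fun h1 => ?_
    -- the lift of the inverse is differentiable, and the composition of the lifts is a translation
    have h2 : ∀ y, Circle.exp (H (G y)) = Circle.exp y := fun y => by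
      rw [← hH, ← hG]
      exact φ.1.symm_apply_apply _
    have h3 : (fun y => Complex.exp (H (G y) * Complex.I)) =
        fun y : ℝ => Complex.exp (y * Complex.I) := funext fun y => by
      rw [← Circle.coe_exp, ← Circle.coe_exp, h2]
    have h4 : HasDerivAt (fun y => Complex.exp (H (G y) * Complex.I)) 0 x := by
      have h5 := ((hHd (G x)).comp x (hGd x)).ofReal_comp
      refine ((h5.mul_const Complex.I).cexp).congr_deriv ?_
      rw [h1]
      simp
    rw [h3] at h4
    have h6 : HasDerivAt (fun y : ℝ => Complex.exp (y * Complex.I))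
        (Complex.exp (x * Complex.I) * (1 * Complex.I)) x :=
      ((hasDerivAt_id x).ofReal_comp.mul_const Complex.I).cexp
    have h7 := h4.unique h6
    simp at h7
  refine ⟨G, hG, hGd, hpos, fun x => ?_⟩
  have hpi := Real.pi_pos
  have h1 : Circle.exp (G (x + 2 * Real.pi)) = Circle.exp (G x) := by
    rw [← hG, ← hG, circleExp_add_two_pi]
  obtain ⟨m, hm⟩ := Circle.exp_eq_exp.1 h1
  have h2 : G x < G (x + 2 * Real.pi) := hGm (by linarith)
  have h3 : (0 : ℝ) < m := by
    by_contra hcon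
    nlinarith [not_lt.1 hcon]
  have h4 : 1 ≤ m := by
    have : (0 : ℤ) < m := by exact_mod_cast h3
    lia
  rcases h4.eq_or_lt with h5 | h5
  · rw [hm, ← h5]; push_cast; ring
  · -- a larger increment would give two points with the same image
    exfalso
    have h6 : (2 : ℝ) ≤ m := by exact_mod_cast h5
    have h7 : G x + 2 * Real.pi ∈ Set.Ioo (G x) (G (x + 2 * Real.pi)) := by
      constructor
      · linarith
      · rw [hm]; nlinarith
    obtain ⟨y, hy, hGy⟩ := intermediate_value_Ioo (by linarith) hGc.continuousOn h7
    have h8 : φ (Circle.exp y) = φ (Circle.exp x) := by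
      rw [hG, hG, hGy, circleExp_add_two_pi]
    obtain ⟨n, hn⟩ := Circle.exp_eq_exp.1 (φ.1.injective h8)
    have h9 : (0 : ℝ) < n := by
      by_contra hcon
      nlinarith [not_lt.1 hcon, hy.1]
    have h10 : (n : ℝ) < 1 := by
      by_contra hcon
      nlinarith [not_lt.1 hcon, hy.2]
    have h11 : (0 : ℤ) < n := by exact_mod_cast h9
    have h12 : n < (1 : ℤ) := by exact_mod_cast h10
    lia

theorem angleDensity_pos (φ : DiffCircle) (θ : ℝ) : 0 < angleDensity φ θ := by
  obtain ⟨G, -, -, h, -⟩ := exists_lift φ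
  exact h θ

/-- Change of variables by a diffeomorphism of the circle. -/
theorem integral_comp_mul_angleDensity (φ : DiffCircle) {h : Circle → ℂ} (hh : Continuous h) :
    ∫ θ in (0 : ℝ)..(2 * Real.pi), h (φ (Circle.exp θ)) * angleDensity φ θ =
      ∫ θ in (0 : ℝ)..(2 * Real.pi), h (Circle.exp θ) := by
  obtain ⟨G, hG, hGd, -, hGp⟩ := exists_lift φ
  have h1 := intervalIntegral.integral_deriv_smul_comp (a := 0) (b := 2 * Real.pi)
    (g := fun θ => h (Circle.exp θ)) (fun x _ => hGd x)
    (continuous_angleDensity φ).continuousOn (hh.comp Circle.exp.continuous)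
  have h2 : Function.Periodic (fun θ => h (Circle.exp θ)) (2 * Real.pi) := fun θ => by
    simp only [circleExp_add_two_pi]
  have h3 := h2.intervalIntegral_add_eq (G 0) 0
  have h4 := hGp 0
  rw [zero_add] at h4 h3
  rw [← h3, ← h4, ← h1]
  congr 1
  funext θ
  simp only [Function.comp_apply, hG, Complex.real_smul, mul_comm]

/-- The values of a smooth curve of diffeomorphisms. -/
theorem SmoothCurve.angleFamily {c : ℝ → DiffCircle} (hc : SmoothCurve c) :
    AngleFamily (fun t θ => angleMap (c t) θ) (timeVelocity c) (fun t θ => angleDensity (c t) θ) := by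
  have hF : SmoothPeriodic fun v : ℝ × ℝ × ℝ => angleMap (c v.2.1) v.2.2 :=
    ⟨hc.contDiff.comp contDiff_snd, fun v => by
      simpa using angleMap_periodic (c v.2.1) v.2.2⟩
  have hconj : SmoothPeriodic fun v : ℝ × ℝ × ℝ => conj (angleMap (c v.2.1) v.2.2) :=
    ⟨Complex.conjCLE.contDiff.comp hF.smooth, fun v => congrArg conj (hF.periodic v)⟩
  have him : ∀ {g : ℝ × ℝ × ℝ → ℂ}, SmoothPeriodic g →
      SmoothPeriodic fun v => ((g v).im : ℂ) := fun hg =>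
    ⟨(Complex.ofRealCLM.comp Complex.imCLM).contDiff.comp hg.smooth, fun v => by
      rw [hg.periodic]⟩
  refine ⟨hF, fun t θ => norm_angleMap _ _, ?_, ?_, fun t θ => ?_, fun t θ =>
    hasDerivAt_angleMap (c t) θ, fun t θ => angleDensity_pos _ _⟩
  · convert him (hF.dTime.mul hconj) using 3 with v
    rw [timeVelocity, (hF.hasDerivAt_time v.1 v.2.1 v.2.2).deriv]
  · convert him (hF.dAngle.mul hconj) using 3 with v
    rw [angleDensity, ← (hF.hasDerivAt_angle v.1 v.2.1 v.2.2).deriv]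
  · have h := hF.hasDerivAt_time 0 t θ
    have h1 : HasDerivAt (fun t => angleMap (c t) θ) (deriv (fun t => angleMap (c t) θ) t) t :=
      h.differentiableAt.hasDerivAt
    exact h1.congr_deriv (deriv_eq_of_norm_eq_one (fun t => norm_angleMap _ _) h1)

/-- The right-translated velocity at the value of the diffeomorphism. -/
theorem rightVelocity_apply {c : ℝ → DiffCircle} (hc : SmoothCurve c) (θ : ℝ) :
    rightVelocity c (c 0 (Circle.exp θ)) = timeVelocity c 0 θ := by
  have h1 : ((c 0)⁻¹ : DiffCircle) (c 0 (Circle.exp θ)) = Circle.exp θ :=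
    (c 0).1.symm_apply_apply _
  have h2 := (hc.angleFamily.hasDerivAt_time 0 θ).deriv
  simp only [rightVelocity, h1]
  change ((deriv (fun t => angleMap (c t) θ) 0) / (Complex.I * angleMap (c 0) θ)).re = _
  rw [h2]
  have h3 := angleMap_ne_zero (c 0) θ
  have h4 := Complex.I_ne_zero
  rw [show angleMap (c 0) θ * (timeVelocity c 0 θ * Complex.I) / (Complex.I * angleMap (c 0) θ) =
    timeVelocity c 0 θ by field_simp]
  simp

theorem continuous_rightVelocity {c : ℝ → DiffCircle} (hc : SmoothCurve c) :
    Continuous (rightVelocity c) := by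
  have h1 : Continuous fun z => rightVelocity c (c 0 z) := by
    have hq : Topology.IsQuotientMap Circle.exp :=
      isLocalHomeomorph_circleExp.isOpenMap.isQuotientMap Circle.exp.continuous
        Circle.exp_surjective
    rw [hq.continuous_iff]
    have h2 := Complex.continuous_re.comp (hc.angleFamily.smooth_time.continuous_angle 0 0)
    refine h2.congr fun θ => ?_
    simp [rightVelocity_apply hc]
  have h2 : Continuous ((c 0)⁻¹ : DiffCircle) := ((c 0)⁻¹).2.1.continuous
  refine (h1.comp h2).congr fun z => ?_
  exact congrArg (rightVelocity c) ((c 0).1.apply_symm_apply z)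

/-! ### The Fourier coefficients of the powers of a diffeomorphism -/

theorem hasSum_of_eq {ι : Type*} {f g : ι → ℂ} {s u : ℂ} (h : HasSum f s) (hfg : ∀ i, g i = f i)
    (hs : u = s) : HasSum g u := by
  rw [hs, funext hfg]
  exact h

/-- The Fourier coefficient with index `j` of the function `φ^q`. -/
def mapCoef (φ : DiffCircle) (j : ℤ) (q : ℕ) : ℂ := angleCoef (fun θ => angleMap φ θ ^ q) j

theorem smoothAngle_angleMap_pow (φ : DiffCircle) (q : ℕ) :
    SmoothAngle fun θ => angleMap φ θ ^ q :=
  ⟨(smoothAngle_angleMap φ).smooth.pow q, fun θ => by rw [angleMap_periodic]⟩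

theorem deriv_angleMap_pow (φ : DiffCircle) (q : ℕ) (θ : ℝ) :
    deriv (fun θ => angleMap φ θ ^ q) θ =
      q * Complex.I * (angleMap φ θ ^ q * angleDensity φ θ) := by
  rw [((SmoothCurve.const φ).angleFamily.hasDerivAt_pow_angle q 0 θ).deriv]
  ring

/-- The symplectic product of `φ^q` and `h ∘ φ` is that of `z^q` and `h`. -/
theorem integral_deriv_angleMap_pow_mul (φ : DiffCircle) (q : ℕ) {h : Circle → ℂ}
    (hh : Continuous h) :
    (2 * Real.pi : ℂ)⁻¹ * ∫ θ in (0 : ℝ)..(2 * Real.pi),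
        deriv (fun θ => angleMap φ θ ^ q) θ * h (φ (Circle.exp θ)) =
      q * Complex.I * angleCoef (fun θ => h (Circle.exp θ)) (-q) := by
  have h1 := integral_comp_mul_angleDensity φ (h := fun z => (z : ℂ) ^ q * h z)
    ((continuous_subtype_val.pow q).mul hh)
  rw [angleCoef, mul_left_comm, ← intervalIntegral.integral_const_mul]
  simp only [deriv_angleMap_pow]
  have h2 : ∀ θ : ℝ, q * Complex.I * (angleMap φ θ ^ q * angleDensity φ θ) * h (φ (Circle.exp θ)) =
      q * Complex.I * ((φ (Circle.exp θ) : ℂ) ^ q * h (φ (Circle.exp θ)) * angleDensity φ θ) :=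
    fun θ => by rw [angleMap]; ring
  simp only [h2]
  rw [intervalIntegral.integral_const_mul, intervalIntegral.integral_const_mul, h1]
  congr 3
  funext θ
  rw [Circle.coe_exp, ← Complex.exp_nat_mul, mul_comm]
  congr 2
  push_cast
  ring

/-- The pullback by a diffeomorphism preserves the symplectic form. -/
theorem hasSum_symplectic_mapCoef (φ : DiffCircle) (q : ℕ) {h : Circle → ℂ} (hh : Continuous h) :
    HasSum (fun k : ℤ => k * mapCoef φ k q * angleCoef (fun θ => h (φ (Circle.exp θ))) (-k))
      (q * angleCoef (fun θ => h (Circle.exp θ)) (-q)) := by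
  have hc : Continuous fun θ => h (φ (Circle.exp θ)) :=
    hh.comp (φ.2.1.continuous.comp Circle.exp.continuous)
  have h1 := (smoothAngle_angleMap_pow φ q).hasSum_symplectic hc
  rw [intervalIntegral.integral_const_mul, mul_left_comm,
    integral_deriv_angleMap_pow_mul φ q hh] at h1
  refine hasSum_of_eq h1 (fun _ => rfl) ?_
  linear_combination (q * angleCoef (fun θ => h (Circle.exp θ)) (-q)) * Complex.I_sq

theorem angleCoef_exp_int (j k : ℤ) :
    angleCoef (fun θ => Complex.exp (j * θ * Complex.I)) k = if j = k then 1 else 0 := by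
  have h2 := two_pi_ne_zero
  have h1 : ∀ θ : ℝ, Complex.exp (j * θ * Complex.I) * Complex.exp (-(k * θ * Complex.I)) =
      Complex.exp (((j - k : ℤ) : ℂ) * Complex.I * θ) := fun θ => by
    rw [← Complex.exp_add]
    congr 1
    push_cast
    ring
  rw [angleCoef]
  simp only [h1]
  split_ifs with h
  · simp [h]
    field_simp
  · have h3 : ((j - k : ℤ) : ℂ) * Complex.I ≠ 0 :=
      mul_ne_zero (by exact_mod_cast sub_ne_zero.2 h) Complex.I_ne_zero
    rw [integral_exp_mul_complex h3]
    have h4 : Complex.exp (((j - k : ℤ) : ℂ) * Complex.I * ((2 * Real.pi : ℝ) : ℂ)) = 1 := by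
      rw [Complex.exp_eq_one_iff]
      exact ⟨j - k, by push_cast; ring⟩
    rw [h4]
    simp

theorem angleCoef_circle_pow (p : ℕ) (k : ℤ) :
    angleCoef (fun θ => (Circle.exp θ : ℂ) ^ p) k = if (p : ℤ) = k then 1 else 0 := by
  rw [← angleCoef_exp_int]
  congr 1
  funext θ
  rw [Circle.coe_exp, ← Complex.exp_nat_mul]
  congr 1
  push_cast
  ring

/-- A sum over the integers as a sum over the positive indices. -/
theorem hasSum_pnat_of_int {f : ℤ → ℂ} {s : ℂ} (hf : HasSum f s) (h0 : f 0 = 0) :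
    HasSum (fun r : ℕ+ => f (r : ℕ) + f (-(r : ℕ))) s := by
  have h1 := hf.nat_add_neg
  rw [h0, add_zero] at h1
  refine (Function.Injective.hasSum_iff PNat.coe_injective fun n hn => ?_).2 h1
  have : n = 0 := by
    by_contra h
    exact hn ⟨⟨n, Nat.pos_of_ne_zero h⟩, rfl⟩
  simp [this, h0]

/-- The symplectic products of the functions `φ^q` and the conjugates of the `φ^p`. -/
theorem hasSum_mapCoef_conj (φ : DiffCircle) (p q : ℕ) :
    HasSum (fun r : ℕ+ => ((r : ℕ) : ℂ) * (conj (mapCoef φ (r : ℕ) p) * mapCoef φ (r : ℕ) q -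
      conj (mapCoef φ (-(r : ℕ)) p) * mapCoef φ (-(r : ℕ)) q)) (if p = q then (q : ℂ) else 0) := by
  have h1 := hasSum_symplectic_mapCoef φ q (h := fun z => conj ((z : ℂ) ^ p))
    (Complex.continuous_conj.comp (continuous_subtype_val.pow p))
  have h2 : ∀ k : ℤ, angleCoef (fun θ => conj ((φ (Circle.exp θ) : ℂ) ^ p)) (-k) =
      conj (mapCoef φ k p) := fun k => by rw [angleCoef_conj, neg_neg]; rfl
  have h3 : angleCoef (fun θ => conj ((Circle.exp θ : ℂ) ^ p)) (-q) = if p = q then 1 else 0 := by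
    rw [angleCoef_conj, neg_neg, angleCoef_circle_pow]
    simp only [Nat.cast_inj]
    split_ifs <;> simp
  simp only [h2, h3] at h1
  convert hasSum_pnat_of_int h1 (by simp) using 1
  · funext r
    push_cast
    ring
  · split_ifs <;> simp

/-- The functions `φ^p` and `φ^q` are orthogonal for the symplectic form. -/
theorem hasSum_mapCoef_mul (φ : DiffCircle) (p : ℕ) (q : ℕ+) :
    HasSum (fun r : ℕ+ => ((r : ℕ) : ℂ) * (mapCoef φ (r : ℕ) q * mapCoef φ (-(r : ℕ)) p -
      mapCoef φ (-(r : ℕ)) q * mapCoef φ (r : ℕ) p)) 0 := by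
  have h1 := hasSum_symplectic_mapCoef φ q (h := fun z => (z : ℂ) ^ p)
    (continuous_subtype_val.pow p)
  have h2 : ∀ k : ℤ, angleCoef (fun θ => (φ (Circle.exp θ) : ℂ) ^ p) k = mapCoef φ k p :=
    fun k => rfl
  have h3 : angleCoef (fun θ => (Circle.exp θ : ℂ) ^ p) (-(q : ℕ)) = 0 := by
    rw [angleCoef_circle_pow, if_neg]
    have := q.pos
    lia
  simp only [h2, h3, mul_zero] at h1
  convert hasSum_pnat_of_int h1 (by simp) using 1
  funext r
  push_cast
  rw [neg_neg]
  ring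

theorem continuous_inv_apply (φ : DiffCircle) : Continuous (φ⁻¹ : DiffCircle) :=
  (φ⁻¹).2.1.continuous

theorem inv_apply_apply (φ : DiffCircle) (z : Circle) : (φ⁻¹ : DiffCircle) (φ z) = z :=
  φ.1.symm_apply_apply z

/-- The coefficients of the inverse diffeomorphism, for indices of the same sign: the substitution
`θ ↦ φ⁻¹ θ` exchanges the two indices. -/
theorem mul_mapCoef_eq_mul_inv (φ : DiffCircle) (j k : ℕ) :
    (j : ℂ) * mapCoef φ j k = k * conj (mapCoef φ⁻¹ k j) := by
  have h1 := (smoothAngle_angleMap_pow φ k).angleCoef_deriv j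
  have h2 := integral_deriv_angleMap_pow_mul φ k
    (h := fun z => conj (((φ⁻¹ : DiffCircle) z : ℂ) ^ j))
    (Complex.continuous_conj.comp ((continuous_subtype_val.comp (continuous_inv_apply φ)).pow j))
  have h3 : angleCoef (fun θ => conj (((φ⁻¹ : DiffCircle) (Circle.exp θ) : ℂ) ^ j)) (-k) =
      conj (mapCoef φ⁻¹ k j) := by rw [angleCoef_conj, neg_neg]; rfl
  simp only [h3, inv_apply_apply] at h2
  have h4 : angleCoef (deriv fun θ => angleMap φ θ ^ k) j =
      k * Complex.I * conj (mapCoef φ⁻¹ k j) := by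
    rw [← h2, angleCoef]
    congr 2
    funext θ
    rw [Circle.coe_exp, ← Complex.exp_nat_mul, ← Complex.exp_conj]
    congr 2
    simp
    ring
  rw [h1] at h4
  have h5 := Complex.I_ne_zero
  apply mul_left_cancel₀ h5
  change Complex.I * (j * angleCoef _ _) = _
  push_cast at h4
  linear_combination h4

/-- The coefficients of the inverse diffeomorphism, for indices of opposite sign. -/
theorem mul_mapCoef_neg_eq_mul_inv (φ : DiffCircle) (j k : ℕ) :
    (j : ℂ) * mapCoef φ (-j) k = -(k * mapCoef φ⁻¹ (-k) j) := by
  have h1 := (smoothAngle_angleMap_pow φ k).angleCoef_deriv (-j)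
  have h2 := integral_deriv_angleMap_pow_mul φ k
    (h := fun z => ((φ⁻¹ : DiffCircle) z : ℂ) ^ j)
    ((continuous_subtype_val.comp (continuous_inv_apply φ)).pow j)
  have h3 : angleCoef (fun θ => ((φ⁻¹ : DiffCircle) (Circle.exp θ) : ℂ) ^ j) (-k) =
      mapCoef φ⁻¹ (-k) j := rfl
  simp only [h3, inv_apply_apply] at h2
  have h4 : angleCoef (deriv fun θ => angleMap φ θ ^ k) (-j) =
      k * Complex.I * mapCoef φ⁻¹ (-k) j := by
    rw [← h2, angleCoef]
    congr 2
    funext θ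
    rw [Circle.coe_exp, ← Complex.exp_nat_mul]
    congr 2
    push_cast
    ring
  rw [h1] at h4
  have h5 := Complex.I_ne_zero
  apply mul_left_cancel₀ h5
  change Complex.I * (j * angleCoef _ _) = _
  push_cast at h4
  linear_combination -h4

/-! ### The blocks of the pullback operator -/

/-- The factor `√p / √q` which relates the coefficients to the orthonormal bases. -/
def normFactor (p q : ℕ+) : ℂ := (√(p : ℝ) / √(q : ℝ) : ℝ)

/-- The matrix of the block `W_+ → W_+` of the pullback by a diffeomorphism. -/
def blockA (φ : DiffCircle) (p q : ℕ+) : ℂ := normFactor p q * mapCoef φ (p : ℕ) q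

/-- The matrix of the block `W_+ → W_-` of the pullback by a diffeomorphism. -/
def blockB (φ : DiffCircle) (p q : ℕ+) : ℂ := normFactor p q * mapCoef φ (-(p : ℕ)) q

theorem norm_normFactor_le (p q : ℕ+) : ‖normFactor p q‖ ≤ (p : ℝ) := by
  have hp : (1 : ℝ) ≤ (p : ℕ) := by exact_mod_cast one_le (a := p)
  have hq : (1 : ℝ) ≤ (q : ℕ) := by exact_mod_cast one_le (a := q)
  rw [normFactor, Complex.norm_real, Real.norm_of_nonneg (by positivity)]
  have h1 : 1 ≤ √(q : ℝ) := Real.one_le_sqrt.2 hq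
  have h2 : √(p : ℝ) ≤ p := (Real.sqrt_le_left (by positivity)).2 (by nlinarith)
  exact (div_le_self (Real.sqrt_nonneg _) h1).trans h2

theorem sqrt_mul_sqrt_pnat (p : ℕ+) : ((√(p : ℝ) : ℝ) : ℂ) * ((√(p : ℝ) : ℝ) : ℂ) = (p : ℕ) := by
  rw [← Complex.ofReal_mul, Real.mul_self_sqrt (by positivity)]; simp

theorem sqrt_pnat_ne_zero (p : ℕ+) : ((√(p : ℝ) : ℝ) : ℂ) ≠ 0 := by
  have hp : (0 : ℝ) < (p : ℕ) := by exact_mod_cast p.pos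
  exact_mod_cast (Real.sqrt_pos.2 hp).ne'

theorem normFactor_mul_normFactor (r p q : ℕ+) : normFactor r p * normFactor r q =
    (r : ℕ) * ((√(p : ℝ) : ℝ) * (√(q : ℝ) : ℝ) : ℂ)⁻¹ := by
  rw [← sqrt_mul_sqrt_pnat, normFactor, normFactor]
  push_cast
  have := sqrt_pnat_ne_zero p
  have := sqrt_pnat_ne_zero q
  field_simp

theorem conj_normFactor (p q : ℕ+) : conj (normFactor p q) = normFactor p q :=
  Complex.conj_ofReal _

theorem hasSum_block_conj (φ : DiffCircle) (p q : ℕ+) :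
    HasSum (fun r => conj (blockA φ r p) * blockA φ r q - conj (blockB φ r p) * blockB φ r q)
      (if p = q then 1 else 0) := by
  refine hasSum_of_eq ((hasSum_mapCoef_conj φ p q).mul_left
    ((√(p : ℝ) : ℝ) * (√(q : ℝ) : ℝ) : ℂ)⁻¹) (fun r => ?_) ?_
  · have h := normFactor_mul_normFactor r p q
    simp only [blockA, blockB, map_mul, conj_normFactor]
    linear_combination (conj (mapCoef φ (r : ℕ) p) * mapCoef φ (r : ℕ) q -
      conj (mapCoef φ (-(r : ℕ)) p) * mapCoef φ (-(r : ℕ)) q) * h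
  · have h : (p : ℕ) = q ↔ p = q := PNat.coe_inj
    simp only [h]
    split_ifs with hpq
    · subst hpq
      rw [sqrt_mul_sqrt_pnat, inv_mul_cancel₀]
      exact_mod_cast p.ne_zero
    · simp

theorem hasSum_block_mul (φ : DiffCircle) (p q : ℕ+) :
    HasSum (fun r => blockA φ r q * blockB φ r p - blockB φ r q * blockA φ r p) 0 := by
  refine hasSum_of_eq ((hasSum_mapCoef_mul φ p q).mul_left
    ((√(p : ℝ) : ℝ) * (√(q : ℝ) : ℝ) : ℂ)⁻¹) (fun r => ?_) (mul_zero _).symm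
  · have h := normFactor_mul_normFactor r p q
    simp only [blockA, blockB]
    linear_combination (mapCoef φ (r : ℕ) q * mapCoef φ (-(r : ℕ)) p -
      mapCoef φ (-(r : ℕ)) q * mapCoef φ (r : ℕ) p) * h

theorem blockA_inv (φ : DiffCircle) (p q : ℕ+) : blockA φ⁻¹ p q = conj (blockA φ q p) := by
  have h := mul_mapCoef_eq_mul_inv φ⁻¹ p q
  rw [inv_inv, ← sqrt_mul_sqrt_pnat, ← sqrt_mul_sqrt_pnat] at h
  have := sqrt_pnat_ne_zero p
  have := sqrt_pnat_ne_zero q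
  simp only [blockA, map_mul, conj_normFactor]
  simp only [normFactor]
  push_cast
  field_simp
  linear_combination h

theorem blockB_inv (φ : DiffCircle) (p q : ℕ+) : blockB φ⁻¹ p q = -blockB φ q p := by
  have h := mul_mapCoef_neg_eq_mul_inv φ⁻¹ p q
  rw [inv_inv, ← sqrt_mul_sqrt_pnat, ← sqrt_mul_sqrt_pnat] at h
  have := sqrt_pnat_ne_zero p
  have := sqrt_pnat_ne_zero q
  simp only [blockB]
  simp only [normFactor]
  push_cast
  field_simp
  linear_combination h

theorem summable_pnat_sq : Summable fun r : ℕ+ => (((r : ℕ) : ℝ) ^ 2)⁻¹ := by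
  have h := (Real.summable_one_div_nat_pow.2 (one_lt_two : 1 < 2)).comp_injective
    PNat.coe_injective
  simpa [Function.comp_def] using h

theorem mapCoef_eq_angleIntegral (c : ℝ → DiffCircle) (k : ℤ) (q : ℕ) (t : ℝ) :
    mapCoef (c t) k q = (2 * Real.pi : ℂ)⁻¹ *
      angleIntegral (phase (fun t θ => angleMap (c t) θ) (-k) q) 0 t := by
  rw [mapCoef, angleCoef]
  congr 2
  funext θ
  simp only [phase]
  congr 2
  push_cast
  ring

theorem norm_two_pi_inv_le : ‖(2 * Real.pi : ℂ)⁻¹‖ ≤ 1 := by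
  rw [norm_inv, ← Complex.ofReal_ofNat, ← Complex.ofReal_mul, Complex.norm_real,
    Real.norm_of_nonneg (by positivity)]
  exact inv_le_one_of_one_le₀ (by linarith [Real.pi_gt_three])

theorem norm_normFactor_mul_le (p q : ℕ+) :
    ‖normFactor p q * (2 * Real.pi : ℂ)⁻¹‖ ≤ (p : ℝ) := by
  rw [norm_mul]
  exact (mul_le_of_le_one_right (norm_nonneg _) norm_two_pi_inv_le).trans (norm_normFactor_le p q)

theorem derivBound_blockA {c : ℝ → DiffCircle} (hc : SmoothCurve c) (n : ℕ) :
    DerivBound n (fun (i : ℕ+ × ℕ+) t => blockA (c t) i.1 i.2)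
      (fun i => (i.1 : ℝ) * (i.2 : ℝ) ^ n) := by
  have h := (hc.angleFamily.derivBound_positive n).const_mul
    fun i => normFactor i.1 i.2 * (2 * Real.pi : ℂ)⁻¹
  have e : (fun (i : ℕ+ × ℕ+) t => blockA (c t) i.1 i.2) = fun (i : ℕ+ × ℕ+) t =>
      normFactor i.1 i.2 * (2 * Real.pi : ℂ)⁻¹ * angleIntegral
        (phase (fun t θ => angleMap (c t) θ) (-(i.1 : ℕ) : ℤ) i.2) 0 t := by
    funext i t
    rw [blockA, mapCoef_eq_angleIntegral, mul_assoc]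
  rw [e]
  refine h.mono 1 zero_le_one fun i => ?_
  rw [one_mul]
  exact mul_le_mul_of_nonneg_right (norm_normFactor_mul_le _ _) (by positivity)

theorem derivBound_blockB {c : ℝ → DiffCircle} (hc : SmoothCurve c) (n N M : ℕ) :
    DerivBound n (fun (i : ℕ+ × ℕ+) t => blockB (c t) i.1 i.2)
      (fun i => ((i.1 : ℝ) ^ N)⁻¹ * ((i.2 : ℝ) ^ M)⁻¹) := by
  have h := (hc.angleFamily.derivBound_negative n (N + M + 1)).const_mul
    fun i => normFactor i.1 i.2 * (2 * Real.pi : ℂ)⁻¹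
  have e : (fun (i : ℕ+ × ℕ+) t => blockB (c t) i.1 i.2) = fun (i : ℕ+ × ℕ+) t =>
      normFactor i.1 i.2 * (2 * Real.pi : ℂ)⁻¹ * angleIntegral
        (phase (fun t θ => angleMap (c t) θ) (i.1 : ℕ) i.2) 0 t := by
    funext i t
    rw [blockB, mapCoef_eq_angleIntegral, mul_assoc, neg_neg]
  rw [e]
  refine h.mono 1 zero_le_one fun i => ?_
  have hp : (0 : ℝ) < (i.1 : ℕ) := by exact_mod_cast i.1.pos
  have hq : (0 : ℝ) < (i.2 : ℕ) := by exact_mod_cast i.2.pos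
  rw [one_mul, ← mul_inv]
  have h1 : (i.1 : ℝ) ^ N * (i.2 : ℝ) ^ M ≤ ((i.1 : ℕ) + (i.2 : ℕ) : ℝ) ^ (N + M) := by
    rw [pow_add]
    gcongr <;> linarith
  calc _ ≤ ((i.1 : ℕ) + (i.2 : ℕ) : ℝ) * (((i.1 : ℕ) + (i.2 : ℕ) : ℝ) ^ (N + M + 1))⁻¹ := by
        refine mul_le_mul_of_nonneg_right ((norm_normFactor_mul_le _ _).trans ?_) (by positivity)
        linarith
    _ = (((i.1 : ℕ) + (i.2 : ℕ) : ℝ) ^ (N + M))⁻¹ := by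
        rw [pow_succ, mul_inv, mul_comm, mul_assoc, inv_mul_cancel₀ (by positivity), mul_one]
    _ ≤ _ := inv_anti₀ (by positivity) h1

theorem summable_pnat_prod : Summable fun i : ℕ+ × ℕ+ =>
    (((i.1 : ℕ) : ℝ) ^ 2)⁻¹ * (((i.2 : ℕ) : ℝ) ^ 2)⁻¹ :=
  summable_pnat_sq.mul_of_nonneg summable_pnat_sq (fun _ => by positivity)
    (fun _ => by positivity)

/-- The block `W_+ → W_-` of a smooth curve of diffeomorphisms is a smooth curve of
Hilbert-Schmidt matrices. -/
theorem exists_contDiff_blockB {c : ℝ → DiffCircle} (hc : SmoothCurve c) :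
    ∃ B : ℝ → HSOp, ContDiff ℝ ∞ B ∧ ∀ t i, B t i = blockB (c t) i.1 i.2 :=
  exists_contDiff_lp fun n => ⟨_, summable_pnat_prod, derivBound_blockB hc n 2 2⟩

/-- The Hilbert-Schmidt block `W_+ → W_-` of the pullback. -/
def opB (φ : DiffCircle) : HSOp := (exists_contDiff_blockB (SmoothCurve.const φ)).choose 0

theorem opB_apply (φ : DiffCircle) (p q : ℕ+) : opB φ (p, q) = blockB φ p q :=
  (exists_contDiff_blockB (SmoothCurve.const φ)).choose_spec.2 0 (p, q)

theorem contDiff_opB {c : ℝ → DiffCircle} (hc : SmoothCurve c) :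
    ContDiff ℝ ∞ fun t => opB (c t) := by
  obtain ⟨B, hB, h⟩ := exists_contDiff_blockB hc
  convert hB using 2 with t
  ext ⟨p, q⟩
  rw [opB_apply, h]

/-- For a fixed column of the block `W_+ → W_+`, the entries are rapidly decreasing. -/
theorem exists_contDiff_columnA {c : ℝ → DiffCircle} (hc : SmoothCurve c) (q : ℕ+) :
    ∃ v : ℝ → HalfSpace, ContDiff ℝ ∞ v ∧ ∀ t p, v t p = blockA (c t) p q := by
  refine exists_contDiff_lp fun n => ⟨_, summable_pnat_sq, ?_⟩
  have h := ((derivBound_fourier (hc.angleFamily.smooth.pow q) n 2).comp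
    fun p : ℕ+ => (-(p : ℕ) : ℤ)).const_mul fun p => normFactor p q * (2 * Real.pi : ℂ)⁻¹
  have e : (fun (p : ℕ+) t => blockA (c t) p q) = fun (p : ℕ+) t =>
      normFactor p q * (2 * Real.pi : ℂ)⁻¹ * angleIntegral (fun v =>
        Complex.exp (((-(p : ℕ) : ℤ) : ℂ) * v.2.2 * Complex.I) *
          angleMap (c v.2.1) v.2.2 ^ (q : ℕ)) 0 t := by
    funext p t
    rw [blockA, mapCoef_eq_angleIntegral, mul_assoc]
    congr 3
    funext v
    rw [phase, mul_comm]
  rw [e]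
  refine h.mono 1 zero_le_one fun p => ?_
  have hp : (0 : ℝ) < (p : ℕ) := by exact_mod_cast p.pos
  rw [one_mul]
  have h1 : (p : ℝ) * (p : ℝ) ^ 2 ≤ (1 + (p : ℝ) ^ 2) ^ 2 := by
    nlinarith [sq_nonneg ((p : ℝ) - 1), sq_nonneg ((p : ℝ) ^ 2)]
  calc _ ≤ (p : ℝ) * ((1 + (p : ℝ) ^ 2) ^ 2)⁻¹ := by
        refine mul_le_mul (norm_normFactor_mul_le _ _) (le_of_eq ?_) (by positivity) hp.le
        push_cast
        rw [neg_sq]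
    _ ≤ (p : ℝ) * ((p : ℝ) * (p : ℝ) ^ 2)⁻¹ := by gcongr
    _ = ((p : ℝ) ^ 2)⁻¹ := by field_simp

/-- The columns of the block `W_+ → W_+` have the Gram matrix of `1 + b†b`, so that they are the
columns of a bounded operator. -/
theorem exists_opA (φ : DiffCircle) :
    ∃ a : HalfSpace →L[ℂ] HalfSpace, ∀ p q, a (basisVec q) p = blockA φ p q := by
  choose v hv h using fun q => exists_contDiff_columnA (SmoothCurve.const φ) q
  obtain ⟨a, ha⟩ := exists_clm_of_gram (fun q => v q 0)
    (1 + adjoint (op (opB φ)) ∘L op (opB φ)) fun p q => by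
      have h1 := lp.hasSum_inner (𝕜 := ℂ) (v p 0) (v q 0)
      have h2 := lp.hasSum_inner (𝕜 := ℂ) (op (opB φ) (basisVec p)) (op (opB φ) (basisVec q))
      have h3 := h1.sub h2
      have e : ∀ z w : ℂ, ⟪z, w⟫_ℂ = conj z * w := fun z w => by
        rw [RCLike.inner_apply, mul_comm]
      simp only [e, h, op_basisVec, opB_apply] at h3
      have h4 := h3.unique (hasSum_block_conj φ p q)
      rw [add_apply, inner_add_right, ContinuousLinearMap.comp_apply,
        ContinuousLinearMap.adjoint_inner_right, sub_eq_iff_eq_add.1 h4]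
      congr 1
      rw [inner_basisVec, one_apply_eq_self, lp.single_apply]
      simp [Pi.single_apply]
  exact ⟨a, fun p q => by rw [ha, h]⟩

/-- The bounded block `W_+ → W_+` of the pullback. -/
def opA (φ : DiffCircle) : HalfSpace →L[ℂ] HalfSpace := (exists_opA φ).choose

theorem opA_basisVec (φ : DiffCircle) (p q : ℕ+) : opA φ (basisVec q) p = blockA φ p q :=
  (exists_opA φ).choose_spec p q

theorem opA_inv (φ : DiffCircle) : opA φ⁻¹ = adjoint (opA φ) :=
  clm_ext_entries fun p q => by rw [opA_basisVec, adjoint_basisVec, opA_basisVec, blockA_inv]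

theorem op_opB_inv (φ : DiffCircle) : op (opB φ⁻¹) = -transposeOp (op (opB φ)) :=
  clm_ext_entries fun p q => by
    rw [op_basisVec, neg_apply, lp.coeFn_neg, Pi.neg_apply,
      transposeOp_basisVec, op_basisVec, opB_apply, opB_apply, blockB_inv]

theorem hasSum_transposeOp_comp (K L : HalfSpace →L[ℂ] HalfSpace) (p q : ℕ+) :
    HasSum (fun r => K (basisVec p) r * L (basisVec q) r)
      ((transposeOp K ∘L L) (basisVec q) p) := by
  have h := lp.hasSum_inner (𝕜 := ℂ) (conjOp K (basisVec p)) (L (basisVec q))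
  rw [← adjoint_transposeOp, ContinuousLinearMap.adjoint_inner_left, inner_basisVec] at h
  refine hasSum_of_eq h (fun r => ?_) rfl
  rw [adjoint_transposeOp, conjOp_basisVec, RCLike.inner_apply, RCLike.conj_conj, mul_comm]

theorem gram_opA (φ : DiffCircle) :
    adjoint (opA φ) ∘L opA φ = 1 + adjoint (op (opB φ)) ∘L op (opB φ) := by
  refine clm_ext_entries fun p q => ?_
  have h1 := hasSum_transposeOp_comp (conjOp (opA φ)) (opA φ) p q
  have h2 := hasSum_transposeOp_comp (conjOp (op (opB φ))) (op (opB φ)) p q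
  simp only [conjOp_basisVec, opA_basisVec, op_basisVec, opB_apply, transposeOp_conjOp] at h1 h2
  have h3 := (h1.sub h2).unique (hasSum_block_conj φ p q)
  rw [sub_eq_iff_eq_add.1 h3, add_apply, lp.coeFn_add, Pi.add_apply]
  congr 1
  rw [one_apply_eq_self, lp.single_apply]
  simp [Pi.single_apply]

theorem symm_opA (φ : DiffCircle) :
    transposeOp (opA φ) ∘L op (opB φ) = transposeOp (op (opB φ)) ∘L opA φ := by
  refine clm_ext_entries fun p q => ?_
  have h1 := hasSum_transposeOp_comp (opA φ) (op (opB φ)) p q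
  have h2 := hasSum_transposeOp_comp (op (opB φ)) (opA φ) p q
  simp only [opA_basisVec, op_basisVec, opB_apply] at h1 h2
  exact sub_eq_zero.1 ((h1.sub h2).unique (hasSum_block_mul φ q p))

theorem transposeOp_neg (K : HalfSpace →L[ℂ] HalfSpace) : transposeOp (-K) = -transposeOp K :=
  clm_ext_entries fun p q => by simp [transposeOp_basisVec]

theorem isSymplecticPair (φ : DiffCircle) : IsSymplecticPair (opA φ) (opB φ) where
  gram := gram_opA φ
  symm := symm_opA φ
  gram_adjoint := by
    have h := gram_opA φ⁻¹
    rwa [opA_inv, op_opB_inv, ContinuousLinearMap.adjoint_adjoint, map_neg,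
      ContinuousLinearMap.neg_comp, ContinuousLinearMap.comp_neg, neg_neg,
      adjoint_transposeOp] at h

theorem symm_opA_adjoint (φ : DiffCircle) :
    op (opB φ) ∘L adjoint (opA φ) = conjOp (opA φ) ∘L transposeOp (op (opB φ)) := by
  have h := symm_opA φ⁻¹
  rw [opA_inv, op_opB_inv, transposeOp_adjoint, transposeOp_neg, transposeOp_transposeOp,
    ContinuousLinearMap.comp_neg, ContinuousLinearMap.neg_comp, neg_inj] at h
  exact h.symm

/-! ### Smoothness of the period map -/

/-- The Hilbert-Schmidt operator `b a†`. -/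
def opX (φ : DiffCircle) : HSOp := hsRight (opB φ) (adjoint (opA φ))

theorem opX_apply (φ : DiffCircle) (p q : ℕ+) :
    opX φ (p, q) = ∑' r, blockB φ p r * conj (blockA φ q r) := by
  rw [← op_basisVec, opX, op_hsRight, ContinuousLinearMap.comp_apply, op_apply]
  simp only [opB_apply, adjoint_basisVec, opA_basisVec]

theorem opX_symm (φ : DiffCircle) (p q : ℕ+) : opX φ (p, q) = opX φ (q, p) := by
  have h : IsSymm (opX φ) := (isSymm_iff _).2 (by
    rw [opX, op_hsRight, transposeOp_comp, transposeOp_adjoint, symm_opA_adjoint])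
  exact h p q

/-- The rapid decay of `b` in the index of summation dominates the polynomial growth of the
derivatives of `a`, and leaves rapid decay in the first index only. -/
theorem derivBound_opX {c : ℝ → DiffCircle} (hc : SmoothCurve c) (n N : ℕ) :
    DerivBound n (fun (i : ℕ+ × ℕ+) t => opX (c t) i)
      (fun i => ((i.1 : ℝ) ^ N)⁻¹ * (i.2 : ℝ)) := by
  have h : ∀ n, DerivBound n
      (fun (x : (ℕ+ × ℕ+) × ℕ+) t => blockB (c t) x.1.1 x.2 * conj (blockA (c t) x.1.2 x.2))
      (fun x => ((x.1.1 : ℝ) ^ N)⁻¹ * (x.1.2 : ℝ) * ((x.2 : ℝ) ^ 2)⁻¹) := fun n => by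
    have h1 := ((derivBound_blockB hc n N (n + 2)).comp
      fun x : (ℕ+ × ℕ+) × ℕ+ => (x.1.1, x.2)).mul
      ((derivBound_blockA hc n).conj.comp fun x : (ℕ+ × ℕ+) × ℕ+ => (x.1.2, x.2))
    refine h1.mono 1 zero_le_one fun x => ?_
    have hr : (0 : ℝ) < (x.2 : ℕ) := by exact_mod_cast x.2.pos
    have hp : (0 : ℝ) < (x.1.1 : ℕ) := by exact_mod_cast x.1.1.pos
    refine le_of_eq ?_
    rw [pow_add]
    field_simp
  have h2 := DerivBound.tsum (u := fun i : ℕ+ × ℕ+ => ((i.1 : ℝ) ^ N)⁻¹ * (i.2 : ℝ))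
    (fun i => by positivity) summable_pnat_sq h n
  convert h2 using 3 with i t
  exact opX_apply _ _ _

/-- By symmetry the entries of `b a†` decay rapidly in either index, and by taking the geometric
mean, in both. -/
theorem contDiff_opX {c : ℝ → DiffCircle} (hc : SmoothCurve c) :
    ContDiff ℝ ∞ fun t => opX (c t) := by
  obtain ⟨g, hg, h⟩ := exists_contDiff_lp (f := fun (i : ℕ+ × ℕ+) t => opX (c t) i) fun n =>
    ⟨_, summable_pnat_prod, by
      have h1 := derivBound_opX hc n 5
      have h2 := h1.comp Prod.swap
      have e : (fun (i : ℕ+ × ℕ+) t => opX (c t) i.swap) = fun i t => opX (c t) i :=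
        funext fun i => funext fun t => opX_symm _ _ _
      rw [e] at h2
      refine h1.geom_mean h2 (fun i => by positivity) fun i => le_of_eq ?_
      have hp : (0 : ℝ) < (i.1 : ℕ) := by exact_mod_cast i.1.pos
      have hq : (0 : ℝ) < (i.2 : ℕ) := by exact_mod_cast i.2.pos
      simp only [Prod.fst_swap, Prod.snd_swap]
      field_simp⟩
  convert hg using 2 with t
  ext i
  rw [h]

/-- The point of the Siegel disc defined by a diffeomorphism. -/
def period (φ : DiffCircle) : HSOp := siegelPoint (opA φ) (opB φ)

/-- The period as a product of `b a†` and the inverse of `1 + b̄bᵗ`, both of which are smooth in the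
time although `a` need not be in the operator norm. -/
theorem contDiff_period {c : ℝ → DiffCircle} (hc : SmoothCurve c) :
    ContDiff ℝ ∞ fun t => period (c t) := by
  have h0 : ∀ t, 1 + conjOp (op (opB (c t))) ∘L transposeOp (op (opB (c t))) =
      1 + opL (star (opB (c t))) ∘L opL (hsTranspose (opB (c t))) := fun t => by
    rw [opL_apply, opL_apply, op_star, op_hsTranspose]
  have hL : ContDiff ℝ ∞ fun t => opL (hsTranspose (opB (c t))) :=
    ((opL ∘L hsTranspose.toContinuousLinearMap).restrictScalars ℝ).contDiff.comp (contDiff_opB hc)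
  have hstar : ContDiff ℝ ∞ fun t => star (opB (c t)) :=
    (starL' ℝ : HSOp ≃L[ℝ] HSOp).contDiff.comp (contDiff_opB hc)
  have hK : ContDiff ℝ ∞ fun t => opL (star (opB (c t))) :=
    (opL.restrictScalars ℝ).contDiff.comp hstar
  have h1 : ContDiff ℝ ∞ fun t =>
      1 + opL (star (opB (c t))) ∘L opL (hsTranspose (opB (c t))) :=
    contDiff_const.add (hK.mul hL)
  have h2 : ContDiff ℝ ∞ fun t => Ring.inverse
      (1 + conjOp (op (opB (c t))) ∘L transposeOp (op (opB (c t)))) := by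
    rw [contDiff_iff_contDiffAt]
    intro t
    have hu : IsUnit (1 + opL (star (opB (c t))) ∘L opL (hsTranspose (opB (c t)))) := by
      rw [← h0, ← (isSymplecticPair (c t)).gram_adjoint]
      exact (isSymplecticPair (c t)).isUnit.mul (isSymplecticPair (c t)).isUnit.star
    obtain ⟨u, hu⟩ := hu
    simp only [h0]
    have h3 : ContDiffAt ℝ ∞ Ring.inverse
        (1 + opL (star (opB (c t))) ∘L opL (hsTranspose (opB (c t)))) := by
      rw [← hu]
      exact contDiffAt_ringInverse ℝ u
    exact h3.comp t h1.contDiffAt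
  have h3 := isBoundedBilinearMap_hsRight.contDiff.comp ((contDiff_opX hc).prodMk h2)
  convert h3 using 2 with t
  exact (isSymplecticPair (c t)).siegelPoint_eq

/-! ### The polarization is the graph of the period -/

theorem smoothAngle_comp_exp {σ : Circle → ℂ} (hσ : ContMDiff (𝓡 1) 𝓘(ℝ, ℂ) ∞ σ) :
    SmoothAngle fun θ => σ (Circle.exp θ) :=
  ⟨(hσ.comp contMDiff_circleExp).contDiff, fun θ => by
    simp only [circleExp_add_two_pi]⟩

theorem hasSum_smoothPlus {σ : Circle → ℂ} (hσ : σ ∈ SmoothPlus) (z : Circle) :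
    HasSum (fun k : ℕ => fourierCoef σ k * (z : ℂ) ^ k) (σ z) := by
  obtain ⟨θ, rfl⟩ := Circle.exp_surjective z
  have h := (smoothAngle_comp_exp hσ.1).hasSum_fourier θ
  have h2 := (Function.Injective.hasSum_iff (g := fun k : ℕ => (k : ℤ)) Nat.cast_injective
    (f := fun k : ℤ => angleCoef (fun θ => σ (Circle.exp θ)) k * Complex.exp (k * θ * Complex.I))
    fun k hk => by
      have hk0 : k < 0 := by
        by_contra h0
        exact hk ⟨k.toNat, Int.toNat_of_nonneg (not_lt.1 h0)⟩
      rw [← fourierCoef_eq, hσ.2 k hk0, zero_mul]).2 h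
  refine hasSum_of_eq h2 (fun k => ?_) rfl
  rw [Function.comp_apply, Circle.coe_exp, ← Complex.exp_nat_mul, fourierCoef_eq]
  congr 2
  push_cast
  ring

/-- The coefficients of `σ ∘ φ` in terms of those of `σ` and of the powers of `φ`. -/
theorem hasSum_fourierCoef_comp {σ : Circle → ℂ} (hσ : σ ∈ SmoothPlus) (φ : DiffCircle) (j : ℤ) :
    HasSum (fun k : ℕ => fourierCoef σ k * mapCoef φ j k) (fourierCoef (σ ∘ φ) j) := by
  have hs : Summable fun k : ℕ => ‖fourierCoef σ k‖ :=
    (smoothAngle_comp_exp hσ.1).summable_angleCoef.comp_injective Nat.cast_injective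
  have hcφ := (smoothAngle_angleMap φ).continuous
  have h := intervalIntegral.hasSum_integral_of_dominated_convergence
    (μ := MeasureTheory.volume) (a := 0) (b := 2 * Real.pi)
    (F := fun (k : ℕ) (θ : ℝ) => fourierCoef σ k * angleMap φ θ ^ k *
      Complex.exp (-(j * θ * Complex.I)))
    (f := fun θ => σ (φ (Circle.exp θ)) * Complex.exp (-(j * θ * Complex.I)))
    (fun k _ => ‖fourierCoef σ k‖)
    (fun k => (by fun_prop : Continuous fun θ : ℝ => fourierCoef σ k * angleMap φ θ ^ k *
      Complex.exp (-(j * θ * Complex.I))).aestronglyMeasurable)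
    (fun k => Filter.Eventually.of_forall fun θ _ => by
      have e : -(j * θ * Complex.I : ℂ) = ((-j : ℤ) : ℂ) * θ * Complex.I := by push_cast; ring
      rw [norm_mul, norm_mul, norm_pow, norm_angleMap, one_pow, mul_one, e, norm_exp_int_mul,
        mul_one])
    (Filter.Eventually.of_forall fun θ _ => hs)
    intervalIntegrable_const
    (Filter.Eventually.of_forall fun θ _ => (hasSum_smoothPlus hσ _).mul_right _)
  refine hasSum_of_eq (h.mul_left (2 * Real.pi : ℂ)⁻¹) (fun k => ?_) rfl
  rw [mapCoef, angleCoef, mul_left_comm, ← intervalIntegral.integral_const_mul]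
  congr 2
  funext θ
  ring

theorem mapCoef_zero (φ : DiffCircle) {j : ℤ} (hj : j ≠ 0) : mapCoef φ j 0 = 0 := by
  have h := angleCoef_exp_int 0 j
  rw [if_neg hj.symm] at h
  simpa [mapCoef] using h

/-- A function with coefficients of nonnegative index, in the orthonormal basis of `W_+`. -/
theorem exists_halfSpace_of_smoothPlus {σ : Circle → ℂ} (hσ : σ ∈ SmoothPlus) :
    ∃ y : HalfSpace, ∀ p : ℕ+, y p = √(p : ℝ) * fourierCoef σ p := by
  obtain ⟨C, hC0, hC⟩ := (smoothAngle_comp_exp hσ.1).exists_bound_angleCoef 2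
  refine ⟨⟨fun p : ℕ+ => √(p : ℝ) * fourierCoef σ p, memℓp_gen ?_⟩, fun p => rfl⟩
  refine Summable.of_nonneg_of_le (fun _ => by positivity) (fun p => ?_)
    (summable_pnat_sq.mul_left (C ^ 2))
  have hp : (1 : ℝ) ≤ (p : ℕ) := by exact_mod_cast one_le (a := p)
  have h1 := hC p
  rw [← fourierCoef_eq] at h1
  have h2 : √(p : ℝ) ≤ p := (Real.sqrt_le_left (by positivity)).2 (by nlinarith)
  have h3 : ‖(√(p : ℝ) * fourierCoef σ p : ℂ)‖ ≤ C * ((p : ℕ) : ℝ)⁻¹ := by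
    rw [norm_mul, Complex.norm_real, Real.norm_of_nonneg (Real.sqrt_nonneg _)]
    have h4 : ((1 + ((p : ℕ) : ℝ) ^ 2) ^ 2)⁻¹ ≤ (((p : ℕ) : ℝ) ^ 2)⁻¹ :=
      inv_anti₀ (by positivity) (by nlinarith [sq_nonneg (((p : ℕ) : ℝ) ^ 2)])
    calc √(p : ℝ) * ‖fourierCoef σ p‖ ≤ ((p : ℕ) : ℝ) * (C * (((p : ℕ) : ℝ) ^ 2)⁻¹) := by
          refine mul_le_mul h2 ?_ (norm_nonneg _) (by positivity)
          refine (by exact_mod_cast h1 : _ ≤ C * ((1 + ((p : ℕ) : ℝ) ^ 2) ^ 2)⁻¹).trans ?_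
          exact mul_le_mul_of_nonneg_left h4 hC0
      _ = C * ((p : ℕ) : ℝ)⁻¹ := by field_simp
  have h4 := pow_le_pow_left₀ (norm_nonneg _) h3 2
  rw [mul_pow, inv_pow] at h4
  simpa using h4

/-- The entries of a bounded operator determine its values. -/
theorem hasSum_apply (K : HalfSpace →L[ℂ] HalfSpace) (y : HalfSpace) (p : ℕ+) :
    HasSum (fun q => y q * K (basisVec q) p) (K y p) := by
  have h := ((hasSum_basisVec y).mapL K).mapL (lp.evalCLM ℂ (fun _ : ℕ+ => ℂ) 2 p)
  refine hasSum_of_eq h (fun q => ?_) rfl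
  rw [map_smul, map_smul]
  rfl

theorem fourierCoef_comp_eq {σ : Circle → ℂ} (hσ : σ ∈ SmoothPlus) (φ : DiffCircle) {y : HalfSpace}
    (hy : ∀ p : ℕ+, y p = √(p : ℝ) * fourierCoef σ p) {j : ℤ} (hj : j ≠ 0) (p : ℕ+) :
    HasSum (fun q : ℕ+ => y q * (normFactor p q * mapCoef φ j q))
      (√(p : ℝ) * fourierCoef (σ ∘ φ) j) := by
  have h := (Function.Injective.hasSum_iff PNat.coe_injective
    (f := fun k : ℕ => fourierCoef σ k * mapCoef φ j k) fun n hn => by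
      have : n = 0 := by
        by_contra h
        exact hn ⟨⟨n, Nat.pos_of_ne_zero h⟩, rfl⟩
      rw [this, mapCoef_zero φ hj, mul_zero]).2 (hasSum_fourierCoef_comp hσ φ j)
  refine hasSum_of_eq (h.mul_left (√(p : ℝ) : ℂ)) (fun q => ?_) rfl
  have := sqrt_pnat_ne_zero q
  rw [hy, normFactor, Function.comp_apply]
  push_cast
  field_simp

theorem represents_comp {σ : Circle → ℂ} (hσ : σ ∈ SmoothPlus) (φ : DiffCircle) {y : HalfSpace}
    (hy : ∀ p : ℕ+, y p = √(p : ℝ) * fourierCoef σ p) :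
    Represents (σ ∘ φ) (opA φ y, op (opB φ) y) := by
  intro p
  have hp := p.ne_zero
  constructor
  · refine (hasSum_apply (opA φ) y p).unique ?_
    simp only [opA_basisVec, blockA]
    exact fourierCoef_comp_eq hσ φ hy (by exact_mod_cast hp) p
  · refine (hasSum_apply (op (opB φ)) y p).unique ?_
    simp only [op_basisVec, opB_apply, blockB]
    exact fourierCoef_comp_eq hσ φ hy (by simp) p

theorem Represents.unique {f : Circle → ℂ} {x y : HalfSpace × HalfSpace} (hx : Represents f x)
    (hy : Represents f y) : x = y :=
  Prod.ext (lp.ext (funext fun p => (hx p).1.trans (hy p).1.symm))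
    (lp.ext (funext fun p => (hx p).2.trans (hy p).2.symm))

theorem fourierCoef_add {f g : Circle → ℂ} (hf : Continuous f) (hg : Continuous g) (k : ℤ) :
    fourierCoef (f + g) k = fourierCoef f k + fourierCoef g k := by
  have hf' : Continuous fun θ : ℝ => f (Circle.exp θ) * Complex.exp (-(k * θ * Complex.I)) := by
    have := hf.comp Circle.exp.continuous
    fun_prop
  have hg' : Continuous fun θ : ℝ => g (Circle.exp θ) * Complex.exp (-(k * θ * Complex.I)) := by
    have := hg.comp Circle.exp.continuous
    fun_prop
  simp only [fourierCoef, Pi.add_apply, add_mul]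
  rw [intervalIntegral.integral_add (hf'.intervalIntegrable _ _) (hg'.intervalIntegrable _ _),
    mul_add]

theorem fourierCoef_smul (a : ℂ) (f : Circle → ℂ) (k : ℤ) :
    fourierCoef (a • f) k = a * fourierCoef f k := by
  simp only [fourierCoef, Pi.smul_apply, smul_eq_mul, mul_assoc]
  rw [intervalIntegral.integral_const_mul, mul_left_comm]

/-- The classes of the functions `σ ∘ φ` form a linear subspace. -/
def smoothPolarization (φ : DiffCircle) : Submodule ℂ (HalfSpace × HalfSpace) where
  carrier := {x | ∃ σ ∈ SmoothPlus, Represents (σ ∘ φ) x}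
  zero_mem' := ⟨0, ⟨contMDiff_const, fun k _ => by simp [fourierCoef]⟩, fun p => by
    simp [fourierCoef]⟩
  add_mem' := by
    rintro x y ⟨σ, hσ, hx⟩ ⟨τ, hτ, hy⟩
    have hφ := φ.2.1.continuous
    refine ⟨σ + τ, ⟨hσ.1.add hτ.1, fun k hk => ?_⟩, fun p => ?_⟩
    · rw [fourierCoef_add hσ.1.continuous hτ.1.continuous, hσ.2 k hk, hτ.2 k hk, add_zero]
    · have e : (σ + τ) ∘ φ = σ ∘ φ + τ ∘ φ := rfl
      rw [e, fourierCoef_add (hσ.1.continuous.comp hφ) (hτ.1.continuous.comp hφ),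
        fourierCoef_add (hσ.1.continuous.comp hφ) (hτ.1.continuous.comp hφ), mul_add, mul_add,
        ← (hx p).1, ← (hx p).2, ← (hy p).1, ← (hy p).2]
      exact ⟨rfl, rfl⟩
  smul_mem' := by
    rintro a x ⟨σ, hσ, hx⟩
    refine ⟨a • σ, ⟨(contDiff_const_smul a).contMDiff.comp hσ.1, fun k hk => ?_⟩, fun p => ?_⟩
    · rw [fourierCoef_smul, hσ.2 k hk, mul_zero]
    · have e : (a • σ) ∘ φ = a • (σ ∘ φ) := rfl
      rw [e, fourierCoef_smul, fourierCoef_smul, mul_left_comm, mul_left_comm _ a, ← (hx p).1,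
        ← (hx p).2]
      exact ⟨rfl, rfl⟩

theorem fourierCoef_circle_pow (q : ℕ) (k : ℤ) :
    fourierCoef (fun z => (z : ℂ) ^ q) k = if (q : ℤ) = k then 1 else 0 := by
  rw [fourierCoef_eq, angleCoef_circle_pow]

theorem circle_pow_mem_smoothPlus (q : ℕ) : (fun z : Circle => (z : ℂ) ^ q) ∈ SmoothPlus :=
  ⟨(contDiff_id.pow q : ContDiff ℝ ∞ fun z : ℂ => z ^ q).contMDiff.comp contMDiff_circle_coe,
    fun k hk => by
    rw [fourierCoef_circle_pow, if_neg (by lia)]⟩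

/-- The image of `W_+` under the pullback is closed, as a graph, and the classes of the `φ^q` span a
dense subspace of it. -/
theorem graph_period (φ : DiffCircle) : graph (period φ) = polarization φ := by
  refine Set.Subset.antisymm ?_ (closure_minimal ?_ ?_)
  · rw [period, (isSymplecticPair φ).graph_siegelPoint]
    rintro _ ⟨y, rfl⟩
    change _ ∈ closure (smoothPolarization φ : Set (HalfSpace × HalfSpace))
    rw [← Submodule.topologicalClosure_coe]
    have h := (hasSum_basisVec y).mapL ((opA φ).prod (op (opB φ)))
    refine (Submodule.isClosed_topologicalClosure _).mem_of_tendsto h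
      (Filter.Eventually.of_forall fun s => ?_)
    refine Submodule.sum_mem _ fun q _ => ?_
    rw [map_smul]
    refine Submodule.smul_mem _ _ (Submodule.le_topologicalClosure _ ?_)
    -- `√q e_q` is the class of `z ^ q`
    have h1 : (√(q : ℝ) : ℂ) • ((opA φ).prod (op (opB φ))) (basisVec q) ∈ smoothPolarization φ := by
      rw [← map_smul]
      refine ⟨_, circle_pow_mem_smoothPlus q,
        represents_comp (circle_pow_mem_smoothPlus q) φ fun p => ?_⟩
      rw [fourierCoef_circle_pow, lp.coeFn_smul, Pi.smul_apply, lp.single_apply, smul_eq_mul]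
      by_cases hpq : p = q
      · subst hpq; simp
      · have h2 : ¬ ((q : ℕ) : ℤ) = (p : ℕ) := fun h => hpq (PNat.coe_injective (by lia))
        simp [hpq, h2]
    have h2 := Submodule.smul_mem _ (√(q : ℝ) : ℂ)⁻¹ h1
    rwa [smul_smul, inv_mul_cancel₀ (sqrt_pnat_ne_zero q), one_smul] at h2
  · rintro x ⟨σ, hσ, hx⟩
    obtain ⟨y, hy⟩ := exists_halfSpace_of_smoothPlus hσ
    rw [hx.unique (represents_comp hσ φ hy), period, (isSymplecticPair φ).graph_siegelPoint]
    exact ⟨y, rfl⟩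
  · exact isClosed_eq continuous_snd ((op (period φ)).continuous.comp continuous_fst)

theorem eq_of_graph_eq {Z W : HSOp} (h : graph Z = graph W) : Z = W := by
  apply op_injective
  ext1 x
  have h1 : (x, op Z x) ∈ graph W := by
    rw [← h]
    rfl
  exact h1

/-! ### Invariance under the Möbius group -/

/-- The powers of a Möbius transformation have no Fourier coefficients of negative index, by Cauchy's
theorem in the disc. -/
theorem mapCoef_mob {m : DiffCircle} (hm : m ∈ Mob) {j : ℤ} (hj : j < 0) (k : ℕ) :
    mapCoef m j k = 0 := by
  obtain ⟨a, b, hab, h⟩ := hm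
  have hlt : ‖b‖ < ‖a‖ := by
    have := norm_nonneg a
    have := norm_nonneg b
    nlinarith
  have hden : ∀ z : ℂ, ‖z‖ ≤ 1 → conj b * z + conj a ≠ 0 := fun z hz h0 => by
    have h1 : ‖conj a‖ = ‖conj b * z‖ := by
      rw [eq_neg_of_add_eq_zero_right h0, norm_neg]
    rw [norm_mul, RCLike.norm_conj, RCLike.norm_conj] at h1
    have := norm_nonneg b
    nlinarith
  obtain ⟨p, rfl⟩ : ∃ p : ℕ, j = -((p : ℤ) + 1) := ⟨(-j - 1).toNat, by lia⟩
  -- the integrand extends to a holomorphic function on the disc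
  let f : ℂ → ℂ := fun z => ((a * z + b) / (conj b * z + conj a)) ^ k * z ^ p
  have hd : ∀ z : ℂ, ‖z‖ ≤ 1 → DifferentiableAt ℂ f z := fun z hz => by
    have h1 : DifferentiableAt ℂ (fun z => a * z + b) z := by fun_prop
    have h2 : DifferentiableAt ℂ (fun z => conj b * z + conj a) z := by fun_prop
    exact ((h1.fun_div h2 (hden z hz)).fun_pow k).fun_mul (differentiableAt_id.fun_pow p)
  have hf : (∮ z in C(0, 1), f z) = 0 := by
    refine Complex.circleIntegral_eq_zero_of_differentiable_on_off_countable zero_le_one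
      Set.countable_empty (fun z hz => (hd z (by simpa using hz)).continuousAt.continuousWithinAt)
      fun z hz => hd z ?_
    have := hz.1
    rw [Metric.mem_ball, dist_zero_right] at this
    exact this.le
  have e : ∀ θ : ℝ, deriv (circleMap 0 1) θ • f (circleMap 0 1 θ) = Complex.I *
      (angleMap m θ ^ k * Complex.exp (-(((-((p : ℤ) + 1) : ℤ) : ℂ) * θ * Complex.I))) := by
    intro θ
    have h1 : circleMap 0 1 θ = (Circle.exp θ : ℂ) := by
      rw [Circle.coe_exp, circleMap]; simp
    have h2 : angleMap m θ = (a * (Circle.exp θ : ℂ) + b) / (conj b * Circle.exp θ + conj a) := by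
      rw [eq_div_iff (hden _ (by simp))]
      exact h (Circle.exp θ)
    have h3 : Complex.exp (-(((-((p : ℤ) + 1) : ℤ) : ℂ) * θ * Complex.I)) =
        (Circle.exp θ : ℂ) ^ p * Circle.exp θ := by
      rw [← pow_succ, Circle.coe_exp, ← Complex.exp_nat_mul]
      congr 1
      push_cast
      ring
    rw [deriv_circleMap, h1, h2, h3, smul_eq_mul]
    simp only [f]
    ring
  rw [circleIntegral] at hf
  simp only [e] at hf
  rw [intervalIntegral.integral_const_mul] at hf
  rw [mapCoef, angleCoef, (mul_eq_zero.1 hf).resolve_left Complex.I_ne_zero, mul_zero]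

theorem smoothPlus_comp_mob {m : DiffCircle} (hm : m ∈ Mob) {σ : Circle → ℂ}
    (hσ : σ ∈ SmoothPlus) : σ ∘ m ∈ SmoothPlus :=
  ⟨hσ.1.comp m.2.1, fun k hk => by
    refine (hasSum_fourierCoef_comp hσ m k).unique ?_
    simp only [mapCoef_mob hm hk, mul_zero]
    exact hasSum_zero⟩

theorem polarization_mob_mul {m : DiffCircle} (hm : m ∈ Mob) (φ : DiffCircle) :
    polarization (m * φ) = polarization φ := by
  unfold polarization
  congr 1
  ext x
  constructor
  · rintro ⟨σ, hσ, hx⟩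
    exact ⟨σ ∘ m, smoothPlus_comp_mob hm hσ, hx⟩
  · rintro ⟨σ, hσ, hx⟩
    refine ⟨σ ∘ (m⁻¹ : DiffCircle), smoothPlus_comp_mob (Mob.inv_mem hm) hσ, ?_⟩
    convert hx using 1
    funext z
    exact congrArg σ (m.1.symm_apply_apply (φ z))

/-- The period map on the homogeneous space. -/
def periodMap (x : DiffModMob) : siegelDisc :=
  Quotient.lift (fun φ => (⟨period φ, (isSymplecticPair φ).siegelPoint_mem⟩ : siegelDisc))
    (fun φ ψ h => by
      have h1 : ψ * φ⁻¹ ∈ Mob := QuotientGroup.rightRel_apply.1 h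
      have h2 := polarization_mob_mul h1 φ
      rw [inv_mul_cancel_right, ← graph_period, ← graph_period] at h2
      exact Subtype.ext (eq_of_graph_eq h2).symm) x

/-! ### The derivative of the period map -/

theorem hasDerivAt_lp_apply {ι : Type*} {v : ℝ → lp (fun _ : ι => ℂ) 2}
    {v' : lp (fun _ : ι => ℂ) 2} {t : ℝ} (h : HasDerivAt v v' t) (i : ι) :
    HasDerivAt (fun t => v t i) (v' i) t :=
  ((lp.evalCLM ℂ (fun _ : ι => ℂ) 2 i).restrictScalars ℝ).hasFDerivAt.comp_hasDerivAt t h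

theorem hasDerivAt_op_apply {Z : ℝ → HSOp} {v : ℝ → HalfSpace} {Z' : HSOp} {v' : HalfSpace} {t : ℝ}
    (hZ : HasDerivAt Z Z' t) (hv : HasDerivAt v v' t) :
    HasDerivAt (fun t => op (Z t) (v t)) (op (Z t) v' + op Z' (v t)) t := by
  have h1 : HasDerivAt (fun t => opL (Z t)) (opL Z') t :=
    (opL.restrictScalars ℝ).hasFDerivAt.comp_hasDerivAt t hZ
  have h2 := (isBoundedBilinearMap_apply (𝕜 := ℂ) (E := HalfSpace) (F := HalfSpace)).hasFDerivAt
    (opL (Z t), v t)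
  exact (h2.restrictScalars ℝ).comp_hasDerivAt t (h1.prodMk hv)

/-- The tangent vector of the period map carried to the origin of the Siegel disc. -/
def originVelocity (c : ℝ → DiffCircle) : HSOp :=
  hsLeft (transposeOp (opA (c 0))) (hsRight (deriv (fun t => period (c t)) 0) (opA (c 0)))

/-- The velocity of the function `φ_t^q`, as a function of the value of `φ_0`. -/
def powVelocity (c : ℝ → DiffCircle) (q : ℕ) (z : Circle) : ℂ :=
  (z : ℂ) ^ q * (q * rightVelocity c z * Complex.I)

theorem continuous_powVelocity {c : ℝ → DiffCircle} (hc : SmoothCurve c) (q : ℕ) :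
    Continuous (powVelocity c q) := by
  have h1 := Complex.continuous_ofReal.comp (continuous_rightVelocity hc)
  exact (continuous_subtype_val.pow q).mul ((continuous_const.mul h1).mul continuous_const)

/-- Differentiation of the coefficients of `φ_t^q` under the integral. -/
theorem hasDerivAt_mapCoef {c : ℝ → DiffCircle} (hc : SmoothCurve c) (k : ℤ) (q : ℕ) :
    HasDerivAt (fun t => mapCoef (c t) k q)
      (angleCoef (fun θ => powVelocity c q (c 0 (Circle.exp θ))) k) 0 := by
  have h := (hc.angleFamily.hasDerivAt_angleIntegral (SmoothPeriodic.const 1) (-k) q 0 0).const_mul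
    (2 * Real.pi : ℂ)⁻¹
  have e : (fun t => mapCoef (c t) k q) = fun t => (2 * Real.pi : ℂ)⁻¹ *
      angleIntegral (fun v => phase (fun t θ => angleMap (c t) θ) (-k) q v * 1) 0 t := by
    funext t
    simp only [mapCoef_eq_angleIntegral, mul_one]
  rw [e]
  refine h.congr_deriv ?_
  have h0 : ∀ v, dTime (fun _ => 1) v = 0 := fun v => by
    rw [dTime, fderiv_const_apply]; rfl
  rw [angleCoef, angleIntegral]
  simp only [h0, zero_add, mul_one, phase, powVelocity, rightVelocity_apply hc]
  congr 2
  funext θ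
  rw [show (((-k : ℤ) : ℂ) * θ * Complex.I) = -(k * θ * Complex.I) by push_cast; ring, angleMap]
  ring

theorem hasSum_transposeOp_apply (K : HalfSpace →L[ℂ] HalfSpace) (y : HalfSpace) (p : ℕ+) :
    HasSum (fun r => K (basisVec p) r * y r) (transposeOp K y p) := by
  refine hasSum_of_eq (hasSum_apply (transposeOp K) y p) (fun r => ?_) rfl
  rw [transposeOp_basisVec, mul_comm]

theorem angleCoef_powVelocity (c : ℝ → DiffCircle) (p q : ℕ+) :
    angleCoef (fun θ => powVelocity c q (Circle.exp θ)) (-(p : ℕ)) =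
      (q : ℕ) * Complex.I * vecCoef (rightVelocity c) (-((p : ℕ) + (q : ℕ))) := by
  rw [vecCoef, fourierCoef, angleCoef, mul_left_comm]
  congr 1
  rw [← intervalIntegral.integral_const_mul]
  congr 1
  funext θ
  have h : Complex.exp (-(((-((p : ℕ) + (q : ℕ)) : ℤ) : ℂ) * θ * Complex.I)) =
      (Circle.exp θ : ℂ) ^ (q : ℕ) * Complex.exp (-(((-(p : ℕ) : ℤ) : ℂ) * θ * Complex.I)) := by
    rw [Circle.coe_exp, ← Complex.exp_nat_mul, ← Complex.exp_add]
    congr 1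
    push_cast
    ring
  rw [h, powVelocity]
  ring

/-- The tangent vector at the origin, in terms of the Fourier coefficients of the velocity. -/
theorem originVelocity_apply {c : ℝ → DiffCircle} (hc : SmoothCurve c) (p q : ℕ+) :
    originVelocity c (p, q) = Complex.I * ((√(p : ℝ) : ℂ) * (√(q : ℝ) : ℂ)) *
      vecCoef (rightVelocity c) (-((p : ℕ) + (q : ℕ))) := by
  set g : ℝ → ℂ := fun θ => powVelocity c q (c 0 (Circle.exp θ)) with hg
  have hs := isSymplecticPair (c 0)
  obtain ⟨v, hv, hvA⟩ := exists_contDiff_columnA hc q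
  have hva : ∀ t, v t = opA (c t) (basisVec q) := fun t =>
    lp.ext (funext fun p => by rw [hvA, opA_basisVec])
  have dv : HasDerivAt v (deriv v 0) 0 := (hv.differentiable (by simp) 0).hasDerivAt
  have dB : HasDerivAt (fun t => opB (c t)) (deriv (fun t => opB (c t)) 0) 0 :=
    ((contDiff_opB hc).differentiable (by simp) 0).hasDerivAt
  have dZ : HasDerivAt (fun t => period (c t)) (deriv (fun t => period (c t)) 0) 0 :=
    ((contDiff_period hc).differentiable (by simp) 0).hasDerivAt
  -- differentiate the relation `Z a = b`
  have h1 := hasDerivAt_op_apply dZ dv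
  have h2 := hasDerivAt_op_apply dB (hasDerivAt_const (0 : ℝ) (basisVec q))
  have h3 : (fun t => op (period (c t)) (v t)) = fun t => op (opB (c t)) (basisVec q) :=
    funext fun t => by
      rw [hva, ← (isSymplecticPair (c t)).siegelPoint_comp]; rfl
  rw [h3] at h1
  have h4 := h1.unique h2
  rw [map_zero, zero_add] at h4
  have hvr : ∀ r, deriv v 0 r = normFactor r q * angleCoef g (r : ℕ) := fun r => by
    have h5 := hasDerivAt_lp_apply dv r
    simp only [hvA, blockA] at h5
    exact h5.unique ((hasDerivAt_mapCoef hc _ _).const_mul _)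
  have hBr : ∀ r, op (deriv (fun t => opB (c t)) 0) (basisVec q) r =
      normFactor r q * angleCoef g (-(r : ℕ)) := fun r => by
    have h5 := hasDerivAt_lp_apply dB (r, q)
    simp only [opB_apply, blockB] at h5
    rw [op_basisVec]
    exact h5.unique ((hasDerivAt_mapCoef hc _ _).const_mul _)
  have h5 : originVelocity c (p, q) =
      transposeOp (opA (c 0)) (op (deriv (fun t => opB (c t)) 0) (basisVec q)) p -
        transposeOp (op (opB (c 0))) (deriv v 0) p := by
    rw [← op_basisVec, originVelocity, op_hsLeft, op_hsRight, ContinuousLinearMap.comp_apply,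
      ContinuousLinearMap.comp_apply, ← hva, ← h4, map_add, ← hs.transposeOp_comp_siegelPoint,
      lp.coeFn_add, Pi.add_apply]
    exact (add_sub_cancel_left _ _).symm
  have h6 := (hasSum_transposeOp_apply (opA (c 0))
    (op (deriv (fun t => opB (c t)) 0) (basisVec q)) p).sub
    (hasSum_transposeOp_apply (op (opB (c 0))) (deriv v 0) p)
  rw [← h5] at h6
  have h7 := hasSum_pnat_of_int
    (hasSum_symplectic_mapCoef (c 0) p (continuous_powVelocity hc q)) (by simp)
  have h8 := h6.unique (hasSum_of_eq (h7.mul_left ((√(p : ℝ) : ℝ) * (√(q : ℝ) : ℝ) : ℂ)⁻¹)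
    (fun r => by
      have h9 := normFactor_mul_normFactor r p q
      simp only [hvr, hBr, opA_basisVec, op_basisVec, opB_apply, blockA, blockB, neg_neg]
      push_cast
      linear_combination (mapCoef (c 0) (r : ℕ) p * angleCoef g (-(r : ℕ)) -
        mapCoef (c 0) (-(r : ℕ)) p * angleCoef g (r : ℕ)) * h9) rfl)
  rw [h8, angleCoef_powVelocity, ← sqrt_mul_sqrt_pnat p, ← sqrt_mul_sqrt_pnat q]
  have := sqrt_pnat_ne_zero p
  have := sqrt_pnat_ne_zero q
  field_simp

theorem isSymm_deriv_period {c : ℝ → DiffCircle} (hc : SmoothCurve c) :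
    IsSymm (deriv (fun t => period (c t)) 0) := by
  intro p q
  have dZ : HasDerivAt (fun t => period (c t)) (deriv (fun t => period (c t)) 0) 0 :=
    ((contDiff_period hc).differentiable (by simp) 0).hasDerivAt
  have h1 := hasDerivAt_lp_apply dZ (p, q)
  have h2 := hasDerivAt_lp_apply dZ (q, p)
  have h3 : (fun t => period (c t) (p, q)) = fun t => period (c t) (q, p) :=
    funext fun t => (isSymplecticPair (c t)).siegelPoint_mem.1 p q
  rw [h3] at h1
  exact h1.unique h2

theorem originVelocity_eq_zero_iff (c : ℝ → DiffCircle) :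
    originVelocity c = 0 ↔ deriv (fun t => period (c t)) 0 = 0 := by
  have hs := isSymplecticPair (c 0)
  have h0 : op 0 = 0 := by ext x p; simp [op_apply]
  constructor
  · intro h
    apply op_injective
    refine hs.eq_of_comp_right (hs.eq_of_transposeOp_comp ?_)
    have h1 := congrArg op h
    rw [originVelocity, op_hsLeft, op_hsRight, h0] at h1
    rw [h1, h0]
    simp
  · intro h
    apply op_injective
    rw [originVelocity, op_hsLeft, op_hsRight, h, h0]
    simp

theorem vecCoef_neg (u : Circle → ℝ) (m : ℤ) : vecCoef u (-m) = conj (vecCoef u m) := by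
  have h := angleCoef_conj (fun θ => (u (Circle.exp θ) : ℂ)) (-m)
  simp only [Complex.conj_ofReal, neg_neg] at h
  exact h

theorem deriv_period_eq_zero_iff {c : ℝ → DiffCircle} (hc : SmoothCurve c) :
    deriv (fun t => period (c t)) 0 = 0 ↔
      ∀ m : ℤ, 2 ≤ |m| → vecCoef (rightVelocity c) m = 0 := by
  rw [← originVelocity_eq_zero_iff]
  constructor
  · intro h
    have key : ∀ n : ℕ, 2 ≤ n → vecCoef (rightVelocity c) (-n) = 0 := fun n hn => by
      obtain ⟨k, rfl⟩ := Nat.exists_eq_add_of_le hn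
      have h1 := originVelocity_apply hc 1 ⟨k + 1, k.succ_pos⟩
      have h2 := sqrt_pnat_ne_zero 1
      have h3 := sqrt_pnat_ne_zero ⟨k + 1, k.succ_pos⟩
      rw [h] at h1
      have h4 := (mul_eq_zero.1 h1.symm).resolve_left
        (mul_ne_zero Complex.I_ne_zero (mul_ne_zero h2 h3))
      rw [← h4]
      congr 1
      simp only [PNat.one_coe, PNat.mk_coe]
      push_cast
      ring
    intro m hm
    rcases abs_cases m with ⟨h1, -⟩ | ⟨h1, -⟩
    · obtain ⟨n, rfl⟩ := Int.eq_ofNat_of_zero_le (by lia : 0 ≤ m)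
      have h2 := key n (by lia)
      rwa [vecCoef_neg, map_eq_zero] at h2
    · obtain ⟨n, hn⟩ := Int.eq_ofNat_of_zero_le (by lia : 0 ≤ -m)
      have h2 := key n (by lia)
      rwa [← hn, neg_neg] at h2
  · intro h
    ext ⟨p, q⟩
    have hp := p.pos
    have hq := q.pos
    rw [originVelocity_apply hc, h _ (by rw [abs_neg, abs_of_nonneg (by positivity)]; lia), mul_zero]
    rfl

/-! ### Comparison of the metrics -/

theorem sum_antidiagonal_snd (n : ℕ) :
    ∑ x ∈ Finset.HasAntidiagonal.antidiagonal n, (x.2 : ℂ) = n * (n + 1) / 2 := by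
  induction n with
  | zero => simp
  | succ n ih =>
    rw [Finset.Nat.sum_antidiagonal_succ, ih]
    push_cast
    ring

theorem sum_antidiagonal_mul (n : ℕ) :
    ∑ x ∈ Finset.HasAntidiagonal.antidiagonal n, (x.1 : ℂ) * x.2 = ((n : ℂ) ^ 3 - n) / 6 := by
  induction n with
  | zero => simp
  | succ n ih =>
    rw [Finset.Nat.sum_antidiagonal_succ]
    push_cast
    simp only [add_mul, one_mul, Finset.sum_add_distrib]
    rw [ih, sum_antidiagonal_snd]
    ring

/-- A sum over pairs of positive indices, grouped by the sum of the indices. -/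
theorem hasSum_of_hasSum_pairs {f : ℕ → ℂ} {s : ℂ}
    (h : HasSum (fun i : ℕ+ × ℕ+ => ((i.1 : ℕ) : ℂ) * (i.2 : ℕ) * f (i.1 + i.2)) s) :
    HasSum (fun n : ℕ => ((n : ℂ) ^ 3 - n) / 6 * f n) s := by
  have h1 : HasSum (fun x : ℕ × ℕ => (x.1 : ℂ) * x.2 * f (x.1 + x.2)) s := by
    refine (Function.Injective.hasSum_iff
      (PNat.coe_injective.prodMap PNat.coe_injective) fun x hx => ?_).1 h
    obtain ⟨m, n⟩ := x
    rcases Nat.eq_zero_or_pos m with rfl | hm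
    · simp
    rcases Nat.eq_zero_or_pos n with rfl | hn
    · simp
    exact absurd ⟨(⟨m, hm⟩, ⟨n, hn⟩), rfl⟩ hx
  have h2 := Finset.HasAntidiagonal.sigmaAntidiagonalEquivProd.hasSum_iff.2 h1
  have h3 := h2.sigma fun n => hasSum_fintype _
  refine hasSum_of_eq h3 (fun n => ?_) rfl
  rw [← sum_antidiagonal_mul, Finset.sum_mul, ← Finset.sum_coe_sort]
  refine Finset.sum_congr rfl fun x _ => ?_
  have hx := Finset.HasAntidiagonal.mem_antidiagonal.1 x.2
  simp only [Function.comp_apply, Finset.HasAntidiagonal.sigmaAntidiagonalEquivProd_apply]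
  rw [hx]

/-- At the origin, the Hilbert-Schmidt inner product is one sixth of the homogeneous metric. -/
theorem hasSum_gTerm {c₁ c₂ : ℝ → DiffCircle} (h₁ : SmoothCurve c₁) (h₂ : SmoothCurve c₂) :
    HasSum (gTerm (rightVelocity c₂) (rightVelocity c₁))
      (6 * ⟪originVelocity c₂, originVelocity c₁⟫_ℂ) := by
  have h := lp.hasSum_inner (𝕜 := ℂ) (originVelocity c₂) (originVelocity c₁)
  have h3 := hasSum_of_hasSum_pairs (f := fun n => vecCoef (rightVelocity c₂) n *
    conj (vecCoef (rightVelocity c₁) n)) (hasSum_of_eq h (fun i => by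
      rw [RCLike.inner_apply, originVelocity_apply h₁, originVelocity_apply h₂, vecCoef_neg,
        vecCoef_neg]
      have hp := sqrt_mul_sqrt_pnat i.1
      have hq := sqrt_mul_sqrt_pnat i.2
      simp only [map_mul, Complex.conj_I, Complex.conj_ofReal, Complex.conj_conj]
      rw [← hp, ← hq]
      push_cast
      linear_combination ((√(i.1 : ℝ) : ℂ) * (√(i.1 : ℝ) : ℂ) * ((√(i.2 : ℝ) : ℂ) *
        (√(i.2 : ℝ) : ℂ)) * vecCoef (rightVelocity c₂) ((i.1 : ℕ) + (i.2 : ℕ)) *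
        conj (vecCoef (rightVelocity c₁) ((i.1 : ℕ) + (i.2 : ℕ)))) * Complex.I_sq) rfl)
  refine hasSum_of_eq (h3.mul_left 6) (fun n => ?_) rfl
  rw [gTerm]
  ring

end

end CirclePeriod

theorem mainTheorem1 :
    ∃ Per : DiffModMob → siegelDisc,
      -- `Per` is the period map: the graph of `Per[φ]` is the polarization `T_φ(W_+)`
      (∀ φ : DiffCircle, graph (Per (toM φ)).1 = polarization φ) ∧
      -- `Per` is smooth: it carries smooth curves to smooth curves
      (∀ c : ℝ → DiffCircle, SmoothCurve c →
        ContDiff ℝ ∞ (fun t : ℝ => (Per (toM (c t))).1)) ∧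
      -- `Per` is an immersion: its differential kills exactly the zero tangent vectors of `M`
      (∀ c : ℝ → DiffCircle, SmoothCurve c →
        (deriv (fun t : ℝ => (Per (toM (c t))).1) 0 = 0 ↔
          ∀ m : ℤ, 2 ≤ |m| → vecCoef (rightVelocity c) m = 0)) ∧
      -- `Per` pulls `h` back to `g`, up to the numerical factor and with the slots of the two
      -- Hermitian pairings in opposite order
      (∀ c₁ c₂ : ℝ → DiffCircle, SmoothCurve c₁ → SmoothCurve c₂ → c₁ 0 = c₂ 0 →
        Summable (gTerm (rightVelocity c₁) (rightVelocity c₂)) ∧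
        Summable (diagEntry (siegelOp (Per (toM (c₁ 0))).1
          (deriv (fun t : ℝ => (Per (toM (c₁ t))).1) 0)
          (deriv (fun t : ℝ => (Per (toM (c₂ t))).1) 0))) ∧
        siegelMetric (Per (toM (c₁ 0))).1
          (deriv (fun t : ℝ => (Per (toM (c₁ t))).1) 0)
          (deriv (fun t : ℝ => (Per (toM (c₂ t))).1) 0) =
            (1 / 6 : ℂ) * gMetric c₂ c₁) := by
  refine ⟨periodMap, graph_period, fun c hc => contDiff_period hc,
    fun c hc => deriv_period_eq_zero_iff hc, fun c₁ c₂ h₁ h₂ h0 => ?_⟩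
  have h1 := (isSymplecticPair (c₁ 0)).hasSum_diagEntry_siegelOp
    (Y := deriv (fun t => period (c₂ t)) 0) (isSymm_deriv_period h₁)
  have h2 : hsLeft (transposeOp (opA (c₁ 0)))
      (hsRight (deriv (fun t => period (c₂ t)) 0) (opA (c₁ 0))) = originVelocity c₂ := by
    rw [originVelocity, h0]
  rw [h2] at h1
  refine ⟨(hasSum_gTerm h₂ h₁).summable, h1.summable, ?_⟩
  have h3 : gMetric c₂ c₁ = _ := (hasSum_gTerm h₁ h₂).tsum_eq
  rw [h3, ← mul_assoc, one_div, inv_mul_cancel₀ (by norm_num), one_mul]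
  exact h1.tsum_eq
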